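/- **Liouville's Theorem.** Let $U$ be a connected Riemann surface, $x$ a non-constant meromorphic function on $U$, and equip the field of meromorphic functions on $U$ with the derivation $g\mapsto g'=dg/dx$. Let $K$ be a functional differential field on $(U,x)$, i.e. a subfield of the field of meromorphic functions on $U$ that contains all complex constants and is closed under this derivation. A multivalued function on a Riemann surface is one generated by a holomorphic germ at a point through analytic continuation. An operation on multivalued functions is performed on germs of the given functions at a common point (for a composition $\phi\circ g$: on a germ of $g$ at a point $a$ and a germ of $\phi$ at $g(a)$), and its results are the multivalued functions generated by the germs so obtained. * The *generalized elementary functions of one variable* form the smallest class of multivalued functions on $\mathbb C$ that contains the complex constants, the independent variable, $\exp$, $\ln$, the powers $z^\alpha$ ($\alpha\in\mathbb C$), $\sin,\cos,\tan,\cot,\arcsin,\arccos,\arctan,\operatorname{arccot}$, and that is closed under composition, the arithmetic operations, differentiation, and solving algebraic equations $y^n+f_1y^{n-1}+\dots+f_n=0$ ($n\ge 1$). * The *generalized elementary functions over $K$* form the smallest class of multivalued functions on $U$ that contains all functions in $K$ and is closed under $g\mapsto\phi\circ g$ for every generalized elementary function $\phi$ of one variable, the arithmetic operations, the differentiation $g\mapsto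 dg/dx$, and solving algebraic equations $y^n+f_1y^{n-1}+\dots+f_n=0$ ($n\ge 1$). Let $f\in K$ and let $y$ be a (possibly multivalued) integral of $f$, that is, the multivalued function on $U$ generated by a holomorphic germ with $dy/dx=f$. Then $y$ is a generalized elementary function over $K$ if and only if there exist an integer $m\ge 0$, functions $r_0,r_1,\dots,r_m\in K$ and complex constants $\lambda_1,\dots,\lambda_m$ such that $y$ is representable in the form $$y=r_0+\sum_{i=1}^m\lambda_i\ln r_i,$$ that is, at some point of $U$ some germ of $y$ equals the germ of $r_0$ plus the sum of $\lambda_i\ell_i$, where $\ell_i$ is a holomorphic germ with $e^{\ell_i}=r_i$. -/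

import Mathlib

open Filter Topology
open scoped Manifold ContDiff

/-! ### Meromorphic functions on a Riemann surface

A Riemann surface is a Hausdorff space `U` with a complex-analytic atlas modelled on `ℂ`.
Holomorphy of `f : U → ℂ` at a point is `ContMDiffAt 𝓘(ℂ) 𝓘(ℂ) ω f p`.  A meromorphic function is
represented by a function `U → ℂ`, with two representatives identified when they agree on a
punctured neighbourhood of every point (`SameMeromorphic`). -/

section Surface

variable {U : Type*} [TopologicalSpace U] [ChartedSpace ℂ U]

/-- `f` is meromorphic on `U`: its expression in the chart at each point is meromorphic there. -/
def IsMeromorphic (f : U → ℂ) : Prop :=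
  ∀ p : U, MeromorphicAt (f ∘ (chartAt ℂ p).symm) (chartAt ℂ p p)

/-- `f` and `g` represent the same meromorphic function: they differ only at isolated points. -/
def SameMeromorphic (f g : U → ℂ) : Prop :=
  ∀ p : U, f =ᶠ[𝓝[≠] p] g

/-- The coefficient of the differential `df` at `p` in the chart at `p`. -/
noncomputable def diffCoeff (f : U → ℂ) (p : U) : ℂ :=
  deriv (f ∘ (chartAt ℂ p).symm) (chartAt ℂ p p)

/-- The derivative `df/dx`, the ratio of two meromorphic `1`-forms.  The ratio does not depend on
the chart.  Its values at poles of `f` or `x` and at zeros of `dx`, which are isolated points, are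
irrelevant. -/
noncomputable def derivAlong (x f : U → ℂ) (p : U) : ℂ :=
  diffCoeff f p / diffCoeff x p

/-- A functional differential field on `(U, x)`: a set of meromorphic functions on `U`, saturated
for the identification of representatives, containing the complex constants, and closed under
sums, products (`Subalgebra`), inverses, and the derivation `f ↦ df/dx`. -/
structure FunctionalDifferentialField (U : Type*) [TopologicalSpace U] [ChartedSpace ℂ U]
    (x : U → ℂ) extends Subalgebra ℂ (U → ℂ) where
  isMeromorphic_of_mem : ∀ {f : U → ℂ}, f ∈ carrier → IsMeromorphic f
  mem_of_same : ∀ {f g : U → ℂ}, f ∈ carrier → SameMeromorphic f g → g ∈ carrier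
  inv_mem : ∀ {f : U → ℂ}, f ∈ carrier → f⁻¹ ∈ carrier
  deriv_mem : ∀ {f : U → ℂ}, f ∈ carrier → derivAlong x f ∈ carrier

/-! ### Multivalued functions

A multivalued function on `U` is generated by a holomorphic germ at a point through analytic
continuation.  A germ is given by a point and a function, of which only the values near the
point matter. -/

/-- The germ `b = (q, g)` is a direct analytic continuation of the germ `a = (p, f)`: `g` is
holomorphic on a connected open set containing `p` and `q` and agrees with `f` near `p`. -/
def DirectContinuation (a b : U × (U → ℂ)) : Prop :=
  ∃ V : Set U, IsOpen V ∧ IsPreconnected V ∧ a.1 ∈ V ∧ b.1 ∈ V ∧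
    ContMDiffOn 𝓘(ℂ) 𝓘(ℂ) ω b.2 V ∧ a.2 =ᶠ[𝓝 a.1] b.2

/-- `b` is obtained from `a` by a finite chain of direct analytic continuations. -/
def AnalyticContinuation : U × (U → ℂ) → U × (U → ℂ) → Prop :=
  Relation.ReflTransGen DirectContinuation

end Surface

/-! ### Generalized elementary functions of one variable -/

/-- The germs of (all branches of) the basic elementary functions, at points of `ℂ`. -/
inductive IsBasicElementary : ℂ → (ℂ → ℂ) → Prop
  | const (z c : ℂ) : IsBasicElementary z (fun _ => c)
  | var (z : ℂ) : IsBasicElementary z (fun w => w)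
  | exp (z : ℂ) : IsBasicElementary z Complex.exp
  | log (z : ℂ) (l : ℂ → ℂ) (hl : AnalyticAt ℂ l z)
      (h : ∀ᶠ w in 𝓝 z, Complex.exp (l w) = w) : IsBasicElementary z l
  | pow (α z : ℂ) (l : ℂ → ℂ) (hl : AnalyticAt ℂ l z)
      (h : ∀ᶠ w in 𝓝 z, Complex.exp (l w) = w) :
      IsBasicElementary z (fun w => Complex.exp (α * l w))
  | sin (z : ℂ) : IsBasicElementary z Complex.sin
  | cos (z : ℂ) : IsBasicElementary z Complex.cos
  | tan (z : ℂ) (h : Complex.cos z ≠ 0) : IsBasicElementary z Complex.tan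
  | cot (z : ℂ) (h : Complex.sin z ≠ 0) : IsBasicElementary z Complex.cot
  | arcsin (z : ℂ) (g : ℂ → ℂ) (hg : AnalyticAt ℂ g z)
      (h : ∀ᶠ w in 𝓝 z, Complex.sin (g w) = w) : IsBasicElementary z g
  | arccos (z : ℂ) (g : ℂ → ℂ) (hg : AnalyticAt ℂ g z)
      (h : ∀ᶠ w in 𝓝 z, Complex.cos (g w) = w) : IsBasicElementary z g
  | arctan (z : ℂ) (g : ℂ → ℂ) (hg : AnalyticAt ℂ g z)
      (h : ∀ᶠ w in 𝓝 z, Complex.sin (g w) = w * Complex.cos (g w)) : IsBasicElementary z g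
  | arccot (z : ℂ) (g : ℂ → ℂ) (hg : AnalyticAt ℂ g z)
      (h : ∀ᶠ w in 𝓝 z, Complex.cos (g w) = w * Complex.sin (g w)) : IsBasicElementary z g

/-- `IsGenElementary z f`: the multivalued function generated by the germ of `f` at `z` is a
generalized elementary function of one variable.  The class is generated from the basic elementary
functions by composition, arithmetic operations, differentiation and solving algebraic equations;
operations on multivalued functions are performed on germs, so the class of germs is also closed
under analytic continuation. -/
inductive IsGenElementary : ℂ → (ℂ → ℂ) → Prop
  | basic {z : ℂ} {f : ℂ → ℂ} (hf : IsBasicElementary z f) : IsGenElementary z f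
  | continuation {z w : ℂ} {f g : ℂ → ℂ} (hf : IsGenElementary z f) (V : Set ℂ) (hV : IsOpen V)
      (hc : IsPreconnected V) (hz : z ∈ V) (hw : w ∈ V) (hg : AnalyticOnNhd ℂ g V)
      (hfg : f =ᶠ[𝓝 z] g) : IsGenElementary w g
  | comp {z : ℂ} {f g : ℂ → ℂ} (hg : IsGenElementary z g) (hf : IsGenElementary (g z) f) :
      IsGenElementary z (f ∘ g)
  | add {z : ℂ} {f g : ℂ → ℂ} (hf : IsGenElementary z f) (hg : IsGenElementary z g) :
      IsGenElementary z (f + g)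
  | sub {z : ℂ} {f g : ℂ → ℂ} (hf : IsGenElementary z f) (hg : IsGenElementary z g) :
      IsGenElementary z (f - g)
  | mul {z : ℂ} {f g : ℂ → ℂ} (hf : IsGenElementary z f) (hg : IsGenElementary z g) :
      IsGenElementary z (f * g)
  | div {z : ℂ} {f g : ℂ → ℂ} (hf : IsGenElementary z f) (hg : IsGenElementary z g)
      (h : g z ≠ 0) : IsGenElementary z (f / g)
  | deriv {z : ℂ} {f : ℂ → ℂ} (hf : IsGenElementary z f) : IsGenElementary z (deriv f)
  | algebraic {z : ℂ} {n : ℕ} (hn : 0 < n) (c : Fin n → ℂ → ℂ) (y : ℂ → ℂ)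
      (hc : ∀ i, IsGenElementary z (c i)) (hy : AnalyticAt ℂ y z)
      (h : ∀ᶠ w in 𝓝 z, y w ^ n + ∑ i, c i w * y w ^ (i : ℕ) = 0) : IsGenElementary z y

section Over

variable {U : Type*} [TopologicalSpace U] [ChartedSpace ℂ U] {x : U → ℂ}

/-- `IsGenElementaryOver K p f`: the multivalued function on `U` generated by the germ of `f` at
`p` is a generalized elementary function over `K`.  The class is generated from the functions of
`K` by composition `f ↦ φ ∘ f` with generalized elementary functions `φ` of one variable,
arithmetic operations, differentiation `f ↦ df/dx` and solving algebraic equations; operations on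
multivalued functions are performed on germs, so the class of germs is also closed under analytic
continuation. -/
inductive IsGenElementaryOver (K : FunctionalDifferentialField U x) : U → (U → ℂ) → Prop
  | base {p : U} {f : U → ℂ} (hf : f ∈ K.toSubalgebra) (hp : ContMDiffAt 𝓘(ℂ) 𝓘(ℂ) ω f p) :
      IsGenElementaryOver K p f
  | continuation {p q : U} {f g : U → ℂ} (hf : IsGenElementaryOver K p f)
      (hfg : DirectContinuation (p, f) (q, g)) : IsGenElementaryOver K q g
  | comp {p : U} {f : U → ℂ} {φ : ℂ → ℂ} (hf : IsGenElementaryOver K p f)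
      (hφ : IsGenElementary (f p) φ) : IsGenElementaryOver K p (φ ∘ f)
  | add {p : U} {f g : U → ℂ} (hf : IsGenElementaryOver K p f)
      (hg : IsGenElementaryOver K p g) : IsGenElementaryOver K p (f + g)
  | sub {p : U} {f g : U → ℂ} (hf : IsGenElementaryOver K p f)
      (hg : IsGenElementaryOver K p g) : IsGenElementaryOver K p (f - g)
  | mul {p : U} {f g : U → ℂ} (hf : IsGenElementaryOver K p f)
      (hg : IsGenElementaryOver K p g) : IsGenElementaryOver K p (f * g)
  | div {p : U} {f g : U → ℂ} (hf : IsGenElementaryOver K p f)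
      (hg : IsGenElementaryOver K p g) (h : g p ≠ 0) : IsGenElementaryOver K p (f / g)
  | deriv {p : U} {f : U → ℂ} (hf : IsGenElementaryOver K p f)
      (hx : ContMDiffAt 𝓘(ℂ) 𝓘(ℂ) ω x p) (h : diffCoeff x p ≠ 0) :
      IsGenElementaryOver K p (derivAlong x f)
  | algebraic {p : U} {n : ℕ} (hn : 0 < n) (c : Fin n → U → ℂ) (y : U → ℂ)
      (hc : ∀ i, IsGenElementaryOver K p (c i)) (hy : ContMDiffAt 𝓘(ℂ) 𝓘(ℂ) ω y p)
      (h : ∀ᶠ q in 𝓝 p, y q ^ n + ∑ i, c i q * y q ^ (i : ℕ) = 0) : IsGenElementaryOver K p y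

/-- `y`, holomorphic at `p`, generates a (multivalued) integral of `f`: `dy/dx = f` near `p`. -/
def IsIntegralGerm (x f : U → ℂ) (p : U) (y : U → ℂ) : Prop :=
  ContMDiffAt 𝓘(ℂ) 𝓘(ℂ) ω y p ∧ ∀ᶠ q in 𝓝[≠] p, derivAlong x y q = f q

/-- The multivalued function generated by the germ of `y` at `p` is representable as
`r₀ + ∑ᵢ cᵢ ln rᵢ`: at some point `q`, one of its germs is the sum of the germ of `r₀` and the
multiples by `cᵢ` of holomorphic germs `lᵢ` of `ln rᵢ`. -/
def IsSumWithLogs (p : U) (y r₀ : U → ℂ) {m : ℕ} (c : Fin m → ℂ) (r : Fin m → U → ℂ) : Prop :=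
  ∃ (q : U) (z : U → ℂ) (l : Fin m → U → ℂ),
    AnalyticContinuation (p, y) (q, z) ∧
    ContMDiffAt 𝓘(ℂ) 𝓘(ℂ) ω r₀ q ∧
    (∀ i, ContMDiffAt 𝓘(ℂ) 𝓘(ℂ) ω (l i) q ∧ ∀ᶠ t in 𝓝 q, Complex.exp (l i t) = r i t) ∧
    ∀ᶠ t in 𝓝 q, z t = r₀ t + ∑ i, c i * l i t

end Over

/-!
The theorem is reduced to Liouville's theorem in differential algebra.

*From functions to Laurent series.* At a point `q` where `x` is a local coordinate, Taylor expansion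
in `x - x(q)` (`taylorAlong`) embeds the germs holomorphic at `q` into the field `SeriesField` of
formal Laurent series, turning `d/dx` into the formal derivation. A germ is called elementary at `q`
(`IsElementaryGerm`) if its expansion is obtained from the expansions of functions of `K` by field
operations, exponentials, logarithms and algebraic equations inside this field
(`IsElementaryOver`). The constants of `SeriesField` are the complex numbers, so Liouville's theorem
applies there.

*Liouville's theorem* (`IsElementaryOver.deriv_mem_liouvilleForms`) is proved for an arbitrary
differential field of characteristic zero. Elements are adjoined one at a time, and it is shown
that the adjunction of an exponential, a logarithm or an algebraic element to a differential
subfield `M` produces no new elements of `M` of the form `∑ cᵢ uᵢ'/uᵢ + v'`. For a transcendental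
exponential or logarithm `t` this follows by comparing the polynomial parts at `t = ∞`.

*Every generalized elementary function has elementary germs*, with the possible exception of
isolated points (`IsGenElementaryOver.isElementaryNear`). The proof is by induction on the
construction of the function. The inverse trigonometric functions are logarithms of algebraic functions. Two steps are
not formal.

* Composition with a function `φ` of one variable
  (`IsElementaryNear.comp`): unless `g` is locally constant, substitution of
  the Taylor series of `g` is a homomorphism of fields of Laurent series which multiplies the
  derivation by `g'` and hence preserves elementary elements.
* Analytic continuation (`IsElementaryGerm.eventually_of_isPreconnected`): an elementary germ might
  a priori be expressed by exponentials, logarithms and algebraic functions whose continuations have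
  singularities anywhere. However, by the identity theorem the Taylor expansions at two points of a
  connected set correspond under an isomorphism `θ` of differential rings of Laurent series, and a
  differential homomorphism `θ` in general position preserves elementary elements
  (`IsElementaryOver.exists_forall_hom`). Indeed, the constant term of `θ` extends to a finitely
  generated differential ring over which the elementary expression is defined, by the existence of
  points of varieties over `ℂ`, and the formal Taylor series of the extension extend `θ`. General
  position excludes only isolated points.

*Conclusion.* If the integral `y` of `f` is generalized elementary, then `f` is a sum of
logarithmic derivatives and a derivative of functions of `K` near some point
(`exists_eq_sum_logDeriv`), and termwise integration gives the representation of `y`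
(`eventually_eq_add_sum_log`). Conversely, a function represented in this way is generalized
elementary at some point, and analytic continuation can be reversed.
-/

/-! ### Liouville forms and algebraic extensions -/

open Differential Polynomial in
/-- The additive group of *Liouville forms* over a subfield `M` of a differential field: the sums
`∑ cᵢ uᵢ'/uᵢ + v'` with constants `cᵢ` and with `uᵢ, v ∈ M`. -/
def liouvilleForms {N : Type*} [Field N] [Differential N] (M : Subfield N) : AddSubgroup N :=
  AddSubgroup.closure ({a | ∃ c u, c′ = 0 ∧ u ∈ M ∧ a = c * logDeriv u} ∪ {a | ∃ v ∈ M, a = v′})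

/-- A subfield closed under the derivation and containing all constants. -/
structure IsDifferentialSubfield {N : Type*} [Field N] [Differential N] (M : Subfield N) :
    Prop where
  deriv_mem : ∀ a ∈ M, Differential.deriv a ∈ M
  const_mem : ∀ a : N, Differential.deriv a = 0 → a ∈ M

section Liouville

open Differential Polynomial

variable {N : Type*} [Field N] [Differential N] {M L : Subfield N}

lemma mul_logDeriv_mem_liouvilleForms {c u : N} (hc : c′ = 0) (hu : u ∈ M) :
    c * logDeriv u ∈ liouvilleForms M :=
  AddSubgroup.subset_closure (Or.inl ⟨c, u, hc, hu, rfl⟩)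

lemma deriv_mem_liouvilleForms {v : N} (hv : v ∈ M) : v′ ∈ liouvilleForms M :=
  AddSubgroup.subset_closure (Or.inr ⟨v, hv, rfl⟩)

lemma deriv_inv_field (a : N) : (a⁻¹)′ = -(a⁻¹ ^ 2) * a′ := by
  rcases eq_or_ne a 0 with rfl | ha
  · simp
  · have h : (a * a⁻¹)′ = 0 := by rw [mul_inv_cancel₀ ha]; simp
    rw [Derivation.leibniz, smul_eq_mul, smul_eq_mul] at h
    field_simp at h ⊢
    linear_combination h

/-- The derivation of a differential subfield. -/
@[reducible]
def IsDifferentialSubfield.differential (hM : IsDifferentialSubfield M) : Differential M where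
  deriv := Derivation.mk'
    { toFun := fun a => ⟨(a : N)′, hM.deriv_mem a a.2⟩
      map_add' := fun a b => Subtype.ext (by simp)
      map_smul' := fun n a => Subtype.ext (by simp) }
    (fun a b => Subtype.ext (by simp))

lemma IsDifferentialSubfield.differentialAlgebra (hM : IsDifferentialSubfield M) :
    letI := hM.differential
    DifferentialAlgebra M N :=
  let _ := hM.differential
  ⟨fun _ => rfl⟩

/-- A Liouville form is a finite sum indexed by a type. -/
lemma exists_sum_of_mem_liouvilleForms {a : N} (ha : a ∈ liouvilleForms M) :
    ∃ (ι : Type) (_ : Fintype ι) (c u : ι → N) (v : N), (∀ i, (c i)′ = 0) ∧ (∀ i, u i ∈ M) ∧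
      v ∈ M ∧ a = ∑ i, c i * logDeriv (u i) + v′ := by
  induction ha using AddSubgroup.closure_induction with
  | mem x hx =>
    rcases hx with ⟨c, u, hc, hu, rfl⟩ | ⟨v, hv, rfl⟩
    · exact ⟨Unit, inferInstance, fun _ => c, fun _ => u, 0, fun _ => hc, fun _ => hu,
        M.zero_mem, by simp⟩
    · exact ⟨Empty, inferInstance, fun _ => 0, fun _ => 0, v, by simp, by simp, hv, by simp⟩
  | zero => exact ⟨Empty, inferInstance, fun _ => 0, fun _ => 0, 0, by simp, by simp,
      M.zero_mem, by simp⟩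
  | add x y _ _ ihx ihy =>
    obtain ⟨ι, _, c, u, v, hc, hu, hv, rfl⟩ := ihx
    obtain ⟨κ, _, d, w, z, hd, hw, hz, rfl⟩ := ihy
    refine ⟨ι ⊕ κ, inferInstance, Sum.elim c d, Sum.elim u w, v + z, ?_, ?_,
      M.add_mem hv hz, ?_⟩
    · rintro (i | i) <;> simp [hc, hd]
    · rintro (i | i) <;> simp [hu, hw]
    · simp; ring
  | neg x _ ihx =>
    obtain ⟨ι, _, c, u, v, hc, hu, hv, rfl⟩ := ihx
    refine ⟨ι, inferInstance, fun i => -c i, u, -v, by simp [hc], hu, M.neg_mem hv, ?_⟩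
    simp [Finset.sum_neg_distrib]; ring

/-- The algebraic step of Liouville's theorem. -/
lemma exists_differentialSubfield_of_algebraic [CharZero N] (hM : IsDifferentialSubfield M) {t : N}
    (ht : IsAlgebraic M t) :
    ∃ L : Subfield N, M ≤ L ∧ t ∈ L ∧ IsDifferentialSubfield L ∧
      ∀ a ∈ M, a ∈ liouvilleForms L → a ∈ liouvilleForms M := by
  let _ := hM.differential
  have := hM.differentialAlgebra
  let B : IntermediateField M N := IntermediateField.adjoin M {t}
  have : FiniteDimensional M B := IntermediateField.adjoin.finiteDimensional ht.isIntegral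
  have hML : M ≤ B.toSubfield := fun a ha => B.algebraMap_mem ⟨a, ha⟩
  have hd (b : B) : (b : N)′ = ((b′ : B) : N) := deriv_algebraMap (A := B) (B := N) b
  refine ⟨B.toSubfield, hML, IntermediateField.mem_adjoin_simple_self M t,
    ⟨fun a ha => ?_, fun a ha => hML (hM.const_mem a ha)⟩, fun a ha haL => ?_⟩
  · rw [show a = ((⟨a, ha⟩ : B) : N) from rfl, hd]
    exact (Differential.deriv (⟨a, ha⟩ : B)).2
  · obtain ⟨ι, _, c, u, v, hc, hu, hv, h⟩ := exists_sum_of_mem_liouvilleForms haL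
    have key := (isLiouville_of_finiteDimensional (F := M) (K := B)).isLiouville ⟨a, ha⟩ ι
      (fun i => ⟨c i, hM.const_mem _ (hc i)⟩) (fun i => Subtype.ext (hc i))
      (fun i => ⟨u i, hu i⟩) ⟨v, hv⟩ (by
        apply Subtype.ext
        simp only [IntermediateField.coe_add, IntermediateField.coe_sum,
          IntermediateField.coe_mul]
        refine h.trans ?_
        congr 1
        · refine Finset.sum_congr rfl fun i _ => ?_
          congr 1
          exact logDeriv_algebraMap (F := B) (K := N) ⟨u i, hu i⟩
        · exact hd ⟨v, hv⟩)
    obtain ⟨κ, _, c₀, hc₀, u₀, v₀, h₀⟩ := key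
    have h₁ : a = ∑ i, (c₀ i : N) * logDeriv (u₀ i : N) + (v₀ : N)′ := by
      have := congrArg (algebraMap M N) h₀
      simp only [map_add, map_sum, map_mul, ← logDeriv_algebraMap, ← deriv_algebraMap] at this
      exact this
    rw [h₁]
    refine add_mem (sum_mem fun i _ => mul_logDeriv_mem_liouvilleForms ?_ (u₀ i).2)
      (deriv_mem_liouvilleForms v₀.2)
    exact congrArg Subtype.val (hc₀ i)

end Liouville

/-! ### Transcendental exponentials and logarithms -/

section Transcendental

open Differential Polynomial

variable {F N : Type*} [Field F] [Field N] [Algebra F N] {t : N}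

/-- The values at `t` of the rational functions over `F` of negative degree, that is, of those
vanishing at infinity. -/
def IsProperFraction (F : Type*) {N : Type*} [Field F] [Field N] [Algebra F N] (t a : N) : Prop :=
  ∃ R S : F[X], S ≠ 0 ∧ R.degree < S.degree ∧ a = aeval t R / aeval t S

lemma IsProperFraction.zero : IsProperFraction F t (0 : N) :=
  ⟨0, 1, one_ne_zero, by simp, by simp⟩

lemma IsProperFraction.add (ht : Transcendental F t) {a b : N} (ha : IsProperFraction F t a)
    (hb : IsProperFraction F t b) : IsProperFraction F t (a + b) := by
  obtain ⟨R, S, hS, hRS, rfl⟩ := ha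
  obtain ⟨R', S', hS', hRS', rfl⟩ := hb
  have h0 (P : F[X]) (hP : P ≠ 0) : aeval t P ≠ 0 :=
    fun h => hP ((transcendental_iff.1 ht) P h)
  refine ⟨R * S' + S * R', S * S', mul_ne_zero hS hS', ?_, ?_⟩
  · refine (degree_add_le _ _).trans_lt (max_lt ?_ ?_)
    · rw [degree_mul, degree_mul]
      exact WithBot.add_lt_add_right (by simpa using hS') hRS
    · rw [degree_mul, degree_mul]
      exact WithBot.add_lt_add_left (by simpa using hS) hRS'
  · have := h0 S hS
    have := h0 S' hS'
    simp only [map_add, map_mul]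
    field_simp

lemma IsProperFraction.smul {a : N} (c : N) (hc : c ∈ (algebraMap F N).range)
    (ha : IsProperFraction F t a) : IsProperFraction F t (c * a) := by
  obtain ⟨R, S, hS, hRS, rfl⟩ := ha
  obtain ⟨c, rfl⟩ := hc
  refine ⟨C c * R, S, hS, (C_mul' c R ▸ degree_smul_le c R).trans_lt hRS, ?_⟩
  simp [mul_div_assoc]

/-- A rational function vanishing at infinity is a polynomial only if it is zero. -/
lemma IsProperFraction.eq_zero (ht : Transcendental F t) {P : F[X]}
    (h : IsProperFraction F t (aeval t P)) : P = 0 := by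
  obtain ⟨R, S, hS, hRS, h⟩ := h
  have h0 : aeval t S ≠ 0 := fun h => hS ((transcendental_iff.1 ht) S h)
  rw [eq_div_iff h0, ← map_mul] at h
  have h1 : P * S = R := by
    have := (transcendental_iff.1 ht) (P * S - R) (by rw [map_sub, h, sub_self])
    exact sub_eq_zero.1 this
  by_contra hP
  rw [← h1, degree_mul, degree_eq_natDegree hP, degree_eq_natDegree hS] at hRS
  norm_cast at hRS
  lia

lemma degree_sub_C_mul_lt {P Q : F[X]} (hP : P ≠ 0) {l : F}
    (hlt : ∀ n, P.natDegree < n → Q.coeff n = 0)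
    (hl : Q.coeff P.natDegree = l * P.leadingCoeff) : (Q - C l * P).degree < P.degree := by
  rw [degree_eq_natDegree hP, degree_lt_iff_coeff_zero]
  intro n hn
  have hn' : P.natDegree ≤ n := hn
  rcases hn'.eq_or_lt with rfl | h
  · simp [hl]
  · simp [hlt n h, coeff_eq_zero_of_natDegree_lt h]

variable [Differential F] [Differential N] [DifferentialAlgebra F N] {M : Subfield N} {w : F[X]}

/-- Expansion at infinity: modulo rational functions of `t` vanishing at infinity, a Liouville form
over `F(t)` is a Liouville form over the ground field plus the derivative of a polynomial in `t`.
The hypothesis `hlead` says that the logarithmic derivative of a polynomial in `t` has at infinity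
a finite value, which is itself a Liouville form. -/
lemma exists_of_mem_liouvilleForms_adjoin (hcM : ∀ c : N, c′ = 0 → c ∈ (algebraMap F N).range)
    (ht : Transcendental F t) (hw : t′ = aeval t w)
    (hlead : ∀ P : F[X], P ≠ 0 → ∃ l : F, (∀ c : N, c′ = 0 →
      c * algebraMap F N l ∈ liouvilleForms M) ∧ (implicitDeriv w P - C l * P).degree < P.degree)
    {a : N} (ha : a ∈ liouvilleForms (IntermediateField.adjoin F {t}).toSubfield) :
    ∃ e ∈ liouvilleForms M, ∃ q : F[X], ∃ r, IsProperFraction F t r ∧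
      a = e + aeval t (implicitDeriv w q) + r := by
  have h0 (P : F[X]) (hP : P ≠ 0) : aeval t P ≠ 0 :=
    fun h => hP ((transcendental_iff.1 ht) P h)
  have hd (P : F[X]) : (aeval t P)′ = aeval t (implicitDeriv w P) :=
    deriv_aeval_eq_implicitDeriv t w hw P
  have hneg : ∀ r, IsProperFraction F t r → IsProperFraction F t (-r) := fun r hr => by
    simpa using hr.smul (-1) ⟨-1, by simp⟩
  have hlog (P : F[X]) (hP : P ≠ 0) (c : N) (hc : c′ = 0) : ∃ e ∈ liouvilleForms M, ∃ r,
      IsProperFraction F t r ∧ c * logDeriv (aeval t P) = e + r := by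
    obtain ⟨l, hl, hdeg⟩ := hlead P hP
    refine ⟨_, hl c hc, _, IsProperFraction.smul c (hcM c hc) ⟨_, P, hP, hdeg, rfl⟩, ?_⟩
    have := h0 P hP
    rw [Differential.logDeriv, hd]
    simp only [map_sub, map_mul, aeval_C]
    field_simp
    ring
  have hdle (P : F[X]) : (implicitDeriv w P).degree ≤ P.degree := by
    rcases eq_or_ne P 0 with rfl | hP
    · simp
    obtain ⟨l, -, hdeg⟩ := hlead P hP
    rw [show implicitDeriv w P = (implicitDeriv w P - C l * P) + C l * P by ring]
    exact (degree_add_le _ _).trans (max_le hdeg.le (C_mul' l P ▸ degree_smul_le l P))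
  induction ha using AddSubgroup.closure_induction with
  | mem x hx =>
    rcases hx with ⟨c, u, hc, hu, rfl⟩ | ⟨v, hv, rfl⟩
    · obtain ⟨R, S, rfl⟩ := IntermediateField.mem_adjoin_simple_iff F u |>.1 hu
      rcases eq_or_ne R 0 with rfl | hR
      · exact ⟨0, zero_mem _, 0, 0, .zero, by simp⟩
      rcases eq_or_ne S 0 with rfl | hS
      · exact ⟨0, zero_mem _, 0, 0, .zero, by simp⟩
      obtain ⟨e, he, r, hr, h⟩ := hlog R hR c hc
      obtain ⟨e', he', r', hr', h'⟩ := hlog S hS c hc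
      refine ⟨e - e', sub_mem he he', 0, r + -r', hr.add ht (hneg _ hr'), ?_⟩
      rw [logDeriv_div _ _ (h0 R hR) (h0 S hS), mul_sub, h, h']
      simp
      ring
    · obtain ⟨R, S, rfl⟩ := IntermediateField.mem_adjoin_simple_iff F v |>.1 hv
      rcases eq_or_ne S 0 with rfl | hS
      · exact ⟨0, zero_mem _, 0, 0, .zero, by simp⟩
      -- split off the polynomial part of the fraction
      refine ⟨0, zero_mem _, R / S, (aeval t (R % S) / aeval t S)′, ?_, ?_⟩
      · refine ⟨implicitDeriv w (R % S) * S - (R % S) * implicitDeriv w S, S * S,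
          mul_ne_zero hS hS, ?_, ?_⟩
        · have hlt : (R % S).degree < S.degree := EuclideanDomain.mod_lt R hS
          refine (degree_sub_le _ _).trans_lt (max_lt ?_ ?_)
          · rw [degree_mul, degree_mul]
            exact WithBot.add_lt_add_right (by simpa using hS) ((hdle _).trans_lt hlt)
          · rw [degree_mul, degree_mul]
            refine (add_le_add_right (hdle S) _).trans_lt ?_
            exact WithBot.add_lt_add_right (by simpa using hS) hlt
        · have := h0 S hS
          rw [Derivation.leibniz_div, hd, hd]
          simp only [smul_eq_mul, map_sub, map_mul]
          field_simp
      · rw [zero_add, ← hd, ← map_add]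
        congr 1
        have := h0 S hS
        field_simp
        rw [← map_mul, ← map_add]
        congr 1
        exact (EuclideanDomain.div_add_mod R S).symm
  | zero => exact ⟨0, zero_mem _, 0, 0, .zero, by simp⟩
  | add x y _ _ ihx ihy =>
    obtain ⟨e, he, q, r, hr, rfl⟩ := ihx
    obtain ⟨e', he', q', r', hr', rfl⟩ := ihy
    exact ⟨e + e', add_mem he he', q + q', r + r', hr.add ht hr', by simp; ring⟩
  | neg x _ ihx =>
    obtain ⟨e, he, q, r, hr, rfl⟩ := ihx
    exact ⟨-e, neg_mem he, -q, -r, hneg _ hr, by simp; ring⟩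

lemma coeff_implicitDeriv_C (b : F) (P : F[X]) (n : ℕ) :
    (implicitDeriv (C b) P).coeff n = (P.coeff n)′ + b * (P.coeff (n + 1) * (n + 1)) := by
  simp [implicitDeriv, coeff_derivative]

lemma coeff_implicitDeriv_C_mul_X (b : F) (P : F[X]) (n : ℕ) :
    (implicitDeriv (C b * X) P).coeff n = (P.coeff n)′ + b * (n * P.coeff n) := by
  simp only [implicitDeriv, Derivation.coe_add, Pi.add_apply, coeff_add, coeff_mapCoeffs,
    Derivation.coe_smul, Pi.smul_apply, smul_eq_mul, mul_assoc, coeff_C_mul,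
    Derivation.restrictScalars_apply, derivative'_apply]
  cases n with
  | zero => simp
  | succ n => simp [coeff_X_mul, coeff_derivative]; ring_nf; simp

/-- If in addition the Liouville form over `F(t)` lies in the ground field, then the part vanishing
at infinity is zero. -/
lemma exists_implicitDeriv_eq_C_of_mem_liouvilleForms
    (hM : ∀ a : N, a ∈ M ↔ a ∈ (algebraMap F N).range)
    (hcM : ∀ c : N, c′ = 0 → c ∈ (algebraMap F N).range)
    (ht : Transcendental F t) (hw : t′ = aeval t w)
    (hlead : ∀ P : F[X], P ≠ 0 → ∃ l : F, (∀ c : N, c′ = 0 →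
      c * algebraMap F N l ∈ liouvilleForms M) ∧ (implicitDeriv w P - C l * P).degree < P.degree)
    {a : N} (haM : a ∈ M)
    (ha : a ∈ liouvilleForms (IntermediateField.adjoin F {t}).toSubfield) :
    ∃ e ∈ liouvilleForms M, ∃ (q : F[X]) (f : F), implicitDeriv w q = C f ∧
      a = e + algebraMap F N f := by
  obtain ⟨e, he, q, r, hr, h⟩ :=
    exists_of_mem_liouvilleForms_adjoin hcM ht hw hlead ha
  have hMd : ∀ b ∈ M, b′ ∈ M := fun b hb => by
    obtain ⟨b, rfl⟩ := (hM b).1 hb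
    exact (hM _).2 ⟨b′, (deriv_algebraMap b).symm⟩
  have heM : e ∈ M := by
    have : liouvilleForms M ≤ M.toAddSubgroup := by
      refine (AddSubgroup.closure_le _).2 ?_
      rintro _ (⟨c, u, hc, hu, rfl⟩ | ⟨v, hv, rfl⟩)
      · exact M.mul_mem ((hM c).2 (hcM c hc)) (M.div_mem (hMd u hu) hu)
      · exact hMd v hv
    exact this he
  obtain ⟨f, hf⟩ := (hM _).1 (M.sub_mem haM heM)
  have hr' : r = aeval t (C f - implicitDeriv w q) := by
    rw [map_sub, aeval_C, hf, h]
    ring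
  refine ⟨e, he, q, f, ?_, by rw [hf]; ring⟩
  exact (sub_eq_zero.1 (IsProperFraction.eq_zero ht (hr' ▸ hr))).symm

/-- The logarithmic step of Liouville's theorem: `t` is a transcendental logarithm of `b`. -/
lemma mem_liouvilleForms_of_log [CharZero N] (hM : ∀ a : N, a ∈ M ↔ a ∈ (algebraMap F N).range)
    (hcM : ∀ c : N, c′ = 0 → c ∈ (algebraMap F N).range)
    (ht : Transcendental F t) {b : F} (hb : t′ = algebraMap F N (Differential.logDeriv b))
    {a : N} (haM : a ∈ M)
    (haL : a ∈ liouvilleForms (IntermediateField.adjoin F {t}).toSubfield) :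
    a ∈ liouvilleForms M := by
  have : CharZero F := (algebraMap F N).charZero_iff (algebraMap F N).injective |>.2 ‹_›
  have hM' (a : F) : algebraMap F N a ∈ M := (hM _).2 ⟨a, rfl⟩
  set β := Differential.logDeriv b with hβ
  obtain ⟨e, he, q, f, hq, rfl⟩ := exists_implicitDeriv_eq_C_of_mem_liouvilleForms (w := C β)
    hM hcM ht (by simpa using hb) (fun P hP => by
      refine ⟨Differential.logDeriv P.leadingCoeff, fun c hc => ?_,
        degree_sub_C_mul_lt hP (fun n hn => ?_) ?_⟩
      · rw [← logDeriv_algebraMap]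
        exact mul_logDeriv_mem_liouvilleForms hc (hM' _)
      · rw [coeff_implicitDeriv_C, coeff_eq_zero_of_natDegree_lt hn,
          coeff_eq_zero_of_natDegree_lt (hn.trans (Nat.lt_succ_self n))]
        simp
      · rw [coeff_implicitDeriv_C, coeff_eq_zero_of_natDegree_lt (Nat.lt_succ_self _)]
        have := leadingCoeff_ne_zero.2 hP
        simp [Differential.logDeriv, this]) haM haL
  have hco (n : ℕ) : (q.coeff n)′ + β * (q.coeff (n + 1) * (n + 1)) = (C f).coeff n := by
    rw [← coeff_implicitDeriv_C, hq]
  -- otherwise `q_{d-1} + d q_d t`, where `d` is the degree of `q`, would be a constant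
  have hdeg : q.natDegree ≤ 1 := by
    by_contra! hlt
    obtain ⟨d, hd⟩ : ∃ d, q.natDegree = d + 2 := ⟨q.natDegree - 2, by lia⟩
    have hlc : q.coeff (d + 2) ≠ 0 := by
      rw [← hd]
      exact leadingCoeff_ne_zero.2 (fun h => by simp [h] at hd)
    have h1 : (q.coeff (d + 2))′ = 0 := by
      have := hco (d + 2)
      rwa [coeff_eq_zero_of_natDegree_lt (n := d + 2 + 1) (by lia), coeff_C_of_ne_zero (by lia),
        zero_mul, mul_zero, add_zero] at this
    have h2 : (q.coeff (d + 1))′ + β * (q.coeff (d + 2) * ((d + 1 : ℕ) + 1)) = 0 := by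
      rw [hco (d + 1), coeff_C_of_ne_zero (by lia)]
    obtain ⟨g, hg⟩ := hcM (algebraMap F N (q.coeff (d + 1)) +
        algebraMap F N (q.coeff (d + 2) * ((d + 1 : ℕ) + 1)) * t) (by
      have h3 : (q.coeff (d + 2) * ((d + 1 : ℕ) + 1))′ = 0 := by
        simp [Derivation.leibniz, h1, -Nat.cast_add, ← Nat.cast_add_one]
      rw [map_add, Derivation.leibniz, deriv_algebraMap, deriv_algebraMap, h3, hb, smul_eq_mul,
        map_zero, smul_zero, add_zero, ← map_mul, ← map_add, mul_comm _ β, h2, map_zero])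
    refine ht ⟨C (q.coeff (d + 2) * ((d + 1 : ℕ) + 1)) * X + C (q.coeff (d + 1) - g), ?_, ?_⟩
    · intro h
      have := congrArg (coeff · 1) h
      simp only [coeff_add, coeff_C_mul, coeff_X_one, coeff_C_succ, coeff_zero, mul_one,
        add_zero, mul_eq_zero, hlc, false_or] at this
      norm_cast at this
    · simp only [map_add, map_mul, aeval_C, aeval_X, map_sub, hg]
      push_cast
      ring
  refine add_mem he ?_
  have h0 := hco 0
  have h1 := hco 1
  rw [coeff_eq_zero_of_natDegree_lt (n := 1 + 1) (by lia), coeff_C_of_ne_zero one_ne_zero,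
    zero_mul, mul_zero, add_zero] at h1
  rw [coeff_C_zero] at h0
  have : algebraMap F N f = algebraMap F N (q.coeff 1) * Differential.logDeriv (algebraMap F N b)
      + (algebraMap F N (q.coeff 0))′ := by
    rw [← h0, logDeriv_algebraMap, deriv_algebraMap, ← map_mul, ← map_add]
    congr 1
    push_cast
    ring
  rw [this]
  exact add_mem (mul_logDeriv_mem_liouvilleForms (by rw [deriv_algebraMap, h1, map_zero]) (hM' _))
    (deriv_mem_liouvilleForms (hM' _))

/-- The exponential step of Liouville's theorem: `t` is a transcendental exponential of `b`. -/
lemma mem_liouvilleForms_of_exp (hM : ∀ a : N, a ∈ M ↔ a ∈ (algebraMap F N).range)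
    (hcM : ∀ c : N, c′ = 0 → c ∈ (algebraMap F N).range)
    (ht : Transcendental F t) {b : F} (hb : t′ = algebraMap F N b′ * t)
    {a : N} (haM : a ∈ M)
    (haL : a ∈ liouvilleForms (IntermediateField.adjoin F {t}).toSubfield) :
    a ∈ liouvilleForms M := by
  have hM' (a : F) : algebraMap F N a ∈ M := (hM _).2 ⟨a, rfl⟩
  obtain ⟨e, he, q, f, hq, rfl⟩ := exists_implicitDeriv_eq_C_of_mem_liouvilleForms
    (w := C b′ * X) hM hcM ht (by simpa using hb) (fun P hP => by
      refine ⟨Differential.logDeriv P.leadingCoeff + (P.natDegree * b)′, fun c hc => ?_,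
        degree_sub_C_mul_lt hP (fun n hn => ?_) ?_⟩
      · rw [map_add, mul_add, ← logDeriv_algebraMap, ← deriv_algebraMap]
        refine add_mem (mul_logDeriv_mem_liouvilleForms hc (hM' _)) ?_
        have : c * (algebraMap F N (P.natDegree * b))′ =
            (c * algebraMap F N (P.natDegree * b))′ := by
          simp [Derivation.leibniz, hc]
        rw [this]
        exact deriv_mem_liouvilleForms (M.mul_mem ((hM _).2 (hcM c hc)) (hM' _))
      · rw [coeff_implicitDeriv_C_mul_X, coeff_eq_zero_of_natDegree_lt hn]
        simp
      · rw [coeff_implicitDeriv_C_mul_X]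
        have := leadingCoeff_ne_zero.2 hP
        simp [Differential.logDeriv, Derivation.leibniz]
        field_simp) haM haL
  have h0 := coeff_implicitDeriv_C_mul_X b′ q 0
  rw [hq, coeff_C_zero] at h0
  refine add_mem he ?_
  have : algebraMap F N f = (algebraMap F N (q.coeff 0))′ := by
    rw [deriv_algebraMap, h0]
    simp
  rw [this]
  exact deriv_mem_liouvilleForms (hM' _)

end Transcendental

/-! ### Liouville's theorem for differential fields -/

open Differential Polynomial in
/-- The elements of a differential field `N` that are elementary over a set `S`: they are obtained
from `S` and the constants by field operations, exponentials, logarithms and the solution of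
algebraic equations within `N`.  Algebraic equations are required to have the solution as a simple
root; `IsElementaryOver.of_isRoot` removes this restriction. -/
inductive IsElementaryOver {N : Type*} [Field N] [Differential N] (S : Set N) : N → Prop
  | base {a : N} (ha : a ∈ S) : IsElementaryOver S a
  | const {c : N} (hc : c′ = 0) : IsElementaryOver S c
  | add {a b : N} (ha : IsElementaryOver S a) (hb : IsElementaryOver S b) :
      IsElementaryOver S (a + b)
  | mul {a b : N} (ha : IsElementaryOver S a) (hb : IsElementaryOver S b) :
      IsElementaryOver S (a * b)
  | inv {a : N} (ha : IsElementaryOver S a) : IsElementaryOver S a⁻¹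
  | exp {a b : N} (ha : IsElementaryOver S a) (hb : b′ = a′ * b) : IsElementaryOver S b
  | log {a b : N} (ha : IsElementaryOver S a) (h0 : a ≠ 0) (hb : a * b′ = a′) :
      IsElementaryOver S b
  | alg (P : N[X]) {b : N} (hP : ∀ i, IsElementaryOver S (P.coeff i)) (hb : P.eval b = 0)
      (hb' : P.derivative.eval b ≠ 0) : IsElementaryOver S b

section Liouville

open Differential Polynomial

variable {N : Type*} [Field N] [Differential N] {M : Subfield N} {S : Set N}

lemma isDifferentialSubfield_adjoin_simple (hM : IsDifferentialSubfield M) {t : N}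
    (ht : t′ ∈ IntermediateField.adjoin M {t}) :
    IsDifferentialSubfield (IntermediateField.adjoin M {t}).toSubfield := by
  let _ := hM.differential
  have := hM.differentialAlgebra
  have hp (P : M[X]) : aeval t P ∈ IntermediateField.adjoin M {t} :=
    IntermediateField.algebra_adjoin_le_adjoin M {t} (aeval_mem_adjoin_singleton M t)
  refine ⟨fun a ha => ?_, fun a ha =>
    (IntermediateField.adjoin M {t}).algebraMap_mem ⟨a, hM.const_mem a ha⟩⟩
  obtain ⟨R, Q, rfl⟩ := IntermediateField.mem_adjoin_simple_iff M a |>.1 ha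
  rw [Derivation.leibniz_div, deriv_aeval_eq, deriv_aeval_eq]
  simp only [smul_eq_mul]
  change _ ∈ IntermediateField.adjoin M {t}
  exact mul_mem (pow_mem (inv_mem (hp _)) 2) (sub_mem
    (mul_mem (hp _) (add_mem (hp _) (mul_mem (hp _) ht)))
    (mul_mem (hp _) (add_mem (hp _) (mul_mem (hp _) ht))))

/-- Adjoining an exponential or a logarithm, algebraic or not, to a differential subfield. -/
lemma exists_differentialSubfield_of_exp_or_log [CharZero N] (hM : IsDifferentialSubfield M)
    {t b : N} (hb : b ∈ M) (ht : t′ = b′ * t ∨ t′ = Differential.logDeriv b) :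
    ∃ L : Subfield N, M ≤ L ∧ t ∈ L ∧ IsDifferentialSubfield L ∧
      ∀ a ∈ M, a ∈ liouvilleForms L → a ∈ liouvilleForms M := by
  by_cases halg : IsAlgebraic M t
  · exact exists_differentialSubfield_of_algebraic hM halg
  let _ := hM.differential
  have := hM.differentialAlgebra
  have hM' (a : N) : a ∈ M ↔ a ∈ (algebraMap M N).range :=
    ⟨fun h => ⟨⟨a, h⟩, rfl⟩, fun ⟨b, hb⟩ => hb ▸ b.2⟩
  have hcM (c : N) (hc : c′ = 0) : c ∈ (algebraMap M N).range := (hM' c).1 (hM.const_mem c hc)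
  have hML (a : N) (ha : a ∈ M) : a ∈ IntermediateField.adjoin M {t} :=
    (IntermediateField.adjoin M {t}).algebraMap_mem ⟨a, ha⟩
  have htL := IntermediateField.mem_adjoin_simple_self M t
  refine ⟨(IntermediateField.adjoin M {t}).toSubfield, hML, htL, ?_, fun a haM haL => ?_⟩
  · refine isDifferentialSubfield_adjoin_simple hM ?_
    rcases ht with ht | ht <;> rw [ht]
    · exact mul_mem (hML _ (hM.deriv_mem b hb)) htL
    · exact hML _ (M.div_mem (hM.deriv_mem b hb) hb)
  · rcases ht with ht | ht
    · exact mem_liouvilleForms_of_exp hM' hcM halg (b := ⟨b, hb⟩) ht haM haL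
    · exact mem_liouvilleForms_of_log hM' hcM halg (b := ⟨b, hb⟩)
        (ht.trans (logDeriv_algebraMap (F := M) (K := N) ⟨b, hb⟩)) haM haL

/-- **Liouville's theorem**, in the form that is proved by induction: an element elementary over
`S` can be adjoined to every differential subfield containing `S` without creating new Liouville
forms. -/
lemma IsElementaryOver.exists_differentialSubfield [CharZero N] {b : N}
    (hb : IsElementaryOver S b) (hM : IsDifferentialSubfield M) (hS : S ⊆ M) :
    ∃ L : Subfield N, M ≤ L ∧ b ∈ L ∧ IsDifferentialSubfield L ∧
      ∀ a ∈ M, a ∈ liouvilleForms L → a ∈ liouvilleForms M := by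
  induction hb generalizing M with
  | base ha => exact ⟨M, le_rfl, hS ha, hM, fun _ _ h => h⟩
  | const hc => exact ⟨M, le_rfl, hM.const_mem _ hc, hM, fun _ _ h => h⟩
  | add _ _ iha ihb =>
    obtain ⟨L, hL, haL, hLd, h⟩ := iha hM hS
    obtain ⟨L', hL', hbL, hLd', h'⟩ := ihb hLd (hS.trans hL)
    exact ⟨L', hL.trans hL', add_mem (hL' haL) hbL, hLd', fun a ha h₁ =>
      h a ha (h' a (hL ha) h₁)⟩
  | mul _ _ iha ihb =>
    obtain ⟨L, hL, haL, hLd, h⟩ := iha hM hS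
    obtain ⟨L', hL', hbL, hLd', h'⟩ := ihb hLd (hS.trans hL)
    exact ⟨L', hL.trans hL', mul_mem (hL' haL) hbL, hLd', fun a ha h₁ =>
      h a ha (h' a (hL ha) h₁)⟩
  | inv _ iha =>
    obtain ⟨L, hL, haL, hLd, h⟩ := iha hM hS
    exact ⟨L, hL, inv_mem haL, hLd, h⟩
  | exp _ hb iha =>
    obtain ⟨L, hL, haL, hLd, h⟩ := iha hM hS
    obtain ⟨L', hL', hbL, hLd', h'⟩ := exists_differentialSubfield_of_exp_or_log hLd haL (.inl hb)
    exact ⟨L', hL.trans hL', hbL, hLd', fun a ha h₁ => h a ha (h' a (hL ha) h₁)⟩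
  | @log _ b' _ h0 hb iha =>
    obtain ⟨L, hL, haL, hLd, h⟩ := iha hM hS
    obtain ⟨L', hL', hbL, hLd', h'⟩ := exists_differentialSubfield_of_exp_or_log hLd haL
      (t := b') (.inr (by rw [Differential.logDeriv, ← hb, mul_div_cancel_left₀ _ h0]))
    exact ⟨L', hL.trans hL', hbL, hLd', fun a ha h₁ => h a ha (h' a (hL ha) h₁)⟩
  | @alg P b _ hb hb' ih =>
    have key (n : ℕ) : ∃ L : Subfield N, M ≤ L ∧ (∀ i < n, P.coeff i ∈ L) ∧
        IsDifferentialSubfield L ∧ ∀ a ∈ M, a ∈ liouvilleForms L → a ∈ liouvilleForms M := by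
      induction n with
      | zero => exact ⟨M, le_rfl, by simp, hM, fun _ _ h => h⟩
      | succ n ihn =>
        obtain ⟨L, hL, haL, hLd, h⟩ := ihn
        obtain ⟨L', hL', hbL, hLd', h'⟩ := ih n hLd (hS.trans hL)
        refine ⟨L', hL.trans hL', fun i hi => ?_, hLd', fun a ha h₁ => h a ha (h' a (hL ha) h₁)⟩
        rcases (Nat.lt_succ_iff.1 hi).eq_or_lt with rfl | hi
        · exact hbL
        · exact hL' (haL i hi)
    obtain ⟨L, hL, hPL, hLd, h⟩ := key (P.natDegree + 1)
    have hPL' : ∀ i, P.coeff i ∈ (algebraMap L N).rangeS := fun i => by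
      rcases lt_or_ge i (P.natDegree + 1) with hi | hi
      · exact ⟨⟨_, hPL i hi⟩, rfl⟩
      · rw [coeff_eq_zero_of_natDegree_lt hi]
        exact zero_mem _
    obtain ⟨Q, rfl⟩ := (lifts_iff_coeff_lifts P).2 hPL'
    have halg : IsAlgebraic L b := by
      refine ⟨Q, fun h => hb' (by simp [h]), ?_⟩
      rw [← hb, coe_mapRingHom, eval_map_algebraMap]
    obtain ⟨L', hL', hbL, hLd', h'⟩ := exists_differentialSubfield_of_algebraic hLd halg
    exact ⟨L', hL.trans hL', hbL, hLd', fun a ha h₁ => h a ha (h' a (hL ha) h₁)⟩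

/-- Liouville's theorem: an element of a differential subfield with an elementary integral is a
Liouville form over that subfield. -/
theorem IsElementaryOver.deriv_mem_liouvilleForms [CharZero N] {b : N}
    (hb : IsElementaryOver S b) (hM : IsDifferentialSubfield M) (hS : S ⊆ M) (hbM : b′ ∈ M) :
    b′ ∈ liouvilleForms M := by
  obtain ⟨L, -, hbL, -, h⟩ := hb.exists_differentialSubfield hM hS
  exact h _ hbM (_root_.deriv_mem_liouvilleForms hbL)

lemma IsElementaryOver.mono {T : Set N} {b : N} (hb : IsElementaryOver S b)
    (h : ∀ a ∈ S, IsElementaryOver T a) : IsElementaryOver T b := by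
  induction hb with
  | base ha => exact h _ ha
  | const hc => exact .const hc
  | add _ _ iha ihb => exact .add iha ihb
  | mul _ _ iha ihb => exact .mul iha ihb
  | inv _ iha => exact .inv iha
  | exp _ hb iha => exact .exp iha hb
  | log _ h0 hb iha => exact .log iha h0 hb
  | alg P _ hb hb' ih => exact .alg P ih hb hb'

lemma IsElementaryOver.neg {a : N} (ha : IsElementaryOver S a) : IsElementaryOver S (-a) := by
  simpa using (IsElementaryOver.const (S := S) (c := (-1 : N)) (by simp)).mul ha

lemma IsElementaryOver.sub {a b : N} (ha : IsElementaryOver S a) (hb : IsElementaryOver S b) :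
    IsElementaryOver S (a - b) := by
  simpa [sub_eq_add_neg] using ha.add hb.neg

lemma IsElementaryOver.div {a b : N} (ha : IsElementaryOver S a) (hb : IsElementaryOver S b) :
    IsElementaryOver S (a / b) := by
  simpa [div_eq_mul_inv] using ha.mul hb.inv

lemma IsElementaryOver.pow {a : N} (ha : IsElementaryOver S a) (n : ℕ) :
    IsElementaryOver S (a ^ n) := by
  induction n with
  | zero => simpa using IsElementaryOver.const (S := S) (c := (1 : N)) (by simp)
  | succ n ih => simpa [pow_succ] using ih.mul ha

lemma IsElementaryOver.sum {ι : Type*} (s : Finset ι) {a : ι → N}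
    (ha : ∀ i ∈ s, IsElementaryOver S (a i)) : IsElementaryOver S (∑ i ∈ s, a i) := by
  classical
  induction s using Finset.induction_on with
  | empty => simpa using IsElementaryOver.const (S := S) (c := (0 : N)) (by simp)
  | insert i s hi ih =>
    rw [Finset.sum_insert hi]
    exact (ha i (by simp)).add (ih fun j hj => ha j (by simp [hj]))

/-- Every root of a nonzero polynomial with elementary coefficients is elementary. -/
lemma IsElementaryOver.of_isRoot [CharZero N] (P : N[X]) (hP0 : P ≠ 0)
    (hP : ∀ i, IsElementaryOver S (P.coeff i)) {b : N} (hb : P.eval b = 0) :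
    IsElementaryOver S b := by
  induction hn : P.natDegree using Nat.strong_induction_on generalizing P with
  | _ n ih =>
    have hdeg : P.natDegree ≠ 0 := fun h => by
      rw [eq_C_of_natDegree_eq_zero h] at hb hP0
      simp_all
    by_cases hb' : P.derivative.eval b = 0
    · refine ih _ (hn ▸ natDegree_derivative_lt hdeg) P.derivative ?_ (fun i => ?_) hb' rfl
      · intro h
        exact hdeg (derivative_eq_zero.1 h)
      · rw [coeff_derivative]
        exact (hP _).mul (.const (by simp))
    · exact .alg P hP hb hb'

/-- The elements elementary over `S` are closed under the derivation if the derivatives of the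
elements of `S` are elementary. -/
lemma IsElementaryOver.deriv (hS : ∀ a ∈ S, IsElementaryOver S a′) {b : N}
    (hb : IsElementaryOver S b) : IsElementaryOver S b′ := by
  induction hb with
  | base ha => exact hS _ ha
  | const hc => rw [hc]; exact .const (by simp)
  | add _ _ iha ihb => rw [map_add]; exact iha.add ihb
  | mul ha hb iha ihb =>
    rw [Derivation.leibniz, smul_eq_mul, smul_eq_mul]
    exact (ha.mul ihb).add (hb.mul iha)
  | inv ha iha =>
    rw [deriv_inv_field]
    exact (ha.inv.pow 2).neg.mul iha
  | exp ha hb iha => rw [hb]; exact iha.mul (.exp ha hb)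
  | @log a b ha h0 hb iha =>
    rw [show b′ = a′ / a by rw [← hb, mul_div_cancel_left₀ _ h0]]
    exact iha.div ha
  | @alg P b hP hb hb' ih =>
    have hbe : IsElementaryOver S b := .alg P hP hb hb'
    have h := deriv_aeval_eq b P
    simp only [coe_aeval_eq_eval, hb, map_zero] at h
    have hev (Q : N[X]) (hQ : ∀ i, IsElementaryOver S (Q.coeff i)) :
        IsElementaryOver S (Q.eval b) := by
      rw [eval_eq_sum_range]
      exact .sum _ fun i _ => (hQ i).mul (hbe.pow i)
    rw [show b′ = -(mapCoeffs P).eval b / P.derivative.eval b by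
      field_simp; linear_combination -h]
    refine (hev _ fun i => ?_).neg.div (hev _ fun i => ?_)
    · exact ih i
    · rw [coeff_derivative]
      exact (hP _).mul (.const (by simp))

end Liouville

/-! ### Extension of homomorphisms in general position -/

section Extension

open Polynomial

variable {N : Type*} [Field N]

/-- Homomorphisms from `A` to `ℂ` in general position extend to `B`: the ones not extending to `B`
with a nonzero value at a given `v ≠ 0` all vanish at some fixed nonzero `u ∈ A`. -/
def HomsExtend (A B : Subring N) : Prop :=
  A ≤ B ∧ ∀ v (hv : v ∈ B), v ≠ 0 → ∃ u, ∃ hu : u ∈ A, u ≠ 0 ∧ ∀ φ : A →+* ℂ, φ ⟨u, hu⟩ ≠ 0 →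
    ∃ ψ : B →+* ℂ, (∀ a (ha : a ∈ A) (hb : a ∈ B), ψ ⟨a, hb⟩ = φ ⟨a, ha⟩) ∧ ψ ⟨v, hv⟩ ≠ 0

lemma HomsExtend.refl (A : Subring N) : HomsExtend A A :=
  ⟨le_rfl, fun v hv hv0 => ⟨v, hv, hv0, fun φ hφ => ⟨φ, fun _ _ _ => rfl, hφ⟩⟩⟩

lemma HomsExtend.trans {A B B' : Subring N} (h : HomsExtend A B) (h' : HomsExtend B B') :
    HomsExtend A B' := by
  refine ⟨h.1.trans h'.1, fun v hv hv0 => ?_⟩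
  obtain ⟨u', hu', hu0', H'⟩ := h'.2 v hv hv0
  obtain ⟨u, hu, hu0, H⟩ := h.2 u' hu' hu0'
  refine ⟨u, hu, hu0, fun φ hφ => ?_⟩
  obtain ⟨ψ, hψ, hψu⟩ := H φ hφ
  obtain ⟨χ, hχ, hχv⟩ := H' ψ hψu
  exact ⟨χ, fun a ha hb => (hχ a (h.1 ha) hb).trans (hψ a ha _), hχv⟩

/-- The elements of `A[x]` are the values at `x` of the polynomials over `A`. -/
lemma mem_closure_insert_iff {A : Subring N} {x y : N} :
    y ∈ Subring.closure (insert x (A : Set N)) ↔ ∃ P : A[X], aeval x P = y := by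
  constructor
  · intro hy
    have : Subring.closure (insert x (A : Set N)) ≤
        ((aeval x : A[X] →ₐ[A] N) : A[X] →+* N).range := by
      rw [Subring.closure_le]
      rintro z (rfl | hz)
      · exact ⟨X, aeval_X _⟩
      · exact ⟨C ⟨z, hz⟩, aeval_C _ _⟩
    exact this hy
  · rintro ⟨P, rfl⟩
    rw [aeval_eq_sum_range]
    refine sum_mem fun i _ => ?_
    rw [Algebra.smul_def]
    exact mul_mem (Subring.subset_closure (Set.mem_insert_of_mem x (P.coeff i).2))
      (pow_mem (Subring.subset_closure (Set.mem_insert x _)) i)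

/-- Evaluation of polynomials at a common root of the specialization of a polynomial `Q` of minimal
degree vanishing at `x` kills all polynomials vanishing at `x`, by pseudo-division by `Q`. -/
lemma eval₂_eq_zero_of_minimal {A : Subring N} {x : N} {Q : A[X]}
    (hQ : aeval x Q = 0) (hmin : ∀ R : A[X], R ≠ 0 → aeval x R = 0 → Q.natDegree ≤ R.natDegree)
    {φ : A →+* ℂ} (hφ : φ Q.leadingCoeff ≠ 0) {ξ : ℂ} (hξ : Q.eval₂ φ ξ = 0) (R : A[X])
    (hR : aeval x R = 0) : R.eval₂ φ ξ = 0 := by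
  induction hn : R.natDegree using Nat.strong_induction_on generalizing R with
  | _ n ih =>
    rcases eq_or_ne R 0 with rfl | hR0
    · simp
    have hle := hmin R hR0 hR
    have hpos : 0 < R.natDegree := by
      by_contra! h
      rw [eq_C_of_natDegree_le_zero h] at hR hR0
      simp only [aeval_C, map_eq_zero_iff _ (FaithfulSMul.algebraMap_injective A N)] at hR
      exact hR0 (by rw [hR, C_0])
    have h := ih _ (hn ▸ natDegree_cancelLeads_lt_of_natDegree_le_natDegree hle hpos)
      (Q.cancelLeads R) (by simp [cancelLeads, hQ, hR]) rfl
    simpa [cancelLeads, eval₂_sub, eval₂_mul, hξ, hφ, Nat.sub_eq_zero_of_le hle] using h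

/-- Homomorphisms in general position extend to one further element `x`: its image is a root of the
specialized minimal equation if `x` is algebraic, and a general number if `x` is transcendental. -/
lemma homsExtend_closure_insert (A : Subring N) (x : N) :
    HomsExtend A (Subring.closure (insert x (A : Set N))) := by
  set B := Subring.closure (insert x (A : Set N))
  have hAB : A ≤ B := fun a ha => Subring.subset_closure (Or.inr ha)
  let π : A[X] →+* B := ((aeval x : A[X] →ₐ[A] N) : A[X] →+* N).codRestrict B
    fun P => mem_closure_insert_iff.2 ⟨P, rfl⟩
  have hπ : Function.Surjective π := fun b => by
    obtain ⟨P, hP⟩ := mem_closure_insert_iff.1 b.2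
    exact ⟨P, Subtype.ext hP⟩
  have hπ0 (P : A[X]) (h : π P = 0) : aeval x P = 0 := congrArg Subtype.val h
  -- a homomorphism on `B` is given by a value `ξ` of `x` satisfying the relations of `x`
  have hlift (φ : A →+* ℂ) (ξ : ℂ) (h : ∀ P : A[X], aeval x P = 0 → P.eval₂ φ ξ = 0) :
      ∃ ψ : B →+* ℂ, (∀ a (ha : a ∈ A) (hb : a ∈ B), ψ ⟨a, hb⟩ = φ ⟨a, ha⟩) ∧
        ∀ P : A[X], ψ (π P) = P.eval₂ φ ξ := by
    let ψ := π.liftOfSurjective hπ ⟨eval₂RingHom φ ξ, fun P hP => h P (hπ0 P hP)⟩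
    have hψ (P : A[X]) : ψ (π P) = P.eval₂ φ ξ :=
      RingHom.liftOfSurjective_comp_apply π hπ _ P
    refine ⟨ψ, fun a ha hb => ?_, hψ⟩
    rw [← eval₂_C φ ξ, ← hψ]
    congr 1
    exact Subtype.ext (aeval_C x (⟨a, ha⟩ : A)).symm
  refine ⟨hAB, fun v hv hv0 => ?_⟩
  obtain ⟨P, rfl⟩ := mem_closure_insert_iff.1 hv
  by_cases hx : IsAlgebraic A x
  · obtain ⟨Q, hQ, hmin⟩ : ∃ Q : A[X], (Q ≠ 0 ∧ aeval x Q = 0) ∧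
        ∀ R : A[X], R ≠ 0 → aeval x R = 0 → Q.natDegree ≤ R.natDegree := by
      obtain ⟨Q₀, hQ₀⟩ := hx
      obtain ⟨Q, hQ, hmin⟩ := exists_minimalFor_of_wellFoundedLT
        (fun Q : A[X] => Q ≠ 0 ∧ aeval x Q = 0) natDegree ⟨Q₀, hQ₀⟩
      exact ⟨Q, hQ, fun R hR0 hR => (le_total _ _).elim id fun h => hmin ⟨hR0, hR⟩ h⟩
    have hv_alg : IsAlgebraic A (aeval x P) :=
      Algebra.isAlgebraic_adjoin_singleton_iff.2 hx _ (aeval_mem_adjoin_singleton A x)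
    obtain ⟨T, hT0, hT⟩ := hv_alg.exists_nonzero_coeff_and_aeval_eq_zero
      (mem_nonZeroDivisors_of_ne_zero hv0)
    have hne : Q.leadingCoeff * T.coeff 0 ≠ 0 := mul_ne_zero (leadingCoeff_ne_zero.2 hQ.1) hT0
    refine ⟨(Q.leadingCoeff * T.coeff 0 : A), Subtype.property _, fun h => hne (Subtype.ext h),
      fun φ hφ => ?_⟩
    rw [Subtype.coe_eta, map_mul, mul_ne_zero_iff] at hφ
    obtain ⟨ξ, hξ⟩ : ∃ ξ, Q.eval₂ φ ξ = 0 := by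
      have hdeg : (Q.map φ).degree ≠ 0 := by
        rw [degree_map_eq_of_leadingCoeff_ne_zero φ hφ.1]
        intro h
        have hQ' := hQ
        rw [eq_C_of_degree_eq_zero h] at hQ'
        simp only [aeval_C, map_eq_zero_iff _ (FaithfulSMul.algebraMap_injective A N)] at hQ'
        exact hQ'.1 (by rw [hQ'.2, C_0])
      obtain ⟨ξ, hξ⟩ := IsAlgClosed.exists_root _ hdeg
      exact ⟨ξ, by rwa [IsRoot, eval_map] at hξ⟩
    obtain ⟨ψ, hψA, hψ⟩ := hlift φ ξ (eval₂_eq_zero_of_minimal hQ.2 hmin hφ.1 hξ)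
    refine ⟨ψ, hψA, fun h0 => hφ.2 ?_⟩
    have h1 : (T.comp P).eval₂ φ ξ = 0 := by
      rw [← hψ, show π (T.comp P) = 0 from Subtype.ext ?_, map_zero]
      change aeval x (T.comp P) = 0
      rw [aeval_comp, hT]
    have h2 : P.eval₂ φ ξ = 0 := by rw [← hψ]; exact h0
    rw [eval₂_comp, h2, ← eval_map, ← coeff_zero_eq_eval_zero, coeff_map] at h1
    exact h1
  · have hP0 : P ≠ 0 := fun h => hv0 (by simp [h])
    refine ⟨P.leadingCoeff, Subtype.property _, fun h =>
      leadingCoeff_ne_zero.2 hP0 (Subtype.ext h), fun φ hφ => ?_⟩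
    have hmap : P.map φ ≠ 0 := fun h => hφ (by
      have := congrArg (coeff · P.natDegree) h
      simpa using this)
    obtain ⟨ξ, hξ⟩ := exists_eval_ne_zero_of_natDegree_lt_card (P.map φ) hmap (by
      simpa using Cardinal.natCast_lt_aleph0.trans_le (Cardinal.aleph0_le_mk ℂ))
    obtain ⟨ψ, hψA, hψ⟩ := hlift φ ξ fun R hR => by
      rw [(transcendental_iff.1 hx) R hR, eval₂_zero]
    exact ⟨ψ, hψA, fun h0 => hξ (by rw [eval_map, ← hψ]; exact h0)⟩

end Extension

/-! ### Specialization of elementary elements -/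

section Specialization

open Differential Polynomial

variable {N : Type*} [Field N] [Differential N]

lemma deriv_mem_closure {T : Set N} (hT : ∀ a ∈ T, a′ ∈ Subring.closure T) {a : N}
    (ha : a ∈ Subring.closure T) : a′ ∈ Subring.closure T := by
  induction ha using Subring.closure_induction with
  | mem x hx => exact hT x hx
  | zero => simp
  | one => simp
  | add x y _ _ hx hy => rw [map_add]; exact add_mem hx hy
  | neg x _ hx => rw [map_neg]; exact neg_mem hx
  | mul x y hx' hy' hx hy =>
    rw [Derivation.leibniz]
    exact add_mem (mul_mem hx' hy) (mul_mem hy' hx)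

/-- A field element elementary over `S ⊆ A` lies in a finitely generated extension `B` of the
differential ring `A`, closed under the derivation, such that every differential ring homomorphism
from `B` to a differential field maps the element to one elementary over the image of `S`. -/
lemma IsElementaryOver.exists_specialization {N' : Type*} [Field N'] [Differential N']
    [CharZero N] {S : Set N} {b : N}
    (hb : IsElementaryOver S b) {A : Subring N} (hS : S ⊆ A) (hA : ∀ a ∈ A, a′ ∈ A) :
    ∃ B : Subring N, HomsExtend A B ∧ (∀ a ∈ B, a′ ∈ B) ∧ ∃ hbB : b ∈ B,
      ∀ τ : B →+* N', (∀ a (ha : a ∈ B) (ha' : a′ ∈ B), (τ ⟨a, ha⟩)′ = τ ⟨a′, ha'⟩) →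
        IsElementaryOver {c | ∃ a ∈ S, ∃ ha : a ∈ B, c = τ ⟨a, ha⟩} (τ ⟨b, hbB⟩) := by
  -- the homomorphisms are used only through their restrictions to smaller rings
  have hres {B B' : Subring N} (h : B ≤ B') {b : N} (hbB : b ∈ B)
      (H : ∀ τ : B →+* N', (∀ a (ha : a ∈ B) (ha' : a′ ∈ B), (τ ⟨a, ha⟩)′ = τ ⟨a′, ha'⟩) →
        IsElementaryOver {c | ∃ a ∈ S, ∃ ha : a ∈ B, c = τ ⟨a, ha⟩} (τ ⟨b, hbB⟩))
      (τ : B' →+* N') (hτ : ∀ a (ha : a ∈ B') (ha' : a′ ∈ B'), (τ ⟨a, ha⟩)′ = τ ⟨a′, ha'⟩) :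
      IsElementaryOver {c | ∃ a ∈ S, ∃ ha : a ∈ B', c = τ ⟨a, ha⟩} (τ ⟨b, h hbB⟩) := by
    refine (H (τ.comp (Subring.inclusion h)) fun a ha ha' => hτ a _ _).mono ?_
    rintro _ ⟨a, haS, ha, rfl⟩
    exact .base ⟨a, haS, h ha, rfl⟩
  have hins (B : Subring N) (x : N) : x ∈ Subring.closure (insert x (B : Set N)) :=
    Subring.subset_closure (Set.mem_insert _ _)
  have hle (B : Subring N) (x : N) : B ≤ Subring.closure (insert x (B : Set N)) :=
    fun a ha => Subring.subset_closure (Set.mem_insert_of_mem _ ha)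
  have hstab {B : Subring N} (hB : ∀ a ∈ B, a′ ∈ B) {x : N}
      (hx : x′ ∈ Subring.closure (insert x (B : Set N))) :
      ∀ a ∈ Subring.closure (insert x (B : Set N)),
        a′ ∈ Subring.closure (insert x (B : Set N)) :=
    fun a ha => deriv_mem_closure (by
      rintro a (rfl | ha)
      · exact hx
      · exact hle B x (hB a ha)) ha
  have hinv {B : Subring N} (hB : ∀ a ∈ B, a′ ∈ B) {a : N} (ha : a ∈ B) :
      (a⁻¹)′ ∈ Subring.closure (insert a⁻¹ (B : Set N)) := by
    rw [deriv_inv_field]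
    exact mul_mem (neg_mem (pow_mem (hins _ _) 2)) (hle _ _ (hB a ha))
  induction hb generalizing A with
  | @base a ha => exact ⟨A, .refl A, hA, hS ha, fun τ _ => .base ⟨a, ha, hS ha, rfl⟩⟩
  | @const c hc =>
    refine ⟨_, homsExtend_closure_insert A c, hstab hA (by rw [hc]; exact zero_mem _), hins A c,
      fun τ hτ => .const ?_⟩
    rw [hτ _ _ (by rw [hc]; exact zero_mem _)]
    simp only [hc]
    exact map_zero τ
  | add _ _ iha ihb =>
    obtain ⟨B, hAB, hB, haB, h⟩ := iha hS hA
    obtain ⟨B', hBB', hB', hbB', h'⟩ := ihb (hS.trans hAB.1) hB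
    refine ⟨B', hAB.trans hBB', hB', add_mem (hBB'.1 haB) hbB', fun τ hτ => ?_⟩
    exact (map_add τ ⟨_, hBB'.1 haB⟩ ⟨_, hbB'⟩) ▸ (hres hBB'.1 haB h τ hτ).add (h' τ hτ)
  | mul _ _ iha ihb =>
    obtain ⟨B, hAB, hB, haB, h⟩ := iha hS hA
    obtain ⟨B', hBB', hB', hbB', h'⟩ := ihb (hS.trans hAB.1) hB
    refine ⟨B', hAB.trans hBB', hB', mul_mem (hBB'.1 haB) hbB', fun τ hτ => ?_⟩
    exact (map_mul τ ⟨_, hBB'.1 haB⟩ ⟨_, hbB'⟩) ▸ (hres hBB'.1 haB h τ hτ).mul (h' τ hτ)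
  | @inv a _ iha =>
    obtain ⟨B, hAB, hB, haB, h⟩ := iha hS hA
    rcases eq_or_ne a 0 with rfl | ha0
    · rw [inv_zero]
      exact ⟨B, hAB, hB, haB, h⟩
    refine ⟨_, hAB.trans (homsExtend_closure_insert B a⁻¹), hstab hB (hinv hB haB), hins B a⁻¹,
      fun τ hτ => ?_⟩
    have h1 : τ ⟨a, hle B a⁻¹ haB⟩ * τ ⟨a⁻¹, hins B a⁻¹⟩ = 1 := by
      rw [← map_mul, ← map_one τ]
      exact congrArg τ (Subtype.ext (mul_inv_cancel₀ ha0))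
    rw [← DivisionMonoid.inv_eq_of_mul _ _ h1]
    exact (hres (hle B a⁻¹) haB h τ hτ).inv
  | @exp a b _ hb iha =>
    obtain ⟨B, hAB, hB, haB, h⟩ := iha hS hA
    have hb' : b′ ∈ Subring.closure (insert b (B : Set N)) := by
      rw [hb]
      exact mul_mem (hle _ _ (hB a haB)) (hins _ _)
    refine ⟨_, hAB.trans (homsExtend_closure_insert B b), hstab hB hb', hins B b, fun τ hτ => ?_⟩
    refine (hres (hle B b) haB h τ hτ).exp ?_
    rw [hτ _ _ hb', hτ _ _ (hle _ _ (hB a haB)), ← map_mul]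
    exact congrArg τ (Subtype.ext hb)
  | @log a b _ ha0 hb iha =>
    obtain ⟨B, hAB, hB, haB, h⟩ := iha hS hA
    set B₁ := Subring.closure (insert a⁻¹ (B : Set N)) with hB₁
    have hB₁' : ∀ c ∈ B₁, c′ ∈ B₁ := hstab hB (hinv hB haB)
    have hb' : b′ ∈ Subring.closure (insert b (B₁ : Set N)) := by
      rw [show b′ = (a⁻¹ * a′) by rw [← hb, inv_mul_cancel_left₀ ha0]]
      exact hle _ _ (mul_mem (hins _ _) (hle _ _ (hB a haB)))
    have hBB : B ≤ Subring.closure (insert b (B₁ : Set N)) := (hle B _).trans (hle B₁ _)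
    refine ⟨_, (hAB.trans (homsExtend_closure_insert B a⁻¹)).trans
      (homsExtend_closure_insert B₁ b), hstab hB₁' hb', hins B₁ b, fun τ hτ => ?_⟩
    refine (hres hBB haB h τ hτ).log (fun h0 => ?_) ?_
    · have h1 : τ ⟨a, hBB haB⟩ * τ ⟨a⁻¹, hle B₁ b (hins B a⁻¹)⟩ = 1 := by
        rw [← map_mul, ← map_one τ]
        exact congrArg τ (Subtype.ext (mul_inv_cancel₀ ha0))
      rw [h0, zero_mul] at h1
      exact zero_ne_one h1
    · rw [hτ _ _ hb', hτ _ _ (hBB (hB a haB)), ← map_mul]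
      exact congrArg τ (Subtype.ext hb)
  | @alg P b _ hb hb' ih =>
    have key (n : ℕ) : ∃ B : Subring N, HomsExtend A B ∧ (∀ a ∈ B, a′ ∈ B) ∧
        ∀ i < n, ∃ hbB : P.coeff i ∈ B,
        ∀ τ : B →+* N', (∀ a (ha : a ∈ B) (ha' : a′ ∈ B), (τ ⟨a, ha⟩)′ = τ ⟨a′, ha'⟩) →
          IsElementaryOver {c | ∃ a ∈ S, ∃ ha : a ∈ B, c = τ ⟨a, ha⟩} (τ ⟨P.coeff i, hbB⟩) := by
      induction n with
      | zero => exact ⟨A, .refl A, hA, by simp⟩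
      | succ n ihn =>
        obtain ⟨B, hAB, hB, h⟩ := ihn
        obtain ⟨B', hBB', hB', hbB', h'⟩ := ih n (hS.trans hAB.1) hB
        refine ⟨B', hAB.trans hBB', hB', fun i hi => ?_⟩
        rcases (Nat.lt_succ_iff.1 hi).eq_or_lt with rfl | hi
        · exact ⟨hbB', h'⟩
        · obtain ⟨hiB, hi'⟩ := h i hi
          exact ⟨hBB'.1 hiB, hres hBB'.1 hiB hi'⟩
    obtain ⟨B, hAB, hB, h⟩ := key (P.natDegree + 1)
    have hPB (i : ℕ) : P.coeff i ∈ B := by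
      rcases lt_or_ge i (P.natDegree + 1) with hi | hi
      · exact (h i hi).1
      · rw [coeff_eq_zero_of_natDegree_lt hi]
        exact zero_mem _
    obtain ⟨Q, rfl⟩ := (lifts_iff_coeff_lifts (f := algebraMap B N) P).2
      fun i => ⟨⟨_, hPB i⟩, rfl⟩
    simp only [coe_mapRingHom] at *
    set B₁ := Subring.closure (insert b (B : Set N)) with hB₁
    set d := (Q.map (algebraMap B N)).derivative.eval b with hd
    set B₂ := Subring.closure (insert d⁻¹ (B₁ : Set N)) with hB₂
    have hev (R : N[X]) (hR : ∀ i, R.coeff i ∈ B) : R.eval b ∈ B₁ := by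
      rw [eval_eq_sum_range]
      exact sum_mem fun i _ => mul_mem (hle _ _ (hR i)) (pow_mem (hins _ _) i)
    have hdB : d ∈ B₁ := hev _ fun i => by
      rw [coeff_derivative]
      exact mul_mem (hPB _) (by exact_mod_cast natCast_mem B (i + 1))
    have hbd : b′ ∈ B₂ := by
      have h := deriv_aeval_eq b (Q.map (algebraMap B N))
      simp only [coe_aeval_eq_eval, hb, map_zero, ← hd] at h
      rw [show b′ = -(mapCoeffs (Q.map (algebraMap B N))).eval b * d⁻¹ by
        field_simp; linear_combination -h]
      exact mul_mem (neg_mem (hle _ _ (hev _ fun i => hB _ (hPB i)))) (hins _ _)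
    have hB₁d : ∀ a ∈ B₁, a′ ∈ B₂ := fun a ha => by
      induction ha using Subring.closure_induction with
      | mem x hx =>
        rcases hx with rfl | hx
        · exact hbd
        · exact hle _ _ (hle _ _ (hB _ hx))
      | zero => simp
      | one => simp
      | add x y _ _ hx hy => rw [map_add]; exact add_mem hx hy
      | neg x _ hx => rw [map_neg]; exact neg_mem hx
      | mul x y hx' hy' hx hy =>
        rw [Derivation.leibniz]
        exact add_mem (mul_mem (hle _ _ hx') hy) (mul_mem (hle _ _ hy') hx)
    have hB₂d : ∀ a ∈ B₂, a′ ∈ B₂ := fun a ha => deriv_mem_closure (by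
      rintro a (rfl | ha)
      · rw [deriv_inv_field]
        exact mul_mem (neg_mem (pow_mem (hins _ _) 2)) (hB₁d d hdB)
      · exact hB₁d a ha) ha
    have hBB : B ≤ B₂ := (hle B _).trans (hle B₁ _)
    refine ⟨B₂, (hAB.trans (homsExtend_closure_insert B b)).trans
      (homsExtend_closure_insert B₁ d⁻¹), hB₂d, hle _ _ (hins _ _), fun τ hτ => ?_⟩
    set σ : B →+* N' := τ.comp (Subring.inclusion hBB)
    have hσ (R : B[X]) (hR : (R.map (algebraMap B N)).eval b ∈ B₂) :
        (R.map σ).eval (τ ⟨b, hle B₁ d⁻¹ (hins B b)⟩) =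
          τ ⟨(R.map (algebraMap B N)).eval b, hR⟩ := by
      rw [eval_map, ← hom_eval₂]
      congr 1
      apply Subtype.ext
      exact (hom_eval₂ R (Subring.inclusion hBB) B₂.subtype
        ⟨b, hle B₁ d⁻¹ (hins B b)⟩).trans (eval_map _ _).symm
    refine .alg (Q.map σ) (fun i => ?_) ?_ ?_
    · rw [coeff_map]
      rcases lt_or_ge i ((Q.map (algebraMap B N)).natDegree + 1) with hi | hi
      · obtain ⟨hiB, hi'⟩ := h i hi
        convert hres hBB hiB hi' τ hτ using 1
        simp [σ, Subring.inclusion]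
        rfl
      · have : Q.coeff i = 0 := by
          have := coeff_eq_zero_of_natDegree_lt hi
          rw [coeff_map] at this
          exact Subtype.ext this
        rw [this, map_zero]
        exact .const (by simp)
    · rw [hσ Q (by rw [hb]; exact zero_mem _)]
      simp only [hb]
      exact map_zero τ
    · intro h0
      rw [derivative_map] at hd
      rw [derivative_map, hσ _ (hd ▸ hle _ _ hdB)] at h0
      have h1 : τ ⟨d, hle _ _ hdB⟩ * τ ⟨d⁻¹, hins B₁ d⁻¹⟩ = 1 := by
        rw [← map_mul, ← map_one τ]
        exact congrArg τ (Subtype.ext (mul_inv_cancel₀ hb'))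
      simp only [← hd] at h0
      rw [h0, zero_mul] at h1
      exact zero_ne_one h1

end Specialization

/-! ### The differential field of formal Laurent series -/

section FractionField

open Differential

/-- A differential ring given by an additive map satisfying the Leibniz rule. -/
@[reducible]
def Differential.ofAddMonoidHom {R : Type*} [CommRing R] (d : R →+ R)
    (h : ∀ a b, d (a * b) = a * d b + b * d a) : Differential R :=
  ⟨Derivation.mk' d.toIntLinearMap h⟩

variable {R K : Type*} [CommRing R] [IsDomain R] [Differential R] [Field K] [Algebra R K]
  [IsFractionRing R K]

/-- The ring homomorphism `r ↦ r + r' ε` from a differential ring to the dual numbers over its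
fraction field. -/
def dualNumberHom (R K : Type*) [CommRing R] [Differential R] [Field K] [Algebra R K] :
    R →+* DualNumber K where
  toFun r := TrivSqZeroExt.inl (algebraMap R K r) + TrivSqZeroExt.inr (algebraMap R K r′)
  map_one' := by ext <;> simp
  map_zero' := by ext <;> simp
  map_add' a b := by ext <;> simp [Algebra.smul_def]
  map_mul' a b := by
    ext
    · simp
    · simp only [map_mul, Derivation.leibniz, map_add, smul_eq_mul, TrivSqZeroExt.snd_add,
        TrivSqZeroExt.snd_inl, TrivSqZeroExt.snd_inr, TrivSqZeroExt.snd_mul,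
        TrivSqZeroExt.fst_add, TrivSqZeroExt.fst_inl, TrivSqZeroExt.fst_inr, op_smul_eq_smul]
      ring

lemma isUnit_dualNumberHom (y : nonZeroDivisors R) : IsUnit (dualNumberHom R K y) := by
  rw [TrivSqZeroExt.isUnit_iff_isUnit_fst, isUnit_iff_ne_zero]
  simp only [dualNumberHom, RingHom.coe_mk, MonoidHom.coe_mk, OneHom.coe_mk,
    TrivSqZeroExt.fst_add, TrivSqZeroExt.fst_inl, TrivSqZeroExt.fst_inr, add_zero]
  exact IsLocalization.to_map_ne_zero_of_mem_nonZeroDivisors K le_rfl y.2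

lemma fst_lift_dualNumberHom (a : K) :
    (IsLocalization.lift (M := nonZeroDivisors R) (isUnit_dualNumberHom (K := K)) a).fst = a := by
  have : (TrivSqZeroExt.fstHom K K K : DualNumber K →+* K).comp
      (IsLocalization.lift (M := nonZeroDivisors R) (isUnit_dualNumberHom (K := K))) =
      RingHom.id K := by
    refine IsLocalization.ringHom_ext (nonZeroDivisors R) (RingHom.ext fun r => ?_)
    simp [IsLocalization.lift_eq, dualNumberHom]
  exact congrArg (fun h : K →+* K => h a) this

/-- The derivation of the fraction field `K` of a differential domain `R`: the dual part of the
extension to `K` of the homomorphism `r ↦ r + r' ε`. -/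
@[reducible]
noncomputable def differentialOfIsFractionRing (R K : Type*) [CommRing R] [IsDomain R]
    [Differential R] [Field K] [Algebra R K] [IsFractionRing R K] : Differential K :=
  .ofAddMonoidHom
    { toFun := fun a => (IsLocalization.lift (M := nonZeroDivisors R)
        (isUnit_dualNumberHom (K := K)) a).snd
      map_zero' := by simp
      map_add' := fun a b => by simp }
    (fun a b => by simp [fst_lift_dualNumberHom]; ring)

end FractionField

section Series

open PowerSeries Differential

/-- Formal differentiation makes the power series a differential ring. -/
noncomputable instance : Differential ℂ⟦X⟧ :=
  .ofAddMonoidHom (d⁄dX ℂ : ℂ⟦X⟧ →+ ℂ⟦X⟧) (d⁄dX ℂ).leibniz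

lemma PowerSeries.deriv_eq (f : ℂ⟦X⟧) : f′ = d⁄dX ℂ f := rfl

/-- The field of formal Laurent series, as the field of fractions of the ring of power series. -/
abbrev SeriesField : Type := FractionRing ℂ⟦X⟧

noncomputable instance : Differential SeriesField := differentialOfIsFractionRing ℂ⟦X⟧ SeriesField

instance : DifferentialAlgebra ℂ⟦X⟧ SeriesField where
  deriv_algebraMap a := by
    change (IsLocalization.lift (M := nonZeroDivisors ℂ⟦X⟧) (isUnit_dualNumberHom
      (K := SeriesField)) (algebraMap ℂ⟦X⟧ SeriesField a)).snd = _
    rw [IsLocalization.lift_eq]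
    simp only [dualNumberHom, RingHom.coe_mk, MonoidHom.coe_mk, OneHom.coe_mk,
      TrivSqZeroExt.snd_add, TrivSqZeroExt.snd_inl, TrivSqZeroExt.snd_inr, zero_add]

/-- A formal Laurent series with derivative zero is a complex constant. -/
lemma SeriesField.exists_eq_C_of_deriv_eq_zero {a : SeriesField} (ha : a′ = 0) :
    ∃ c : ℂ, a = algebraMap ℂ⟦X⟧ SeriesField (C c) := by
  have key (f : ℂ⟦X⟧) (hf : (algebraMap ℂ⟦X⟧ SeriesField f)′ = 0) : f = C (constantCoeff f) := by
    rw [deriv_algebraMap, map_eq_zero_iff _ (IsFractionRing.injective ℂ⟦X⟧ SeriesField)] at hf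
    exact derivative.ext (by rw [← deriv_eq, hf, derivative_C]) (by simp)
  rcases ValuationRing.isInteger_or_isInteger ℂ⟦X⟧ a with ⟨f, hf⟩ | ⟨f, hf⟩
  · exact ⟨_, by rw [← hf, ← key f (hf ▸ ha)]⟩
  · refine ⟨(constantCoeff f)⁻¹, ?_⟩
    have h := key f (by rw [hf, deriv_inv_field, ha, mul_zero])
    rcases eq_or_ne (constantCoeff f) 0 with h0 | h0
    · rw [h0, map_zero] at h
      rw [h, map_zero, eq_comm, _root_.inv_eq_zero] at hf
      rw [hf, h0]
      simp
    · rw [← inv_inv a, ← hf, h]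
      refine inv_eq_of_mul_eq_one_right ?_
      rw [← map_mul, ← map_mul, constantCoeff_C, mul_inv_cancel₀ h0, map_one, map_one]

/-- A family of power series closed under differentiation up to a common factor `w` is determined
by the constant coefficients of its members. -/
lemma PowerSeries.eq_of_deriv_eq_mul {ι : Type*} {δ : ι → ι} {P : ι → Prop} {F G : ι → ℂ⟦X⟧}
    (w : ℂ⟦X⟧) (hP : ∀ a, P a → P (δ a))
    (hF : ∀ a, P a → d⁄dX ℂ (F a) = w * F (δ a)) (hG : ∀ a, P a → d⁄dX ℂ (G a) = w * G (δ a))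
    (h0 : ∀ a, P a → constantCoeff (F a) = constantCoeff (G a)) {a : ι} (ha : P a) :
    F a = G a := by
  have key (n : ℕ) : ∀ a, P a → coeff n (F a) = coeff n (G a) := by
    induction n using Nat.strong_induction_on with
    | _ n ih =>
      intro a ha
      cases n with
      | zero => simpa using h0 a ha
      | succ n =>
        have h : coeff n (d⁄dX ℂ (F a)) = coeff n (d⁄dX ℂ (G a)) := by
          rw [hF a ha, hG a ha, coeff_mul, coeff_mul]
          refine Finset.sum_congr rfl fun ij hij => ?_
          rw [ih ij.2 (by have := Finset.HasAntidiagonal.mem_antidiagonal.1 hij; lia) _ (hP a ha)]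
        rw [coeff_derivative, coeff_derivative] at h
        exact mul_right_cancel₀ (Nat.cast_add_one_ne_zero n) h
  exact PowerSeries.ext fun n => key n a ha

/-- The Taylor morphism: a ring homomorphism `ψ` from a differential ring to `ℂ` gives the
differential homomorphism `r ↦ ∑ ψ(r⁽ⁿ⁾) Xⁿ / n!` to the power series. -/
noncomputable def taylorHom {R : Type*} [CommRing R] [Differential R] (ψ : R →+* ℂ) :
    R →+* ℂ⟦X⟧ :=
  let T : R → ℂ⟦X⟧ := fun r => mk fun n => ψ (Differential.deriv^[n] r) / n.factorial
  have hadd (a b : R) : T (a + b) = T a + T b := by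
    ext n
    simp [T, iterate_map_add, add_div]
  have hd (a : R) : d⁄dX ℂ (T a) = T a′ := by
    ext n
    simp only [T, coeff_derivative, coeff_mk, Function.iterate_succ_apply, Nat.factorial_succ]
    push_cast
    field_simp
  have hmul (n : ℕ) : ∀ a b : R, coeff n (T (a * b)) = coeff n (T a * T b) := by
    induction n with
    | zero => intro a b; simp [T, coeff_mul]
    | succ n ih =>
      intro a b
      have h : coeff n (d⁄dX ℂ (T (a * b))) = coeff n (d⁄dX ℂ (T a * T b)) := by
        rw [hd, Derivation.leibniz, Derivation.leibniz, hadd, map_add, map_add, smul_eq_mul,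
          smul_eq_mul, smul_eq_mul, smul_eq_mul, ih, ih, hd, hd]
      rw [coeff_derivative, coeff_derivative] at h
      exact mul_right_cancel₀ (Nat.cast_add_one_ne_zero n) h
  { toFun := T
    map_one' := derivative.ext (by rw [hd]; ext n; simp [T]) (by simp [T])
    map_zero' := by ext n; simp [T]
    map_add' := hadd
    map_mul' := fun a b => PowerSeries.ext fun n => hmul n a b }

lemma derivative_taylorHom {R : Type*} [CommRing R] [Differential R] (ψ : R →+* ℂ) (r : R) :
    d⁄dX ℂ (taylorHom ψ r) = taylorHom ψ r′ := by
  ext n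
  simp only [taylorHom, RingHom.coe_mk, MonoidHom.coe_mk, OneHom.coe_mk, coeff_derivative,
    coeff_mk, Function.iterate_succ_apply, Nat.factorial_succ]
  push_cast
  field_simp

lemma constantCoeff_taylorHom {R : Type*} [CommRing R] [Differential R] (ψ : R →+* ℂ) (r : R) :
    constantCoeff (taylorHom ψ r) = ψ r := by
  simp [taylorHom]

/-- Specialization of elementary elements: if `b` is elementary over `S`, then so is its image under
a differential homomorphism to the power series in general position.  The homomorphism is defined
on a differential ring `A` containing `S` and `b` only, and not on the exponentials, logarithms and
algebraic elements by which `b` is expressed; these have images under the Taylor morphism of an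
extension of the constant coefficient of `θ`. -/
lemma IsElementaryOver.exists_forall_hom {N : Type*} [Field N] [Differential N] [CharZero N]
    {S : Set N} {b : N} (hb : IsElementaryOver S b) {A : Subring N} (hS : S ⊆ A)
    (hA : ∀ a ∈ A, a′ ∈ A) (hbA : b ∈ A) :
    ∃ u : A, u ≠ 0 ∧ ∀ θ : A →+* ℂ⟦X⟧,
      (∀ a (ha : a ∈ A) (ha' : a′ ∈ A), d⁄dX ℂ (θ ⟨a, ha⟩) = θ ⟨a′, ha'⟩) →
      constantCoeff (θ u) ≠ 0 →
      IsElementaryOver {c | ∃ a ∈ S, ∃ ha : a ∈ A, c = algebraMap ℂ⟦X⟧ SeriesField (θ ⟨a, ha⟩)}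
        (algebraMap ℂ⟦X⟧ SeriesField (θ ⟨b, hbA⟩)) := by
  obtain ⟨B, hAB, hB, hbB, H⟩ := hb.exists_specialization (N' := SeriesField) hS hA
  obtain ⟨u, hu, hu0, hφ⟩ := hAB.2 1 (one_mem B) one_ne_zero
  refine ⟨⟨u, hu⟩, fun h => hu0 (congrArg Subtype.val h), fun θ hθ hθu => ?_⟩
  obtain ⟨ψ, hψ, -⟩ := hφ ((constantCoeff (R := ℂ)).comp θ) hθu
  let _ : Differential B :=
    ⟨Derivation.mk'
      { toFun := fun a => ⟨(a : N)′, hB a a.2⟩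
        map_add' := fun a b => Subtype.ext (by simp)
        map_smul' := fun n a => Subtype.ext (by simp) }
      (fun a b => Subtype.ext (by simp))⟩
  have heq (a : N) (ha : a ∈ A) : taylorHom ψ ⟨a, hAB.1 ha⟩ = θ ⟨a, ha⟩ := by
    refine PowerSeries.eq_of_deriv_eq_mul (ι := A) (P := fun _ => True)
      (δ := fun a => ⟨(a : N)′, hA a a.2⟩) (F := fun a => taylorHom ψ ⟨a, hAB.1 a.2⟩)
      (G := θ) 1 (fun _ _ => trivial) (fun a _ => ?_) (fun a _ => ?_) (fun a _ => ?_)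
      (a := ⟨a, ha⟩) trivial
    · rw [one_mul, derivative_taylorHom]
      rfl
    · rw [one_mul]
      exact hθ a a.2 _
    · rw [constantCoeff_taylorHom]
      exact hψ a a.2 _
  have := H ((algebraMap ℂ⟦X⟧ SeriesField).comp (taylorHom ψ)) fun a ha ha' => by
    rw [RingHom.comp_apply, deriv_algebraMap, deriv_eq, derivative_taylorHom]
    rfl
  rw [RingHom.comp_apply, heq b hbA] at this
  refine this.mono ?_
  rintro _ ⟨a, haS, ha, rfl⟩
  exact .base ⟨a, haS, hS haS, by rw [RingHom.comp_apply, heq a (hS haS)]⟩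

/-- Homomorphisms of fields commuting with the derivations up to a common factor preserve
elementary elements. -/
lemma IsElementaryOver.map {N N' : Type*} [Field N] [Differential N] [Field N'] [Differential N']
    (σ : N →+* N') (w : N') (hσ : ∀ a, (σ a)′ = w * σ a′) {S : Set N} {b : N}
    (hb : IsElementaryOver S b) : IsElementaryOver (σ '' S) (σ b) := by
  induction hb with
  | base ha => exact .base ⟨_, ha, rfl⟩
  | const hc => exact .const (by rw [hσ, hc, map_zero, mul_zero])
  | add _ _ iha ihb => rw [map_add]; exact iha.add ihb
  | mul _ _ iha ihb => rw [map_mul]; exact iha.mul ihb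
  | inv _ iha => rw [map_inv₀]; exact iha.inv
  | exp _ hb iha => exact iha.exp (by rw [hσ, hσ, hb, map_mul, mul_assoc])
  | log _ h0 hb iha =>
    exact iha.log (by simpa using h0) (by rw [hσ, hσ, ← hb, map_mul, mul_left_comm])
  | @alg P b _ hb hb' ih =>
    refine .alg (P.map σ) (fun i => by rw [Polynomial.coeff_map]; exact ih i) ?_ ?_
    · rw [Polynomial.eval_map_apply, hb, map_zero]
    · rw [Polynomial.derivative_map, Polynomial.eval_map_apply]
      simpa using hb'

end Series

/-! ### Holomorphic and meromorphic functions on a surface -/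

section Punctured

variable {U : Type*} [TopologicalSpace U] {p : U}

/-- What holds in a punctured neighbourhood holds near each of its points. -/
lemma eventually_nhdsNE_eventually_nhds [T1Space U] {P : U → Prop}
    (h : ∀ᶠ q in 𝓝[≠] p, P q) : ∀ᶠ q in 𝓝[≠] p, ∀ᶠ t in 𝓝 q, P t := by
  filter_upwards [eventually_eventually_nhdsWithin.2 h, self_mem_nhdsWithin] with q hq hqp
  rwa [IsOpen.nhdsWithin_eq isOpen_compl_singleton hqp] at hq

lemma isOpen_setOf_eventually_nhdsNE [T1Space U] (P : U → Prop) :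
    IsOpen {p : U | ∀ᶠ q in 𝓝[≠] p, P q} := by
  rw [isOpen_iff_eventually]
  intro p hp
  have h := eventually_nhdsNE_eventually_nhds hp
  rw [eventually_nhdsWithin_iff] at h
  filter_upwards [h] with q hq
  by_cases hqp : q = p
  · rw [hqp]; exact hp
  · exact (hq hqp).filter_mono nhdsWithin_le_nhds

end Punctured

section Charts

variable {U : Type*} [TopologicalSpace U] [ChartedSpace ℂ U]

/-- `f` is holomorphic at `q`. -/
abbrev HolAt (f : U → ℂ) (q : U) : Prop := ContMDiffAt 𝓘(ℂ) 𝓘(ℂ) ω f q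

/-- `f` is meromorphic at `p`. -/
def MerAt (f : U → ℂ) (p : U) : Prop :=
  MeromorphicAt (f ∘ (chartAt ℂ p).symm) (chartAt ℂ p p)

/-- `x` is a local coordinate at `q`: it is holomorphic with nonzero differential. -/
def IsCoordAt (x : U → ℂ) (q : U) : Prop := HolAt x q ∧ diffCoeff x q ≠ 0

variable {f g x : U → ℂ} {p q : U}

lemma tendsto_chartAt_nhdsNE (p : U) :
    Tendsto (chartAt ℂ p) (𝓝[≠] p) (𝓝[≠] (chartAt ℂ p p)) := by
  refine tendsto_nhdsWithin_of_tendsto_nhds_of_eventually_within _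
    (((chartAt ℂ p).continuousAt (mem_chart_source ℂ p)).tendsto.mono_left nhdsWithin_le_nhds) ?_
  filter_upwards [self_mem_nhdsWithin, mem_nhdsWithin_of_mem_nhds (chart_source_mem_nhds ℂ p)]
    with q hq hqs h
  exact hq ((chartAt ℂ p).injOn hqs (mem_chart_source ℂ p) h)

lemma tendsto_chartAt_symm_nhdsNE (p : U) :
    Tendsto (chartAt ℂ p).symm (𝓝[≠] (chartAt ℂ p p)) (𝓝[≠] p) := by
  refine tendsto_nhdsWithin_of_tendsto_nhds_of_eventually_within _ ?_ ?_
  · have := ((chartAt ℂ p).continuousAt_symm (mem_chart_target ℂ p)).tendsto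
    rw [(chartAt ℂ p).left_inv (mem_chart_source ℂ p)] at this
    exact this.mono_left nhdsWithin_le_nhds
  · filter_upwards [self_mem_nhdsWithin, mem_nhdsWithin_of_mem_nhds (chart_target_mem_nhds ℂ p)]
      with z hz hzt h
    refine hz ?_
    rw [← (chartAt ℂ p).right_inv hzt, h]
    rfl

lemma eventually_chartAt_symm_iff {P : U → Prop} (hq : q ∈ (chartAt ℂ p).source) :
    (∀ᶠ z in 𝓝 (chartAt ℂ p q), P ((chartAt ℂ p).symm z)) ↔ ∀ᶠ t in 𝓝 q, P t :=
  (chartAt ℂ p).eventually_nhds' P hq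

instance nhdsNE_neBot (p : U) : (𝓝[≠] p).NeBot :=
  (tendsto_chartAt_symm_nhdsNE p).neBot

lemma HolAt.congr (h : HolAt f q) (hfg : f =ᶠ[𝓝 q] g) : HolAt g q :=
  ContMDiffAt.congr_of_eventuallyEq h hfg.symm

lemma HolAt.const (c : ℂ) : HolAt (fun _ : U => c) q := contMDiffAt_const

lemma diffCoeff_congr (h : f =ᶠ[𝓝 q] g) : diffCoeff f q = diffCoeff g q := by
  refine Filter.EventuallyEq.deriv_eq ?_
  exact (eventually_chartAt_symm_iff (P := fun t => f t = g t) (mem_chart_source ℂ q)).2 h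

lemma derivAlong_congr (h : f =ᶠ[𝓝 q] g) : derivAlong x f =ᶠ[𝓝 q] derivAlong x g := by
  filter_upwards [eventually_eventually_nhds.2 h] with t ht
  rw [derivAlong, derivAlong, diffCoeff_congr ht]

lemma derivAlong_const (c : ℂ) : derivAlong x (fun _ => c) = fun _ : U => 0 := by
  ext q
  rw [derivAlong, diffCoeff, show (fun _ : U => c) ∘ (chartAt ℂ q).symm = fun _ => c from rfl]
  simp

variable [IsManifold 𝓘(ℂ) ω U]

lemma holAt_iff (hq : q ∈ (chartAt ℂ p).source) :
    HolAt f q ↔ AnalyticAt ℂ (f ∘ (chartAt ℂ p).symm) (chartAt ℂ p q) := by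
  rw [HolAt, contMDiffAt_iff_source_of_mem_source hq]
  simp only [mfld_simps, contMDiffWithinAt_univ]
  rw [contMDiffAt_iff_contDiffAt]
  exact ⟨ContDiffAt.analyticAt, AnalyticAt.contDiffAt⟩

lemma holAt_iff_self : HolAt f q ↔ AnalyticAt ℂ (f ∘ (chartAt ℂ q).symm) (chartAt ℂ q q) :=
  holAt_iff (mem_chart_source ℂ q)

lemma HolAt.eventually (h : HolAt f q) : ∀ᶠ t in 𝓝 q, HolAt f t := by
  have h1 := (holAt_iff_self.1 h).eventually_analyticAt
  filter_upwards [((chartAt ℂ q).continuousAt (mem_chart_source ℂ q)).eventually h1,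
    chart_source_mem_nhds ℂ q] with t ht hts
  exact (holAt_iff hts).2 ht

lemma HolAt.add (hf : HolAt f q) (hg : HolAt g q) : HolAt (f + g) q :=
  holAt_iff_self.2 ((holAt_iff_self.1 hf).add (holAt_iff_self.1 hg))

lemma HolAt.sub (hf : HolAt f q) (hg : HolAt g q) : HolAt (f - g) q :=
  holAt_iff_self.2 ((holAt_iff_self.1 hf).sub (holAt_iff_self.1 hg))

lemma HolAt.mul (hf : HolAt f q) (hg : HolAt g q) : HolAt (f * g) q :=
  holAt_iff_self.2 ((holAt_iff_self.1 hf).mul (holAt_iff_self.1 hg))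

lemma HolAt.inv (hf : HolAt f q) (h0 : f q ≠ 0) : HolAt f⁻¹ q :=
  holAt_iff_self.2 ((holAt_iff_self.1 hf).inv (by simpa using h0))

lemma HolAt.comp {φ : ℂ → ℂ} (hφ : AnalyticAt ℂ φ (f q)) (hf : HolAt f q) : HolAt (φ ∘ f) q :=
  holAt_iff_self.2 (AnalyticAt.comp (g := φ) (by simpa using hφ) (holAt_iff_self.1 hf))

lemma HolAt.merAt (hf : HolAt f q) : MerAt f q := (holAt_iff_self.1 hf).meromorphicAt

/-- A holomorphic function that vanishes on a punctured neighbourhood vanishes near the point. -/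
lemma HolAt.eventually_eq_zero (hf : HolAt f q) (h : ∀ᶠ t in 𝓝[≠] q, f t = 0) :
    ∀ᶠ t in 𝓝 q, f t = 0 := by
  have hz := (tendsto_chartAt_symm_nhdsNE q).eventually h
  have := (holAt_iff_self.1 hf).frequently_zero_iff_eventually_zero.1 hz.frequently
  exact (eventually_chartAt_symm_iff (P := fun t => f t = 0) (mem_chart_source ℂ q)).1 this

/-- The coefficient of `df` changes between charts by the derivative of the transition map. -/
lemma exists_diffCoeff_eq_mul (hq : q ∈ (chartAt ℂ p).source) :
    ∃ c : ℂ, c ≠ 0 ∧ ∀ f : U → ℂ, HolAt f q →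
      diffCoeff f q = deriv (f ∘ (chartAt ℂ p).symm) (chartAt ℂ p q) * c := by
  have hT (p₁ p₂ : U) (h₁ : q ∈ (chartAt ℂ p₁).source) (h₂ : q ∈ (chartAt ℂ p₂).source) :
      DifferentiableAt ℂ (chartAt ℂ p₁ ∘ (chartAt ℂ p₂).symm) (chartAt ℂ p₂ q) :=
    ((holAt_iff h₂).1 (contMDiffAt_of_mem_maximalAtlas
      (IsManifold.chart_mem_maximalAtlas p₁) h₁)).differentiableAt
  -- the change of charts for an arbitrary function, from which `c ≠ 0` follows for `f` a chart
  have hchain (p₁ p₂ : U) (h₁ : q ∈ (chartAt ℂ p₁).source) (h₂ : q ∈ (chartAt ℂ p₂).source)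
      (f : U → ℂ) (hf : HolAt f q) : deriv (f ∘ (chartAt ℂ p₂).symm) (chartAt ℂ p₂ q) =
        deriv (f ∘ (chartAt ℂ p₁).symm) (chartAt ℂ p₁ q) *
          deriv (chartAt ℂ p₁ ∘ (chartAt ℂ p₂).symm) (chartAt ℂ p₂ q) := by
    have hleft : (chartAt ℂ p₂).symm (chartAt ℂ p₂ q) = q := (chartAt ℂ p₂).left_inv h₂
    have hev : f ∘ (chartAt ℂ p₂).symm =ᶠ[𝓝 (chartAt ℂ p₂ q)]
        (f ∘ (chartAt ℂ p₁).symm) ∘ (chartAt ℂ p₁ ∘ (chartAt ℂ p₂).symm) := by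
      refine (eventually_chartAt_symm_iff (P := fun t => f t =
        f ((chartAt ℂ p₁).symm (chartAt ℂ p₁ t))) h₂).2 ?_
      filter_upwards [(chartAt ℂ p₁).open_source.mem_nhds h₁] with t ht
      rw [(chartAt ℂ p₁).left_inv ht]
    have hf₁ := ((holAt_iff h₁).1 hf).differentiableAt
    rw [hev.deriv_eq, deriv_comp _ (by simpa [hleft] using hf₁) (hT p₁ p₂ h₁ h₂)]
    simp [hleft]
  have hqs := mem_chart_source ℂ q
  refine ⟨_, fun h0 => ?_, fun f hf => hchain p q hq hqs f hf⟩
  have h := hchain p q hq hqs (chartAt ℂ q)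
    (contMDiffAt_of_mem_maximalAtlas (IsManifold.chart_mem_maximalAtlas q) hqs)
  rw [h0, mul_zero] at h
  have hid : chartAt ℂ q ∘ (chartAt ℂ q).symm =ᶠ[𝓝 (chartAt ℂ q q)] id := by
    filter_upwards [chart_target_mem_nhds ℂ q] with z hz
    exact (chartAt ℂ q).right_inv hz
  rw [hid.deriv_eq, deriv_id] at h
  exact one_ne_zero h

lemma derivAlong_eq (hq : q ∈ (chartAt ℂ p).source) (hx : HolAt x q) (hf : HolAt f q) :
    derivAlong x f q = deriv (f ∘ (chartAt ℂ p).symm) (chartAt ℂ p q) /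
      deriv (x ∘ (chartAt ℂ p).symm) (chartAt ℂ p q) := by
  obtain ⟨c, hc, h⟩ := exists_diffCoeff_eq_mul hq
  rw [derivAlong, h f hf, h x hx, mul_div_mul_right _ _ hc]

lemma derivAlong_comp_symm_eventuallyEq (hx : HolAt x q) (hf : HolAt f q) :
    derivAlong x f ∘ (chartAt ℂ q).symm =ᶠ[𝓝 (chartAt ℂ q q)]
      deriv (f ∘ (chartAt ℂ q).symm) / deriv (x ∘ (chartAt ℂ q).symm) := by
  have h : ∀ᶠ t in 𝓝 q, derivAlong x f t =
      deriv (f ∘ (chartAt ℂ q).symm) (chartAt ℂ q t) /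
        deriv (x ∘ (chartAt ℂ q).symm) (chartAt ℂ q t) := by
    filter_upwards [hx.eventually, hf.eventually, chart_source_mem_nhds ℂ q] with t hxt hft ht
    exact derivAlong_eq ht hxt hft
  filter_upwards [(eventually_chartAt_symm_iff (mem_chart_source ℂ q)).2 h,
    chart_target_mem_nhds ℂ q] with z hz hzt
  rw [(chartAt ℂ q).right_inv hzt] at hz
  exact hz

lemma IsCoordAt.eventually (hx : IsCoordAt x q) : ∀ᶠ t in 𝓝 q, IsCoordAt x t := by
  have h1 := (holAt_iff_self.1 hx.1).deriv.continuousAt.eventually_ne hx.2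
  filter_upwards [((chartAt ℂ q).continuousAt (mem_chart_source ℂ q)).eventually h1,
    chart_source_mem_nhds ℂ q, hx.1.eventually] with t ht hts hxt
  obtain ⟨c, hc, h⟩ := exists_diffCoeff_eq_mul hts
  exact ⟨hxt, by rw [h x hxt]; exact mul_ne_zero ht hc⟩

lemma HolAt.derivAlong (hx : IsCoordAt x q) (hf : HolAt f q) : HolAt (derivAlong x f) q := by
  refine holAt_iff_self.2 (AnalyticAt.congr ?_ (derivAlong_comp_symm_eventuallyEq hx.1 hf).symm)
  exact (holAt_iff_self.1 hf).deriv.div (holAt_iff_self.1 hx.1).deriv hx.2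

lemma derivAlong_add (hf : HolAt f q) (hg : HolAt g q) :
    derivAlong x (f + g) q = derivAlong x f q + derivAlong x g q := by
  rw [derivAlong, derivAlong, derivAlong, ← add_div]
  congr 1
  exact deriv_add (holAt_iff_self.1 hf).differentiableAt (holAt_iff_self.1 hg).differentiableAt

lemma derivAlong_mul (hf : HolAt f q) (hg : HolAt g q) :
    derivAlong x (f * g) q = f q * derivAlong x g q + g q * derivAlong x f q := by
  have h : diffCoeff (f * g) q = f q * diffCoeff g q + g q * diffCoeff f q := by
    refine (deriv_mul (holAt_iff_self.1 hf).differentiableAt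
      (holAt_iff_self.1 hg).differentiableAt).trans ?_
    simp [diffCoeff]
    ring
  rw [derivAlong, h, derivAlong, derivAlong]
  ring

lemma derivAlong_comp {φ : ℂ → ℂ} (hφ : DifferentiableAt ℂ φ (f q)) (hf : HolAt f q) :
    derivAlong x (φ ∘ f) q = deriv φ (f q) * derivAlong x f q := by
  have h : diffCoeff (φ ∘ f) q = deriv φ (f q) * diffCoeff f q := by
    rw [diffCoeff, Function.comp_assoc,
      deriv_comp _ (by simpa using hφ) (holAt_iff_self.1 hf).differentiableAt]
    simp [diffCoeff]
  rw [derivAlong, h, derivAlong, mul_div_assoc]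

/-- A function whose derivative vanishes off isolated points is locally constant. -/
lemma eventually_eq_of_derivAlong_eq_zero (hf : HolAt f q)
    (h : ∀ᶠ t in 𝓝[≠] q, IsCoordAt x t ∧ derivAlong x f t = 0) : ∀ᶠ t in 𝓝 q, f t = f q := by
  have hfa := holAt_iff_self.1 hf
  have h1 : ∀ᶠ t in 𝓝[≠] q, deriv (f ∘ (chartAt ℂ q).symm) (chartAt ℂ q t) = 0 := by
    filter_upwards [h, hf.eventually.filter_mono nhdsWithin_le_nhds,
      mem_nhdsWithin_of_mem_nhds (chart_source_mem_nhds ℂ q)] with t ⟨hxt, ht⟩ hft hts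
    obtain ⟨c, hc, hd⟩ := exists_diffCoeff_eq_mul hts
    have h2 := hxt.2
    rw [derivAlong_eq hts hxt.1 hft, div_eq_zero_iff] at ht
    rw [hd x hxt.1] at h2
    exact ht.resolve_right (left_ne_zero_of_mul h2)
  have hz : ∀ᶠ z in 𝓝 (chartAt ℂ q q), deriv (f ∘ (chartAt ℂ q).symm) z = 0 := by
    refine hfa.deriv.frequently_zero_iff_eventually_zero.1 (Filter.Eventually.frequently ?_)
    filter_upwards [(tendsto_chartAt_symm_nhdsNE q).eventually h1,
      mem_nhdsWithin_of_mem_nhds (chart_target_mem_nhds ℂ q)] with z hz hzt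
    rwa [(chartAt ℂ q).right_inv hzt] at hz
  obtain ⟨r, hr, hball⟩ := Metric.eventually_nhds_iff_ball.1 (hz.and hfa.eventually_analyticAt)
  refine (eventually_chartAt_symm_iff (mem_chart_source ℂ q)).1 ?_
  filter_upwards [Metric.ball_mem_nhds _ hr] with z hzb
  have := (Metric.isOpen_ball (x := chartAt ℂ q q) (ε := r)).is_const_of_deriv_eq_zero
    (convex_ball _ r).isPreconnected
    (fun w hw => (hball w hw).2.differentiableAt.differentiableWithinAt)
    (fun w hw => (hball w hw).1) hzb (Metric.mem_ball_self hr)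
  simpa using this

end Charts

section Meromorphic

variable {U : Type*} [TopologicalSpace U] [ChartedSpace ℂ U] {f g x : U → ℂ} {p q : U}

lemma MerAt.add (hf : MerAt f p) (hg : MerAt g p) : MerAt (f + g) p := MeromorphicAt.add hf hg

lemma MerAt.sub (hf : MerAt f p) (hg : MerAt g p) : MerAt (f - g) p := MeromorphicAt.sub hf hg

lemma MerAt.mul (hf : MerAt f p) (hg : MerAt g p) : MerAt (f * g) p := MeromorphicAt.mul hf hg

lemma MerAt.const (c : ℂ) : MerAt (fun _ : U => c) p := MeromorphicAt.const c _

lemma MerAt.eventually_eq_zero_or_ne_zero (hf : MerAt f p) :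
    (∀ᶠ q in 𝓝[≠] p, f q = 0) ∨ ∀ᶠ q in 𝓝[≠] p, f q ≠ 0 := by
  have key {P : U → Prop} (h : ∀ᶠ z in 𝓝[≠] (chartAt ℂ p p), P ((chartAt ℂ p).symm z)) :
      ∀ᶠ q in 𝓝[≠] p, P q := by
    filter_upwards [(tendsto_chartAt_nhdsNE p).eventually h,
      mem_nhdsWithin_of_mem_nhds (chart_source_mem_nhds ℂ p)] with q hq hqs
    rwa [(chartAt ℂ p).left_inv hqs] at hq
  exact (MeromorphicAt.eventually_eq_zero_or_eventually_ne_zero hf).imp key key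

/-- The identity theorem for meromorphic functions. -/
lemma eventually_eq_zero_of_isPreconnected [T1Space U] {V : Set U} (hVc : IsPreconnected V)
    (hf : ∀ q ∈ V, MerAt f q) (hp : p ∈ V) (h : ∀ᶠ t in 𝓝[≠] p, f t = 0) (hq : q ∈ V) :
    ∀ᶠ t in 𝓝[≠] q, f t = 0 := by
  refine hVc.subset_left_of_subset_union (isOpen_setOf_eventually_nhdsNE fun t => f t = 0)
    (isOpen_setOf_eventually_nhdsNE fun t => f t ≠ 0) ?_
    (fun q hq => (hf q hq).eventually_eq_zero_or_ne_zero) ⟨p, hp, h⟩ hq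
  refine Set.disjoint_left.2 fun q hq hq' => ?_
  obtain ⟨t, ht, ht'⟩ := (Filter.Eventually.and (Set.mem_ofPred.1 hq) (Set.mem_ofPred.1 hq')).exists
  exact ht' ht

variable [IsManifold 𝓘(ℂ) ω U]

lemma MerAt.eventually_holAt (hf : MerAt f p) : ∀ᶠ q in 𝓝[≠] p, HolAt f q := by
  filter_upwards [(tendsto_chartAt_nhdsNE p).eventually (MeromorphicAt.eventually_analyticAt hf),
    mem_nhdsWithin_of_mem_nhds (chart_source_mem_nhds ℂ p)] with q hq hqs
  exact (holAt_iff hqs).2 hq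

lemma MerAt.derivAlong (hx : MerAt x p) (hf : MerAt f p) : MerAt (derivAlong x f) p := by
  refine ((MeromorphicAt.deriv hf).div (MeromorphicAt.deriv hx)).congr ?_
  have h : ∀ᶠ q in 𝓝[≠] p, q ∈ (chartAt ℂ p).source ∧ HolAt x q ∧ HolAt f q := by
    filter_upwards [hx.eventually_holAt, hf.eventually_holAt,
      mem_nhdsWithin_of_mem_nhds (chart_source_mem_nhds ℂ p)] with q h1 h2 h3
    exact ⟨h3, h1, h2⟩
  filter_upwards [(tendsto_chartAt_symm_nhdsNE p).eventually h,
    mem_nhdsWithin_of_mem_nhds (chart_target_mem_nhds ℂ p)] with z ⟨h1, h2, h3⟩ hz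
  rw [Function.comp_apply, derivAlong_eq h1 h2 h3, (chartAt ℂ p).right_inv hz]
  rfl

/-- A nonconstant meromorphic function on a connected surface is a local coordinate off a set of
isolated points. -/
lemma eventually_isCoordAt [T1Space U] [PreconnectedSpace U] (hx : IsMeromorphic x)
    (hxc : ¬ ∃ c : ℂ, SameMeromorphic x fun _ => c) (p : U) : ∀ᶠ q in 𝓝[≠] p, IsCoordAt x q := by
  have hxp : MerAt x p := hx p
  have hloc : MeromorphicAt (deriv (x ∘ (chartAt ℂ p).symm)) (chartAt ℂ p p) := hxp.deriv
  rcases hloc.eventually_eq_zero_or_eventually_ne_zero with h0 | h0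
  · exfalso
    -- `x` is constant near some point near `p`, hence everywhere
    have h1 : ∀ᶠ q in 𝓝[≠] p, ∀ᶠ t in 𝓝 q, deriv (x ∘ (chartAt ℂ p).symm) (chartAt ℂ p t) = 0 :=
      eventually_nhdsNE_eventually_nhds ((tendsto_chartAt_nhdsNE p).eventually h0)
    have hsrc : ∀ᶠ q in 𝓝[≠] p, q ∈ (chartAt ℂ p).source :=
      mem_nhdsWithin_of_mem_nhds (chart_source_mem_nhds ℂ p)
    obtain ⟨q, hq, hqs', hqx⟩ := (h1.and (hsrc.and hxp.eventually_holAt)).exists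
    have h2 : ∀ᶠ z in 𝓝 (chartAt ℂ p q), deriv (x ∘ (chartAt ℂ p).symm) z = 0 := by
      filter_upwards [(eventually_chartAt_symm_iff hqs').2 hq,
        (chartAt ℂ p).open_target.mem_nhds ((chartAt ℂ p).map_source hqs')] with z hz hzt
      rwa [(chartAt ℂ p).right_inv hzt] at hz
    obtain ⟨r, hr, hball⟩ := Metric.eventually_nhds_iff_ball.1
      (h2.and ((holAt_iff hqs').1 hqx).eventually_analyticAt)
    have h3 : ∀ᶠ t in 𝓝 q, x t = x q := by
      refine (eventually_chartAt_symm_iff hqs').1 ?_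
      filter_upwards [Metric.ball_mem_nhds _ hr] with z hzb
      have := (Metric.isOpen_ball (x := chartAt ℂ p q) (ε := r)).is_const_of_deriv_eq_zero
        (convex_ball _ r).isPreconnected
        (fun w hw => (hball w hw).2.differentiableAt.differentiableWithinAt)
        (fun w hw => (hball w hw).1) hzb (Metric.mem_ball_self hr)
      simpa [(chartAt ℂ p).left_inv hqs'] using this
    refine hxc ⟨x q, fun t => ?_⟩
    have h4 := eventually_eq_zero_of_isPreconnected (f := x - fun _ => x q) isPreconnected_univ
      (fun s _ => (show MerAt x s from hx s).sub (.const _)) (Set.mem_univ q)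
      ((h3.filter_mono nhdsWithin_le_nhds).mono fun t ht => by simp [ht]) (Set.mem_univ t)
    filter_upwards [h4] with s hs
    simpa [sub_eq_zero] using hs
  · filter_upwards [(tendsto_chartAt_nhdsNE p).eventually h0, hxp.eventually_holAt,
      mem_nhdsWithin_of_mem_nhds (chart_source_mem_nhds ℂ p)] with q hq hqx hqs
    obtain ⟨c, hc, h⟩ := exists_diffCoeff_eq_mul hqs
    exact ⟨hqx, by rw [h x hqx]; exact mul_ne_zero hq hc⟩

end Meromorphic

/-! ### Taylor expansion along a local coordinate -/

section Taylor

open PowerSeries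

variable {U : Type*} [TopologicalSpace U] [ChartedSpace ℂ U] {f g x : U → ℂ} {q : U}

/-- The Taylor series of `f` at `q` in the local coordinate `x - x(q)`. -/
noncomputable def taylorAlong (x f : U → ℂ) (q : U) : ℂ⟦X⟧ :=
  mk fun n => (derivAlong x)^[n] f q / n.factorial

lemma constantCoeff_taylorAlong : constantCoeff (taylorAlong x f q) = f q := by
  simp [taylorAlong]

lemma derivative_taylorAlong :
    d⁄dX ℂ (taylorAlong x f q) = taylorAlong x (derivAlong x f) q := by
  ext n
  simp only [taylorAlong, coeff_derivative, coeff_mk, Function.iterate_succ_apply,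
    Nat.factorial_succ]
  push_cast
  field_simp

lemma taylorAlong_congr (h : f =ᶠ[𝓝 q] g) : taylorAlong x f q = taylorAlong x g q := by
  have key (n : ℕ) : (derivAlong x)^[n] f =ᶠ[𝓝 q] (derivAlong x)^[n] g := by
    induction n with
    | zero => exact h
    | succ n ih =>
      rw [Function.iterate_succ_apply', Function.iterate_succ_apply']
      exact derivAlong_congr ih
  ext n
  simp only [taylorAlong, coeff_mk, (key n).eq_of_nhds]

lemma taylorAlong_const (c : ℂ) : taylorAlong x (fun _ => c) q = C c := by
  ext n
  cases n with
  | zero => simp [taylorAlong]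
  | succ n =>
    have h0 := Function.iterate_fixed (derivAlong_const (x := x) (0 : ℂ)) n
    simp [taylorAlong, derivAlong_const, h0]

variable [IsManifold 𝓘(ℂ) ω U]

lemma derivAlong_add_eventuallyEq (hf : HolAt f q) (hg : HolAt g q) :
    derivAlong x (f + g) =ᶠ[𝓝 q] derivAlong x f + derivAlong x g := by
  filter_upwards [hf.eventually, hg.eventually] with t hft hgt using derivAlong_add hft hgt

lemma derivAlong_mul_eventuallyEq (hf : HolAt f q) (hg : HolAt g q) :
    derivAlong x (f * g) =ᶠ[𝓝 q] f * derivAlong x g + g * derivAlong x f := by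
  filter_upwards [hf.eventually, hg.eventually] with t hft hgt using derivAlong_mul hft hgt

lemma taylorAlong_add (hx : IsCoordAt x q) (hf : HolAt f q) (hg : HolAt g q) :
    taylorAlong x (f + g) q = taylorAlong x f q + taylorAlong x g q := by
  refine PowerSeries.eq_of_deriv_eq_mul (ι := (U → ℂ) × (U → ℂ))
    (P := fun a => HolAt a.1 q ∧ HolAt a.2 q) (δ := Prod.map (derivAlong x) (derivAlong x))
    (F := fun a => taylorAlong x (a.1 + a.2) q)
    (G := fun a => taylorAlong x a.1 q + taylorAlong x a.2 q) 1
    (fun a ha => ⟨ha.1.derivAlong hx, ha.2.derivAlong hx⟩) (fun a ha => ?_) (fun a ha => ?_)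
    (fun a ha => by simp [constantCoeff_taylorAlong]) (a := (f, g)) ⟨hf, hg⟩
  · rw [one_mul, derivative_taylorAlong, taylorAlong_congr (derivAlong_add_eventuallyEq ha.1 ha.2)]
    rfl
  · rw [one_mul, map_add, derivative_taylorAlong, derivative_taylorAlong]
    rfl

lemma taylorAlong_mul (hx : IsCoordAt x q) (hf : HolAt f q) (hg : HolAt g q) :
    taylorAlong x (f * g) q = taylorAlong x f q * taylorAlong x g q := by
  have key (n : ℕ) : ∀ f g : U → ℂ, HolAt f q → HolAt g q →
      coeff n (taylorAlong x (f * g) q) = coeff n (taylorAlong x f q * taylorAlong x g q) := by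
    induction n with
    | zero =>
      intro f g _ _
      simp [constantCoeff_taylorAlong]
    | succ n ih =>
      intro f g hf hg
      have hDf := hf.derivAlong hx
      have hDg := hg.derivAlong hx
      have h : coeff n (d⁄dX ℂ (taylorAlong x (f * g) q)) =
          coeff n (d⁄dX ℂ (taylorAlong x f q * taylorAlong x g q)) := by
        rw [derivative_taylorAlong, taylorAlong_congr (derivAlong_mul_eventuallyEq hf hg),
          taylorAlong_add hx (hf.mul hDg) (hg.mul hDf), map_add, ih _ _ hf hDg, ih _ _ hg hDf,
          Derivation.leibniz, derivative_taylorAlong, derivative_taylorAlong, map_add,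
          smul_eq_mul, smul_eq_mul]
      rw [coeff_derivative, coeff_derivative] at h
      exact mul_right_cancel₀ (Nat.cast_add_one_ne_zero n) h
  exact PowerSeries.ext fun n => key n f g hf hg

/-- The functions holomorphic at `q`. -/
def holSubring (q : U) : Subring (U → ℂ) where
  carrier := {f | HolAt f q}
  mul_mem' := HolAt.mul
  one_mem' := .const 1
  add_mem' := HolAt.add
  zero_mem' := .const 0
  neg_mem' {f} hf := by
    have := HolAt.mul (.const (-1)) hf
    rwa [show (fun _ : U => (-1 : ℂ)) * f = -f by ext; simp] at this

/-- Taylor expansion at `q` as a ring homomorphism. -/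
noncomputable def taylorAlongHom (hx : IsCoordAt x q) : holSubring q →+* ℂ⟦X⟧ where
  toFun f := taylorAlong x f q
  map_one' := taylorAlong_const 1
  map_zero' := (taylorAlong_const 0).trans (map_zero C)
  map_add' f g := taylorAlong_add hx f.2 g.2
  map_mul' f g := taylorAlong_mul hx f.2 g.2

/-- A holomorphic function with zero Taylor series vanishes locally: the derivation lowers a finite
order of vanishing by one. -/
lemma eventually_eq_zero_of_taylorAlong_eq_zero (hx : IsCoordAt x q) (hf : HolAt f q)
    (h : taylorAlong x f q = 0) : ∀ᶠ t in 𝓝 q, f t = 0 := by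
  have key (n : ℕ) : ∀ f : U → ℂ, HolAt f q → taylorAlong x f q = 0 →
      analyticOrderAt (f ∘ (chartAt ℂ q).symm) (chartAt ℂ q q) ≠ n := by
    induction n with
    | zero =>
      intro f hf h hn
      have h0 : f q = 0 := by rw [← constantCoeff_taylorAlong (x := x) (f := f), h, map_zero]
      have := (holAt_iff_self.1 hf).analyticOrderAt_ne_zero.2 (by simpa using h0)
      exact this (by simpa using hn)
    | succ n ih =>
      intro f hf h hn
      refine ih _ (hf.derivAlong hx) (by rw [← derivative_taylorAlong, h, map_zero]) ?_
      have hfa := holAt_iff_self.1 hf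
      have hxa := (holAt_iff_self.1 hx.1).deriv
      rw [analyticOrderAt_congr (derivAlong_comp_symm_eventuallyEq hx.1 hf)]
      have h1 : deriv (f ∘ (chartAt ℂ q).symm) / deriv (x ∘ (chartAt ℂ q).symm) =
          deriv (f ∘ (chartAt ℂ q).symm) * (deriv (x ∘ (chartAt ℂ q).symm))⁻¹ :=
        div_eq_mul_inv _ _
      have h2 : (deriv (x ∘ (chartAt ℂ q).symm))⁻¹ (chartAt ℂ q q) ≠ 0 := inv_ne_zero hx.2
      rw [h1, analyticOrderAt_mul hfa.deriv (hxa.inv hx.2),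
        (hxa.inv hx.2).analyticOrderAt_eq_zero.2 h2, add_zero]
      exact analyticOrderAt_deriv_of_pos hfa (by exact_mod_cast hn)
  have htop : analyticOrderAt (f ∘ (chartAt ℂ q).symm) (chartAt ℂ q q) = ⊤ := by
    by_contra hne
    obtain ⟨n, hn⟩ := ENat.ne_top_iff_exists.1 hne
    exact key n f hf h hn.symm
  exact (eventually_chartAt_symm_iff (mem_chart_source ℂ q)).1 (analyticOrderAt_eq_top.1 htop)

lemma derivAlong_id (ψ : ℂ → ℂ) : derivAlong (fun z : ℂ => z) ψ = deriv ψ := by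
  ext z
  change deriv ψ z / deriv (fun z : ℂ => z) z = deriv ψ z
  simp

lemma _root_.PowerSeries.constantCoeff_subst_eq {φ G : ℂ⟦X⟧} (h : constantCoeff G = 0) :
    constantCoeff (φ.subst G) = constantCoeff φ := by
  have hs : HasSubst G := HasSubst.of_constantCoeff_zero h
  conv_lhs => rw [eq_X_mul_shift_add_const φ]
  rw [subst_add hs, subst_mul hs, subst_X hs, map_add, map_mul, h, zero_mul, zero_add]
  rw [subst_C]
  exact constantCoeff_C _

/-- The Taylor series of a composition with a function of one variable. -/
lemma taylorAlong_comp {φ : ℂ → ℂ} (hx : IsCoordAt x q) (hg : HolAt g q)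
    (hφ : AnalyticAt ℂ φ (g q)) : taylorAlong x (φ ∘ g) q =
      (taylorAlong (fun z : ℂ => z) φ (g q)).subst (taylorAlong x g q - C (g q)) := by
  have h0 : constantCoeff (taylorAlong x g q - C (g q)) = 0 := by
    rw [map_sub, constantCoeff_taylorAlong, constantCoeff_C, sub_self]
  have hs : HasSubst (taylorAlong x g q - C (g q)) := HasSubst.of_constantCoeff_zero h0
  refine PowerSeries.eq_of_deriv_eq_mul (P := fun φ : ℂ → ℂ => AnalyticAt ℂ φ (g q)) (δ := deriv)
    (F := fun φ => taylorAlong x (φ ∘ g) q)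
    (G := fun φ => (taylorAlong (fun z : ℂ => z) φ (g q)).subst (taylorAlong x g q - C (g q)))
    (taylorAlong x (derivAlong x g) q) (fun φ hφ => hφ.deriv) (fun φ hφ => ?_) (fun φ hφ => ?_)
    (fun φ hφ => ?_) hφ
  · rw [derivative_taylorAlong, ← taylorAlong_mul hx (hg.derivAlong hx) (.comp hφ.deriv hg)]
    refine taylorAlong_congr ?_
    filter_upwards [hg.eventually, hg.continuousAt.eventually hφ.eventually_analyticAt] with t ht h
    rw [derivAlong_comp h.differentiableAt ht, mul_comm]
    rfl
  · rw [derivative_subst hs, derivative_taylorAlong, derivAlong_id, map_sub, derivative_C, sub_zero,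
      derivative_taylorAlong, mul_comm]
  · rw [constantCoeff_taylorAlong, PowerSeries.constantCoeff_subst_eq h0,
      constantCoeff_taylorAlong]
    rfl

end Taylor

/-! ### Elementary germs -/

instance : CharZero SeriesField :=
  have : CharZero (PowerSeries ℂ) :=
    charZero_of_injective_algebraMap (algebraMap ℂ (PowerSeries ℂ)).injective
  charZero_of_injective_algebraMap (IsFractionRing.injective (PowerSeries ℂ) SeriesField)

section Germs

open Differential

variable {U : Type*} [TopologicalSpace U] [ChartedSpace ℂ U]
  {f g h x : U → ℂ} {K L : Set (U → ℂ)} {p q : U}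

/-- The Taylor series of `f` at `q` along `x`, as an element of the field of Laurent series. -/
noncomputable def expansion (x f : U → ℂ) (q : U) : SeriesField :=
  algebraMap (PowerSeries ℂ) SeriesField (taylorAlong x f q)

/-- The expansions at `q` of the functions of `K` that are holomorphic at `q`. -/
def baseSeries (x : U → ℂ) (K : Set (U → ℂ)) (q : U) : Set SeriesField :=
  {n | ∃ k ∈ K, HolAt k q ∧ n = expansion x k q}

/-- The germ of `f` at `q` is elementary over the functions of `K`, within the Laurent series
in the local coordinate `x - x(q)`. -/
def IsElementaryGerm (x : U → ℂ) (K : Set (U → ℂ)) (q : U) (f : U → ℂ) : Prop :=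
  IsElementaryOver (baseSeries x K q) (expansion x f q)

lemma expansion_congr (hfg : f =ᶠ[𝓝 q] g) : expansion x f q = expansion x g q := by
  rw [expansion, expansion, taylorAlong_congr hfg]

lemma deriv_expansion : (expansion x f q)′ = expansion x (derivAlong x f) q := by
  rw [expansion, deriv_algebraMap, PowerSeries.deriv_eq, derivative_taylorAlong, expansion]

lemma expansion_const (c : ℂ) : expansion x (fun _ => c) q =
    algebraMap (PowerSeries ℂ) SeriesField (PowerSeries.C c) := by
  rw [expansion, taylorAlong_const]

lemma deriv_expansion_const (c : ℂ) : (expansion x (fun _ => c) q)′ = 0 := by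
  rw [deriv_expansion, derivAlong_const, expansion_const, map_zero, map_zero]

lemma expansion_one : expansion x (1 : U → ℂ) q = 1 := by
  rw [show (1 : U → ℂ) = fun _ => 1 from rfl, expansion_const, map_one, map_one]

lemma expansion_zero : expansion x (0 : U → ℂ) q = 0 := by
  rw [show (0 : U → ℂ) = fun _ => 0 from rfl, expansion_const, map_zero, map_zero]

lemma IsElementaryGerm.congr (hf : IsElementaryGerm x K q f) (hfg : f =ᶠ[𝓝 q] g) :
    IsElementaryGerm x K q g := by
  rw [IsElementaryGerm, ← expansion_congr hfg]
  exact hf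

lemma IsElementaryGerm.const (c : ℂ) : IsElementaryGerm x K q fun _ => c :=
  IsElementaryOver.const (deriv_expansion_const c)

lemma IsElementaryGerm.base (hf : f ∈ K) (hfq : HolAt f q) : IsElementaryGerm x K q f :=
  IsElementaryOver.base ⟨f, hf, hfq, rfl⟩

lemma IsElementaryGerm.deriv (hK : ∀ k ∈ K, HolAt k q → IsElementaryGerm x K q (derivAlong x k))
    (hf : IsElementaryGerm x K q f) : IsElementaryGerm x K q (derivAlong x f) := by
  rw [IsElementaryGerm, ← deriv_expansion]
  refine IsElementaryOver.deriv ?_ hf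
  rintro _ ⟨k, hk, hkq, rfl⟩
  rw [deriv_expansion]
  exact hK k hk hkq

variable [IsManifold 𝓘(ℂ) ω U]

lemma expansion_add (hx : IsCoordAt x q) (hf : HolAt f q) (hg : HolAt g q) :
    expansion x (f + g) q = expansion x f q + expansion x g q := by
  rw [expansion, taylorAlong_add hx hf hg, map_add, expansion, expansion]

lemma expansion_mul (hx : IsCoordAt x q) (hf : HolAt f q) (hg : HolAt g q) :
    expansion x (f * g) q = expansion x f q * expansion x g q := by
  rw [expansion, taylorAlong_mul hx hf hg, map_mul, expansion, expansion]

lemma expansion_sub (hx : IsCoordAt x q) (hf : HolAt f q) (hg : HolAt g q) :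
    expansion x (f - g) q = expansion x f q - expansion x g q := by
  rw [eq_sub_iff_add_eq, ← expansion_add hx (hf.sub hg) hg, sub_add_cancel]

lemma expansion_pow (hx : IsCoordAt x q) (hf : HolAt f q) (n : ℕ) :
    expansion x (f ^ n) q = expansion x f q ^ n :=
  map_pow ((algebraMap (PowerSeries ℂ) SeriesField).comp (taylorAlongHom hx))
    (⟨f, hf⟩ : holSubring q) n

lemma expansion_sum (hx : IsCoordAt x q) {ι : Type*} (s : Finset ι) {f : ι → U → ℂ}
    (hf : ∀ i, HolAt (f i) q) :
    expansion x (∑ i ∈ s, f i) q = ∑ i ∈ s, expansion x (f i) q := by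
  have h := map_sum ((algebraMap (PowerSeries ℂ) SeriesField).comp (taylorAlongHom hx))
    (fun i => (⟨f i, hf i⟩ : holSubring q)) s
  refine Eq.trans ?_ h
  change _ = expansion x ((∑ i ∈ s, (⟨f i, hf i⟩ : holSubring q) : holSubring q) : U → ℂ) q
  rw [AddSubmonoidClass.coe_finsetSum]

lemma expansion_eq_zero_iff (hx : IsCoordAt x q) (hf : HolAt f q) :
    expansion x f q = 0 ↔ ∀ᶠ t in 𝓝 q, f t = 0 := by
  refine ⟨fun h => eventually_eq_zero_of_taylorAlong_eq_zero hx hf ?_, fun h => ?_⟩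
  · exact (map_eq_zero_iff _ (IsFractionRing.injective (PowerSeries ℂ) SeriesField)).1 h
  · rw [expansion_congr (g := fun _ => 0) h, expansion_const, map_zero, map_zero]

lemma expansion_ne_zero (hx : IsCoordAt x q) (hf : HolAt f q) (h0 : f q ≠ 0) :
    expansion x f q ≠ 0 :=
  fun h => h0 ((expansion_eq_zero_iff hx hf).1 h).self_of_nhds

lemma expansion_inv (hx : IsCoordAt x q) (hf : HolAt f q) (h0 : f q ≠ 0) :
    expansion x f⁻¹ q = (expansion x f q)⁻¹ := by
  refine eq_inv_of_mul_eq_one_left ?_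
  rw [← expansion_mul hx (hf.inv h0) hf, ← expansion_one (x := x) (q := q)]
  refine expansion_congr ?_
  filter_upwards [hf.continuousAt.eventually_ne h0] with t ht
  simp [ht]

namespace IsElementaryGerm

lemma add (hx : IsCoordAt x q) (hfq : HolAt f q) (hgq : HolAt g q)
    (hf : IsElementaryGerm x K q f) (hg : IsElementaryGerm x K q g) :
    IsElementaryGerm x K q (f + g) := by
  rw [IsElementaryGerm, expansion_add hx hfq hgq]
  exact IsElementaryOver.add hf hg

lemma sub (hx : IsCoordAt x q) (hfq : HolAt f q) (hgq : HolAt g q)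
    (hf : IsElementaryGerm x K q f) (hg : IsElementaryGerm x K q g) :
    IsElementaryGerm x K q (f - g) := by
  rw [IsElementaryGerm, expansion_sub hx hfq hgq]
  exact IsElementaryOver.sub hf hg

lemma mul (hx : IsCoordAt x q) (hfq : HolAt f q) (hgq : HolAt g q)
    (hf : IsElementaryGerm x K q f) (hg : IsElementaryGerm x K q g) :
    IsElementaryGerm x K q (f * g) := by
  rw [IsElementaryGerm, expansion_mul hx hfq hgq]
  exact IsElementaryOver.mul hf hg

lemma inv (hx : IsCoordAt x q) (hfq : HolAt f q) (h0 : f q ≠ 0)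
    (hf : IsElementaryGerm x K q f) : IsElementaryGerm x K q f⁻¹ := by
  rw [IsElementaryGerm, expansion_inv hx hfq h0]
  exact IsElementaryOver.inv hf

/-- A solution of `h' = f' h`, with `f` elementary, is elementary. -/
lemma exp (hx : IsCoordAt x q) (hfq : HolAt f q) (hhq : HolAt h q)
    (hf : IsElementaryGerm x K q f) (hh : derivAlong x h =ᶠ[𝓝 q] derivAlong x f * h) :
    IsElementaryGerm x K q h := by
  refine IsElementaryOver.exp hf ?_
  rw [deriv_expansion, deriv_expansion, expansion_congr hh,
    expansion_mul hx (hfq.derivAlong hx) hhq]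

/-- A solution of `f h' = f'`, with `f` elementary, is elementary. -/
lemma log (hx : IsCoordAt x q) (hfq : HolAt f q) (hhq : HolAt h q) (h0 : f q ≠ 0)
    (hf : IsElementaryGerm x K q f) (hh : f * derivAlong x h =ᶠ[𝓝 q] derivAlong x f) :
    IsElementaryGerm x K q h := by
  refine IsElementaryOver.log hf (expansion_ne_zero hx hfq h0) ?_
  rw [deriv_expansion, deriv_expansion, ← expansion_mul hx hfq (hhq.derivAlong hx),
    expansion_congr hh]

open Polynomial in
lemma algebraic (hx : IsCoordAt x q) {n : ℕ} {c : Fin n → U → ℂ}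
    (hcq : ∀ i, HolAt (c i) q) (hhq : HolAt h q) (hc : ∀ i, IsElementaryGerm x K q (c i))
    (hh : ∀ᶠ t in 𝓝 q, h t ^ n + ∑ i, c i t * h t ^ (i : ℕ) = 0) :
    IsElementaryGerm x K q h := by
  have hpow (k : ℕ) : HolAt (h ^ k) q := ((⟨h, hhq⟩ : holSubring q) ^ k).2
  have hsum : HolAt (∑ i, c i * h ^ (i : ℕ)) q :=
    sum_mem (S := holSubring q) fun i _ => (hcq i).mul (hpow i)
  have h0 : expansion x (h ^ n + ∑ i, c i * h ^ (i : ℕ)) q = 0 := by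
    refine (expansion_eq_zero_iff hx ((hpow n).add hsum)).2 ?_
    filter_upwards [hh] with t ht
    simpa using ht
  rw [expansion_add hx (hpow n) hsum, expansion_sum hx _ fun i => (hcq i).mul (hpow i)] at h0
  have hcoeff (j : ℕ) : (X ^ n + ∑ i : Fin n, C (expansion x (c i) q) * X ^ (i : ℕ)).coeff j =
      if hj : j < n then expansion x (c ⟨j, hj⟩) q else if j = n then 1 else 0 := by
    rw [coeff_add, finsetSum_coeff, coeff_X_pow]
    simp only [coeff_C_mul_X_pow]
    split_ifs with h1 h2 h2
    · omega
    · rw [Finset.sum_eq_zero fun i _ => if_neg (by omega), add_zero]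
    · rw [zero_add, Finset.sum_eq_single ⟨j, h2⟩ (fun i _ hi => if_neg fun h => hi ?_) (by simp)]
      · simp
      · exact Fin.ext h.symm
    · rw [Finset.sum_eq_zero fun i _ => if_neg (by omega), add_zero]
  refine IsElementaryOver.of_isRoot
    (X ^ n + ∑ i : Fin n, C (expansion x (c i) q) * X ^ (i : ℕ)) (fun h => ?_) (fun j => ?_) ?_
  · have := hcoeff n
    simp [h] at this
  · rw [hcoeff]
    split_ifs with h1
    · exact hc _
    · exact .const (by simp)
    · exact .const (by simp)
  · rw [← h0]
    simp only [eval_add, eval_finsetSum, eval_mul, eval_pow, eval_X, eval_C]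
    rw [expansion_pow hx hhq]
    simp only [expansion_mul hx (hcq _) (hpow _), expansion_pow hx hhq]

end IsElementaryGerm

end Germs

/-- An element elementary over `S` is elementary over a finite subset of `S`. -/
lemma IsElementaryOver.exists_finite {N : Type*} [Field N] [Differential N] {S : Set N} {b : N}
    (hb : IsElementaryOver S b) : ∃ T ⊆ S, T.Finite ∧ IsElementaryOver T b := by
  have hmono {T T' : Set N} (h : T ⊆ T') {b : N} (hb : IsElementaryOver T b) :
      IsElementaryOver T' b := hb.mono fun a ha => .base (h ha)
  induction hb with
  | @base a ha => exact ⟨{a}, by simpa using ha, Set.finite_singleton a, .base rfl⟩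
  | const hc => exact ⟨∅, by simp, Set.finite_empty, .const hc⟩
  | add _ _ iha ihb =>
    obtain ⟨T, hT, hTf, ha⟩ := iha
    obtain ⟨T', hT', hTf', hb⟩ := ihb
    exact ⟨T ∪ T', Set.union_subset hT hT', hTf.union hTf',
      .add (hmono Set.subset_union_left ha) (hmono Set.subset_union_right hb)⟩
  | mul _ _ iha ihb =>
    obtain ⟨T, hT, hTf, ha⟩ := iha
    obtain ⟨T', hT', hTf', hb⟩ := ihb
    exact ⟨T ∪ T', Set.union_subset hT hT', hTf.union hTf',
      .mul (hmono Set.subset_union_left ha) (hmono Set.subset_union_right hb)⟩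
  | inv _ iha =>
    obtain ⟨T, hT, hTf, ha⟩ := iha
    exact ⟨T, hT, hTf, .inv ha⟩
  | exp _ hb iha =>
    obtain ⟨T, hT, hTf, ha⟩ := iha
    exact ⟨T, hT, hTf, .exp ha hb⟩
  | log _ h0 hb iha =>
    obtain ⟨T, hT, hTf, ha⟩ := iha
    exact ⟨T, hT, hTf, .log ha h0 hb⟩
  | alg P _ hb hb' ih =>
    choose T hT hTf hP using ih
    refine ⟨⋃ i ∈ Set.Iic P.natDegree, T i, Set.iUnion₂_subset fun i _ => hT i,
      (Set.finite_Iic _).biUnion fun i _ => hTf i, .alg P (fun i => ?_) hb hb'⟩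
    rcases le_or_gt i P.natDegree with hi | hi
    · exact hmono (Set.subset_biUnion_of_mem (u := T) (Set.mem_Iic.2 hi)) (hP i)
    · rw [Polynomial.coeff_eq_zero_of_natDegree_lt hi]
      exact .const (by simp)

/-! ### Analytic continuation of elementary germs -/

section Continuation

open Differential

variable {U : Type*} [TopologicalSpace U] [ChartedSpace ℂ U] [IsManifold 𝓘(ℂ) ω U]
  {f g x : U → ℂ} {K G : Set (U → ℂ)} {V : Set U} {p q : U}

/-- The functions meromorphic on `V` that are holomorphic at those points where `x` is a local
coordinate and all functions of `G` are holomorphic. -/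
def regularSubring (x : U → ℂ) (G : Set (U → ℂ)) (V : Set U) : Subring (U → ℂ) where
  carrier := {f | (∀ q ∈ V, MerAt f q) ∧
    ∀ q ∈ V, IsCoordAt x q → (∀ h ∈ G, HolAt h q) → HolAt f q}
  mul_mem' hf hg := ⟨fun q hq => (hf.1 q hq).mul (hg.1 q hq), fun q hq hx hG =>
    (hf.2 q hq hx hG).mul (hg.2 q hq hx hG)⟩
  one_mem' := ⟨fun _ _ => .const 1, fun _ _ _ _ => .const 1⟩
  add_mem' hf hg := ⟨fun q hq => (hf.1 q hq).add (hg.1 q hq), fun q hq hx hG =>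
    (hf.2 q hq hx hG).add (hg.2 q hq hx hG)⟩
  zero_mem' := ⟨fun _ _ => .const 0, fun _ _ _ _ => .const 0⟩
  neg_mem' {f} hf := ⟨fun q hq => by
    have := (MerAt.const 0).sub (hf.1 q hq)
    rwa [show (fun _ : U => (0 : ℂ)) - f = -f by ext; simp] at this, fun q hq hx hG =>
    (holSubring q).neg_mem (hf.2 q hq hx hG)⟩

lemma derivAlong_mem_regularSubring (hx : ∀ q ∈ V, MerAt x q) (hf : f ∈ regularSubring x G V) :
    derivAlong x f ∈ regularSubring x G V :=
  ⟨fun q hq => (hx q hq).derivAlong (hf.1 q hq), fun q hq hxq hG =>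
    (hf.2 q hq hxq hG).derivAlong hxq⟩

/-- The Taylor expansion at a point `q` of `V` as a homomorphism on `regularSubring`. -/
noncomputable def regularTaylor (hq : q ∈ V) (hx : IsCoordAt x q) (hG : ∀ h ∈ G, HolAt h q) :
    regularSubring x G V →+* PowerSeries ℂ :=
  (taylorAlongHom hx).comp (Subring.inclusion fun _ hf => hf.2 q hq hx hG)

lemma regularTaylor_apply (hq : q ∈ V) (hx : IsCoordAt x q) (hG : ∀ h ∈ G, HolAt h q)
    (f : regularSubring x G V) : regularTaylor hq hx hG f = taylorAlong x f q := rfl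

variable [T1Space U]

/-- By the identity theorem, the Taylor expansions at all points have the same kernel. -/
lemma ker_regularTaylor_le (hV : IsPreconnected V) (hp : p ∈ V) (hxp : IsCoordAt x p)
    (hGp : ∀ h ∈ G, HolAt h p) (hq : q ∈ V) (hxq : IsCoordAt x q) (hGq : ∀ h ∈ G, HolAt h q) :
    RingHom.ker (regularTaylor hp hxp hGp) ≤ RingHom.ker (regularTaylor hq hxq hGq) := by
  rintro ⟨f, hf⟩ h
  rw [RingHom.mem_ker, regularTaylor_apply] at h ⊢
  have h0 := eventually_eq_zero_of_taylorAlong_eq_zero hxp (hf.2 p hp hxp hGp) h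
  have h1 := eventually_eq_zero_of_isPreconnected hV hf.1 hp
    (h0.filter_mono nhdsWithin_le_nhds) hq
  have h2 : f =ᶠ[𝓝 q] fun _ => 0 :=
     (hf.2 q hq hxq hGq).eventually_eq_zero h1
  change taylorAlong x f q = 0
  rw [taylorAlong_congr h2, taylorAlong_const, map_zero]

/-- **Continuation of elementary germs.**  If the germ at one point of a holomorphic function on a
connected open set `V` is elementary over `K`, then so are its germs at all points of `V`, with
isolated exceptions: the expansions at two points correspond under a differential isomorphism of
the ring of all functions involved. -/
theorem IsElementaryGerm.eventually_of_isPreconnected (hVo : IsOpen V) (hV : IsPreconnected V)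
    (hx : ∀ q ∈ V, MerAt x q) (hxc : ∀ q ∈ V, ∀ᶠ t in 𝓝[≠] q, IsCoordAt x t)
    (hK : ∀ k ∈ K, ∀ q ∈ V, MerAt k q) (hg : ∀ q ∈ V, HolAt g q) (hp : p ∈ V)
    (hxp : IsCoordAt x p) (h : IsElementaryGerm x K p g) (hq : q ∈ V) :
    ∀ᶠ t in 𝓝[≠] q, IsElementaryGerm x K t g := by
  obtain ⟨T, hTK, hTf, hT⟩ := IsElementaryOver.exists_finite h
  have hTK' : ∀ a ∈ T, ∃ k ∈ K, HolAt k p ∧ a = expansion x k p := fun a ha => hTK ha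
  choose! κ hκK hκp hκ using hTK'
  let G : Set (U → ℂ) := insert g (κ '' T)
  have hGf : G.Finite := (hTf.image κ).insert g
  have hGm : ∀ f ∈ G, ∀ q ∈ V, MerAt f q := by
    rintro f (rfl | ⟨a, ha, rfl⟩) q hq
    · exact (hg q hq).merAt
    · exact hK _ (hκK a ha) q hq
  have hGp : ∀ f ∈ G, HolAt f p := by
    rintro f (rfl | ⟨a, ha, rfl⟩)
    · exact hg p hp
    · exact hκp a ha
  have hGR : ∀ f ∈ G, f ∈ regularSubring x G V := fun f hf =>
    ⟨hGm f hf, fun q _ _ hG => hG f hf⟩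
  let ρ : regularSubring x G V →+* SeriesField :=
    (algebraMap (PowerSeries ℂ) SeriesField).comp (regularTaylor hp hxp hGp)
  have hinj := IsFractionRing.injective (PowerSeries ℂ) SeriesField
  have hρ (f : regularSubring x G V) : ρ f = expansion x f p := rfl
  have hρd (f : regularSubring x G V) :
      (ρ f)′ = ρ ⟨derivAlong x f, derivAlong_mem_regularSubring hx f.2⟩ := by
    rw [hρ, hρ, deriv_expansion]
  have hTρ : ∀ a ∈ T, ∃ hR : κ a ∈ regularSubring x G V, a = ρ ⟨κ a, hR⟩ := fun a ha =>
    ⟨hGR _ (.inr ⟨a, ha, rfl⟩), hκ a ha⟩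
  obtain ⟨u, hu0, hu⟩ := IsElementaryOver.exists_forall_hom (A := ρ.range) hT
    (fun a ha => by obtain ⟨hR, h⟩ := hTρ a ha; exact ⟨_, h.symm⟩)
    (by rintro _ ⟨f, rfl⟩; exact ⟨_, (hρd f).symm⟩) ⟨⟨g, hGR g (.inl rfl)⟩, rfl⟩
  obtain ⟨u, hur⟩ := u
  obtain ⟨υ, rfl⟩ := RingHom.mem_range.1 hur
  -- the exceptional points are those where `x` is not a coordinate, where one of the functions
  -- involved has a pole, and the zeros of `υ`
  have hυ : ∀ᶠ t in 𝓝[≠] q, υ.1 t ≠ 0 := by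
    refine (υ.2.1 q hq).eventually_eq_zero_or_ne_zero.resolve_left fun h0 => hu0 ?_
    have h1 := eventually_eq_zero_of_isPreconnected hV υ.2.1 hq h0 hp
    have hυp := υ.2.2 p hp hxp hGp
    exact Subtype.ext ((expansion_eq_zero_iff hxp hυp).2 (hυp.eventually_eq_zero h1))
  filter_upwards [hυ, hxc q hq, mem_nhdsWithin_of_mem_nhds (hVo.mem_nhds hq),
    (hGf.eventually_all).2 fun f hf => (hGm f hf q hq).eventually_holAt] with t hυt hxt htV hGt
  let E := regularTaylor htV hxt hGt
  have hker : RingHom.ker ρ.rangeRestrict ≤ RingHom.ker E := by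
    intro f hf
    refine ker_regularTaylor_le hV hp hxp hGp htV hxt hGt ?_
    rw [RingHom.mem_ker] at hf ⊢
    exact hinj ((congrArg Subtype.val hf).trans (map_zero _).symm)
  let θ : ρ.range →+* PowerSeries ℂ :=
    RingHom.liftOfSurjective ρ.rangeRestrict ρ.rangeRestrict_surjective ⟨E, hker⟩
  have hθ (f : regularSubring x G V) (hf : ρ f ∈ ρ.range) : θ ⟨ρ f, hf⟩ = taylorAlong x f t :=
    RingHom.liftOfRightInverse_comp_apply _ _ _ ⟨E, hker⟩ f
  rw [IsElementaryGerm, expansion, ← hθ ⟨g, hGR g (.inl rfl)⟩ ⟨_, rfl⟩]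
  refine (hu θ ?_ ?_).mono ?_
  · intro a ha ha'
    obtain ⟨f, rfl⟩ := RingHom.mem_range.1 ha
    rw [hθ, derivative_taylorAlong]
    refine Eq.trans (hθ ⟨derivAlong x f, derivAlong_mem_regularSubring hx f.2⟩ ?_).symm ?_
    · exact ⟨_, rfl⟩
    · congr 2
      exact (hρd f).symm
  · rw [hθ, constantCoeff_taylorAlong]
    exact hυt
  · rintro _ ⟨a, ha, haA, rfl⟩
    obtain ⟨hR, h⟩ := hTρ a ha
    refine .base ⟨κ a, hκK a ha, hGt _ (.inr ⟨a, ha, rfl⟩), ?_⟩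
    rw [expansion, ← hθ ⟨κ a, hR⟩ ⟨_, rfl⟩]
    congr 3

end Continuation

/-! ### Composition with elementary functions of one variable -/

open Differential in
lemma deriv_div_field {N : Type*} [Field N] [Differential N] (a b : N) :
    (a / b)′ = b⁻¹ ^ 2 * (b * a′ - a * b′) := by
  simpa using Differential.deriv.leibniz_div a b

open Differential in
lemma deriv_mul_field {N : Type*} [Field N] [Differential N] (a b : N) :
    (a * b)′ = a * b′ + b * a′ := by
  simp

section Composition

open Differential PowerSeries

/-- Substitution into a power series of a series without constant term is injective if that series
is not constant. -/
lemma PowerSeries.subst_injective {G : ℂ⟦X⟧} (h : constantCoeff G = 0) (hG : d⁄dX ℂ G ≠ 0) :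
    Function.Injective (substAlgHom (R := ℂ) (HasSubst.of_constantCoeff_zero h)) := by
  rw [injective_iff_map_eq_zero]
  have key (n : ℕ) : ∀ F : ℂ⟦X⟧, F.subst G = 0 → coeff n F = 0 := by
    induction n with
    | zero =>
      intro F hF
      rw [coeff_zero_eq_constantCoeff_apply, ← constantCoeff_subst_eq h, hF, map_zero]
    | succ n ih =>
      intro F hF
      have h1 := derivative_subst (f := F) (HasSubst.of_constantCoeff_zero h)
      rw [hF, map_zero, eq_comm, mul_eq_zero] at h1
      have h2 := ih _ (h1.resolve_right hG)
      rw [coeff_derivative, mul_eq_zero] at h2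
      exact h2.resolve_right (Nat.cast_add_one_ne_zero n)
  intro F hF
  rw [coe_substAlgHom] at hF
  exact PowerSeries.ext fun n => by rw [key n F hF, map_zero]

/-- The extension to Laurent series of the substitution of a nonconstant power series without
constant term. -/
lemma SeriesField.exists_substHom {G : ℂ⟦X⟧} (h : constantCoeff G = 0) (hG : d⁄dX ℂ G ≠ 0) :
    ∃ σ : SeriesField →+* SeriesField,
      (∀ F : ℂ⟦X⟧, σ (algebraMap ℂ⟦X⟧ SeriesField F) = algebraMap ℂ⟦X⟧ SeriesField (F.subst G)) ∧
      ∀ a, (σ a)′ = algebraMap ℂ⟦X⟧ SeriesField (d⁄dX ℂ G) * σ a′ := by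
  have hs : HasSubst G := HasSubst.of_constantCoeff_zero h
  let σ : SeriesField →+* SeriesField := IsFractionRing.map (A := ℂ⟦X⟧) (B := ℂ⟦X⟧)
    (j := (substAlgHom (R := ℂ) hs : ℂ⟦X⟧ →+* ℂ⟦X⟧)) (PowerSeries.subst_injective h hG)
  have hσ (F : ℂ⟦X⟧) : σ (algebraMap ℂ⟦X⟧ SeriesField F) =
      algebraMap ℂ⟦X⟧ SeriesField (F.subst G) := by
    rw [← coe_substAlgHom (R := ℂ) hs]
    exact IsLocalization.map_eq _ F
  have hσd (F : ℂ⟦X⟧) : (σ (algebraMap ℂ⟦X⟧ SeriesField F))′ =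
      algebraMap ℂ⟦X⟧ SeriesField (d⁄dX ℂ G) * σ (algebraMap ℂ⟦X⟧ SeriesField F)′ := by
    rw [hσ, deriv_algebraMap, deriv_algebraMap, hσ, deriv_eq, deriv_eq, derivative_subst hs,
      map_mul, mul_comm]
  refine ⟨σ, hσ, fun a => ?_⟩
  obtain ⟨F, H, hH, rfl⟩ := IsFractionRing.div_surjective (A := ℂ⟦X⟧) a
  rw [map_div₀, deriv_div_field, deriv_div_field, hσd, hσd]
  simp only [map_mul, map_sub, map_pow, map_inv₀]
  ring

variable {U : Type*} [TopologicalSpace U] [ChartedSpace ℂ U] [IsManifold 𝓘(ℂ) ω U]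
  {g x : U → ℂ} {φ : ℂ → ℂ} {K : Set (U → ℂ)} {q : U}

/-- Composition at a point where the inner function has nonzero derivative. -/
lemma IsElementaryGerm.comp (hx : IsCoordAt x q) (hgq : HolAt g q)
    (hφq : AnalyticAt ℂ φ (g q)) (hg' : derivAlong x g q ≠ 0) (hg : IsElementaryGerm x K q g)
    (hφ : IsElementaryGerm (fun z : ℂ => z) {fun z : ℂ => z} (g q) φ) :
    IsElementaryGerm x K q (φ ∘ g) := by
  have h0 : constantCoeff (taylorAlong x g q - C (g q)) = 0 := by
    rw [map_sub, constantCoeff_taylorAlong, constantCoeff_C, sub_self]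
  have hG : d⁄dX ℂ (taylorAlong x g q - C (g q)) ≠ 0 := fun h => hg' <| by
    rw [map_sub, derivative_C, sub_zero, derivative_taylorAlong] at h
    rw [← constantCoeff_taylorAlong (x := x) (f := derivAlong x g), h, map_zero]
  obtain ⟨σ, hσ, hσd⟩ := SeriesField.exists_substHom h0 hG
  have hcomp (ψ : ℂ → ℂ) (hψ : AnalyticAt ℂ ψ (g q)) :
      expansion x (ψ ∘ g) q = σ (expansion (fun z : ℂ => z) ψ (g q)) := by
    rw [expansion, expansion, hσ, taylorAlong_comp hx hgq hψ]
  rw [IsElementaryGerm, hcomp φ hφq]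
  refine (IsElementaryOver.map σ _ hσd hφ).mono ?_
  rintro _ ⟨_, ⟨k, hk, -, rfl⟩, rfl⟩
  obtain rfl := Set.mem_singleton_iff.1 hk
  rw [← hcomp (fun z => z) analyticAt_id]
  exact hg

end Composition

/-! ### Multivalued elementary functions -/

section Near

variable {U : Type*} [TopologicalSpace U] [ChartedSpace ℂ U]
  {f g h x : U → ℂ} {K : Set (U → ℂ)} {p q : U}

/-- `f` is holomorphic at `p`, and its germs at the points near `p`, with `p` itself possibly
excepted, are elementary over `K`.  The exception allows for the singular points of the functions
from which `f` is built. -/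
def IsElementaryNear (x : U → ℂ) (K : Set (U → ℂ)) (p : U) (f : U → ℂ) : Prop :=
  HolAt f p ∧ ∀ᶠ q in 𝓝[≠] p, IsElementaryGerm x K q f

namespace IsElementaryNear

lemma const (c : ℂ) : IsElementaryNear x K p fun _ => c :=
  ⟨.const c, .of_forall fun _ => .const c⟩

lemma congr (hf : IsElementaryNear x K p f) (hfg : f =ᶠ[𝓝 p] g) :
    IsElementaryNear x K p g := by
  refine ⟨hf.1.congr hfg, ?_⟩
  filter_upwards [hf.2, hfg.eventually_nhds.filter_mono nhdsWithin_le_nhds] with q hq hfg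
    using hq.congr hfg

variable [IsManifold 𝓘(ℂ) ω U]

lemma base (hf : f ∈ K) (hfp : HolAt f p) : IsElementaryNear x K p f :=
  ⟨hfp, hfp.merAt.eventually_holAt.mono fun _ h => .base hf h⟩

lemma add (hx : ∀ᶠ q in 𝓝[≠] p, IsCoordAt x q) (hf : IsElementaryNear x K p f)
    (hg : IsElementaryNear x K p g) : IsElementaryNear x K p (f + g) := by
  refine ⟨hf.1.add hg.1, ?_⟩
  filter_upwards [hx, hf.2, hg.2, hf.1.merAt.eventually_holAt, hg.1.merAt.eventually_holAt]
    with q hxq hf hg hfq hgq using hf.add hxq hfq hgq hg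

lemma sub (hx : ∀ᶠ q in 𝓝[≠] p, IsCoordAt x q) (hf : IsElementaryNear x K p f)
    (hg : IsElementaryNear x K p g) : IsElementaryNear x K p (f - g) := by
  refine ⟨hf.1.sub hg.1, ?_⟩
  filter_upwards [hx, hf.2, hg.2, hf.1.merAt.eventually_holAt, hg.1.merAt.eventually_holAt]
    with q hxq hf hg hfq hgq using hf.sub hxq hfq hgq hg

lemma mul (hx : ∀ᶠ q in 𝓝[≠] p, IsCoordAt x q) (hf : IsElementaryNear x K p f)
    (hg : IsElementaryNear x K p g) : IsElementaryNear x K p (f * g) := by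
  refine ⟨hf.1.mul hg.1, ?_⟩
  filter_upwards [hx, hf.2, hg.2, hf.1.merAt.eventually_holAt, hg.1.merAt.eventually_holAt]
    with q hxq hf hg hfq hgq using hf.mul hxq hfq hgq hg

lemma inv (hx : ∀ᶠ q in 𝓝[≠] p, IsCoordAt x q) (hf : IsElementaryNear x K p f) (h0 : f p ≠ 0) :
    IsElementaryNear x K p f⁻¹ := by
  refine ⟨hf.1.inv h0, ?_⟩
  filter_upwards [hx, hf.2, hf.1.merAt.eventually_holAt,
    (hf.1.continuousAt.eventually_ne h0).filter_mono nhdsWithin_le_nhds]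
    with q hxq hf hfq h0 using hf.inv hxq hfq h0

lemma div (hx : ∀ᶠ q in 𝓝[≠] p, IsCoordAt x q) (hf : IsElementaryNear x K p f)
    (hg : IsElementaryNear x K p g) (h0 : g p ≠ 0) : IsElementaryNear x K p (f / g) := by
  rw [div_eq_mul_inv]
  exact hf.mul hx (hg.inv hx h0)

lemma algebraic (hx : ∀ᶠ q in 𝓝[≠] p, IsCoordAt x q) {n : ℕ} {c : Fin n → U → ℂ}
    (hc : ∀ i, IsElementaryNear x K p (c i)) (hh : HolAt h p)
    (h0 : ∀ᶠ t in 𝓝 p, h t ^ n + ∑ i, c i t * h t ^ (i : ℕ) = 0) :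
    IsElementaryNear x K p h := by
  refine ⟨hh, ?_⟩
  filter_upwards [hx, hh.merAt.eventually_holAt, eventually_all.2 fun i => (hc i).2,
    eventually_all.2 fun i => (hc i).1.merAt.eventually_holAt,
    h0.eventually_nhds.filter_mono nhdsWithin_le_nhds] with q hxq hhq hc hcq h0
    using .algebraic hxq hcq hhq hc h0

lemma deriv (hx : IsCoordAt x p)
    (hK : ∀ k ∈ K, ∀ q, IsCoordAt x q → HolAt k q → IsElementaryGerm x K q (derivAlong x k))
    (hf : IsElementaryNear x K p f) : IsElementaryNear x K p (derivAlong x f) := by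
  refine ⟨hf.1.derivAlong hx, ?_⟩
  filter_upwards [hf.2, hx.eventually.filter_mono nhdsWithin_le_nhds] with q hf hxq
    using hf.deriv fun k hk => hK k hk q hxq

variable [T1Space U]

lemma comp (hxp : MerAt x p) (hx : ∀ᶠ q in 𝓝[≠] p, IsCoordAt x q) {φ : ℂ → ℂ}
    (hg : IsElementaryNear x K p g)
    (hφ : IsElementaryNear (fun z : ℂ => z) {fun z : ℂ => z} (g p) φ) :
    IsElementaryNear x K p (φ ∘ g) := by
  have hφa : AnalyticAt ℂ φ (g p) := ContMDiffAt.contDiffAt hφ.1 |>.analyticAt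
  refine ⟨.comp hφa hg.1, ?_⟩
  rcases (hxp.derivAlong hg.1.merAt).eventually_eq_zero_or_ne_zero with h0 | h0
  · -- `g` is constant near `p`
    have h1 := eventually_eq_of_derivAlong_eq_zero hg.1 (hx.and h0)
    filter_upwards [h1.eventually_nhds.filter_mono nhdsWithin_le_nhds] with q hq
    refine IsElementaryGerm.congr (.const (φ (g p))) ?_
    filter_upwards [hq] with t ht
    simp [ht]
  · -- `g` avoids the value `g p` near `p`, so that it maps general points to general points
    have h1 : ∀ᶠ t in 𝓝[≠] p, g t ≠ g p := by
      have := (hg.1.sub (.const (g p))).merAt.eventually_eq_zero_or_ne_zero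
      refine (this.resolve_left fun hz => ?_).mono fun t ht => by simpa [sub_eq_zero] using ht
      obtain ⟨t, ht, ht'⟩ := (h0.and (eventually_nhdsNE_eventually_nhds hz)).exists
      refine ht ?_
      have : g =ᶠ[𝓝 t] fun _ => g p := ht'.mono fun s hs => by simpa [sub_eq_zero] using hs
      rw [(derivAlong_congr this).self_of_nhds, derivAlong_const]
    have h2 : Tendsto g (𝓝[≠] p) (𝓝[≠] (g p)) :=
      tendsto_nhdsWithin_of_tendsto_nhds_of_eventually_within _
        (hg.1.continuousAt.tendsto.mono_left nhdsWithin_le_nhds) h1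
    filter_upwards [h0, hx, hg.2, hg.1.merAt.eventually_holAt, h2.eventually hφ.2,
      h2.eventually (hφa.eventually_analyticAt.filter_mono nhdsWithin_le_nhds)]
      with q h0 hxq hgq hgh hφq hφa using hgq.comp hxq hgh hφa h0 hφq

/-- Elementarity is preserved by analytic continuation: `p` is first replaced by a nearby point at
which `x` is a local coordinate and the germ is elementary. -/
lemma continuation (hx : ∀ p, MerAt x p) (hxc : ∀ p, ∀ᶠ q in 𝓝[≠] p, IsCoordAt x q)
    (hK : ∀ k ∈ K, ∀ p, MerAt k p) (hf : IsElementaryNear x K p f) {V : Set U} (hVo : IsOpen V)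
    (hV : IsPreconnected V) (hp : p ∈ V) (hq : q ∈ V) (hg : ∀ q ∈ V, HolAt g q)
    (hfg : f =ᶠ[𝓝 p] g) : IsElementaryNear x K q g := by
  refine ⟨hg q hq, ?_⟩
  obtain ⟨t, htV, hxt, hft, hfgt⟩ := (((hVo.eventually_mem hp).filter_mono
    nhdsWithin_le_nhds).and ((hxc p).and (hf.2.and
    (hfg.eventually_nhds.filter_mono nhdsWithin_le_nhds)))).exists
  exact IsElementaryGerm.eventually_of_isPreconnected hVo hV (fun q _ => hx q) (fun q _ => hxc q)
    (fun k hk q _ => hK k hk q) hg htV hxt (hft.congr hfgt) hq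

end IsElementaryNear

end Near

/-! ### Exponentials and logarithms of functions -/

section ExpLog

variable {U : Type*} [TopologicalSpace U] [ChartedSpace ℂ U] [IsManifold 𝓘(ℂ) ω U]
  {f l x : U → ℂ} {K : Set (U → ℂ)} {p q : U}

lemma mul_derivAlong_log (hl : HolAt l q) (h : ∀ᶠ t in 𝓝 q, Complex.exp (l t) = f t) :
    f * derivAlong x l =ᶠ[𝓝 q] derivAlong x f := by
  have h' : Complex.exp ∘ l =ᶠ[𝓝 q] f := h
  filter_upwards [derivAlong_congr (x := x) h', hl.eventually, h] with t ht hlt h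
  rw [← ht, derivAlong_comp (Complex.differentiable_exp _) hlt, Complex.deriv_exp, h]
  rfl

namespace IsElementaryNear

lemma const_mul (c : ℂ) (hx : ∀ᶠ q in 𝓝[≠] p, IsCoordAt x q) (hf : IsElementaryNear x K p f) :
    IsElementaryNear x K p fun t => c * f t :=
  (IsElementaryNear.const c).mul hx hf

lemma cexp (hx : ∀ᶠ q in 𝓝[≠] p, IsCoordAt x q) (hf : IsElementaryNear x K p f) :
    IsElementaryNear x K p fun t => Complex.exp (f t) := by
  have hexp (z : ℂ) : AnalyticAt ℂ Complex.exp z := Complex.differentiable_exp.analyticAt z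
  refine ⟨.comp (hexp _) hf.1, ?_⟩
  filter_upwards [hx, hf.2, hf.1.merAt.eventually_holAt] with q hxq hf hfq
  refine hf.exp hxq hfq (.comp (hexp _) hfq) ?_
  filter_upwards [hfq.eventually] with t hft
  refine (derivAlong_comp (hexp _).differentiableAt hft).trans ?_
  rw [Complex.deriv_exp, mul_comm]
  rfl

lemma clog (hx : ∀ᶠ q in 𝓝[≠] p, IsCoordAt x q) (hf : IsElementaryNear x K p f)
    (hl : HolAt l p) (h : ∀ᶠ t in 𝓝 p, Complex.exp (l t) = f t) : IsElementaryNear x K p l := by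
  refine ⟨hl, ?_⟩
  filter_upwards [hx, hf.2, hf.1.merAt.eventually_holAt, hl.merAt.eventually_holAt,
    h.eventually_nhds.filter_mono nhdsWithin_le_nhds] with q hxq hf hfq hlq h
  refine hf.log hxq hfq hlq (h.self_of_nhds ▸ Complex.exp_ne_zero _)
    (mul_derivAlong_log hlq h)

end IsElementaryNear

end ExpLog

/-! ### Elementary functions of one variable -/

section OneVariable

variable {f g : ℂ → ℂ} {z : ℂ}

lemma holAt_iff_analyticAt : HolAt f z ↔ AnalyticAt ℂ f z :=
  holAt_iff_self

lemma isCoordAt_id (z : ℂ) : IsCoordAt (fun w : ℂ => w) z := by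
  refine ⟨holAt_iff_analyticAt.2 analyticAt_id, ?_⟩
  change deriv (fun w : ℂ => w) z ≠ 0
  simp

lemma eventually_isCoordAt_id (z : ℂ) : ∀ᶠ w in 𝓝[≠] z, IsCoordAt (fun w : ℂ => w) w :=
  .of_forall isCoordAt_id

/-- The germs of functions of one variable that are elementary over the independent variable. -/
abbrev IsElementaryNearVar (z : ℂ) (f : ℂ → ℂ) : Prop :=
  IsElementaryNear (fun w : ℂ => w) {fun w : ℂ => w} z f

namespace IsElementaryNearVar

lemma var (z : ℂ) : IsElementaryNearVar z fun w => w := .base rfl (isCoordAt_id z).1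

/-- A function `g` is elementary if `e = exp (i g)` satisfies a quadratic equation
`d e ^ 2 = b + a e`, as it does for the inverse trigonometric functions. -/
lemma of_exp_quadratic {a b d : ℂ → ℂ} (ha : IsElementaryNearVar z a)
    (hb : IsElementaryNearVar z b) (hd : IsElementaryNearVar z d) (hd0 : d z ≠ 0)
    (hg : AnalyticAt ℂ g z)
    (h : ∀ᶠ w in 𝓝 z, (Complex.cos (g w) + Complex.sin (g w) * Complex.I) ^ 2 * d w =
      b w + a w * (Complex.cos (g w) + Complex.sin (g w) * Complex.I)) :
    IsElementaryNearVar z g := by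
  have hx := eventually_isCoordAt_id z
  have hgI : AnalyticAt ℂ (fun w => g w * Complex.I) z := hg.mul analyticAt_const
  have he : IsElementaryNearVar z fun w => Complex.exp (g w * Complex.I) := by
    refine IsElementaryNear.algebraic hx (c := ![fun w => -1 * (b / d) w, fun w => -1 * (a / d) w])
      (fun i => ?_) (holAt_iff_analyticAt.2 hgI.cexp) ?_
    · fin_cases i
      · exact (hb.div hx hd hd0).const_mul (-1) hx
      · exact (ha.div hx hd hd0).const_mul (-1) hx
    · filter_upwards [h, hd.1.continuousAt.eventually_ne hd0] with w hw hdw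
      simp only [Fin.sum_univ_two, Complex.exp_mul_I, Matrix.cons_val_zero, Matrix.cons_val_one,
        Pi.div_apply, Fin.val_zero, Fin.val_one, pow_zero, pow_one]
      field_simp
      linear_combination hw
  refine ((he.clog hx (holAt_iff_analyticAt.2 hgI) (.of_forall fun _ => rfl)).const_mul
    (-Complex.I) hx).congr (.of_forall fun w => ?_)
  linear_combination -(g w) * Complex.I_mul_I

lemma sin (z : ℂ) : IsElementaryNearVar z Complex.sin := by
  have hx := eventually_isCoordAt_id z
  refine (((((var z).const_mul (-Complex.I) hx).cexp hx).sub hx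
    (((var z).const_mul Complex.I hx).cexp hx)).const_mul (Complex.I / 2) hx).congr
    (.of_forall fun w => ?_)
  simp only [Complex.sin, Pi.sub_apply]
  rw [mul_comm Complex.I w, show -Complex.I * w = -w * Complex.I by ring]
  ring

lemma cos (z : ℂ) : IsElementaryNearVar z Complex.cos := by
  have hx := eventually_isCoordAt_id z
  refine (((((var z).const_mul Complex.I hx).cexp hx).add hx
    (((var z).const_mul (-Complex.I) hx).cexp hx)).const_mul (1 / 2) hx).congr
    (.of_forall fun w => ?_)
  simp only [Complex.cos, Pi.add_apply]
  rw [mul_comm Complex.I w, show -Complex.I * w = -w * Complex.I by ring]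
  ring

lemma of_isBasicElementary (hf : IsBasicElementary z f) : IsElementaryNearVar z f := by
  have hx := eventually_isCoordAt_id z
  have hI := Complex.I_mul_I
  cases hf with
  | const _ c => exact .const c
  | var => exact var z
  | exp => exact (var z).cexp hx
  | log _ _ hl h => exact (var z).clog hx (holAt_iff_analyticAt.2 hl) h
  | pow α _ l hl h =>
    exact (((var z).clog hx (holAt_iff_analyticAt.2 hl) h).const_mul α hx).cexp hx
  | sin => exact sin z
  | cos => exact cos z
  | tan _ h => exact (sin z).div hx (cos z) h
  | cot _ h => exact (cos z).div hx (sin z) h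
  | arcsin _ _ hg h =>
    refine of_exp_quadratic ((var z).const_mul (2 * Complex.I) hx) (.const 1) (.const 1) one_ne_zero
      hg ?_
    filter_upwards [h] with w hw
    linear_combination Complex.sin_sq_add_cos_sq (f w) - Complex.sin (f w) ^ 2 * hI +
      2 * Complex.I * (Complex.cos (f w) + Complex.sin (f w) * Complex.I) * hw
  | arccos _ _ hg h =>
    refine of_exp_quadratic ((var z).const_mul 2 hx) (.const (-1)) (.const 1) one_ne_zero hg ?_
    filter_upwards [h] with w hw
    linear_combination -Complex.sin_sq_add_cos_sq (f w) + Complex.sin (f w) ^ 2 * hI +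
      2 * (Complex.cos (f w) + Complex.sin (f w) * Complex.I) * hw
  | arctan _ _ hg h =>
    refine of_exp_quadratic (.const 0) (.add hx (.const 1) ((var z).const_mul Complex.I hx))
      (.add hx (.const 1) ((var z).const_mul (-Complex.I) hx)) (fun h0 => ?_) hg ?_
    · have hw := h.self_of_nhds
      simp only [Pi.add_apply] at h0
      refine one_ne_zero (α := ℂ) ?_
      linear_combination -Complex.sin_sq_add_cos_sq (f z) +
        (Complex.sin (f z) + z * Complex.cos (f z)) * hw +
        Complex.cos (f z) ^ 2 * (1 + Complex.I * z) * h0 + Complex.cos (f z) ^ 2 * z ^ 2 * hI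
    filter_upwards [h] with w hw
    simp only [Pi.add_apply]
    linear_combination (1 + Complex.I * w) * Complex.sin_sq_add_cos_sq (f w) -
      (1 + Complex.I * w) * Complex.cos (f w) ^ 2 * w ^ 2 * hI +
      (Complex.I * (Complex.cos (f w) + Complex.sin (f w) * Complex.I +
        Complex.cos (f w) * (1 + Complex.I * w)) * (1 - Complex.I * w) -
        (1 + Complex.I * w) * (Complex.sin (f w) + w * Complex.cos (f w))) * hw
  | arccot _ _ hg h =>
    refine of_exp_quadratic (.const 0) (.add hx (var z) (.const Complex.I))
      (.sub hx (var z) (.const Complex.I)) (fun h0 => ?_) hg ?_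
    · have hw := h.self_of_nhds
      simp only [Pi.sub_apply] at h0
      refine one_ne_zero (α := ℂ) ?_
      linear_combination -Complex.sin_sq_add_cos_sq (f z) +
        (Complex.cos (f z) + z * Complex.sin (f z)) * hw +
        Complex.sin (f z) ^ 2 * (z + Complex.I) * h0 + Complex.sin (f z) ^ 2 * hI
    filter_upwards [h] with w hw
    simp only [Pi.add_apply, Pi.sub_apply]
    linear_combination (w + Complex.I) * Complex.sin_sq_add_cos_sq (f w) -
      (w + Complex.I) * Complex.sin (f w) ^ 2 * hI +
      ((Complex.cos (f w) + Complex.sin (f w) * Complex.I +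
        Complex.sin (f w) * (w + Complex.I)) * (w - Complex.I) -
        (w + Complex.I) * (Complex.cos (f w) + w * Complex.sin (f w))) * hw

end IsElementaryNearVar

/-- Every generalized elementary function of one variable is elementary near every point. -/
lemma IsGenElementary.isElementaryNearVar (hf : IsGenElementary z f) :
    IsElementaryNearVar z f := by
  have hx := eventually_isCoordAt_id
  have hm (p : ℂ) : MerAt (fun w : ℂ => w) p := (isCoordAt_id p).1.merAt
  induction hf with
  | basic hf => exact .of_isBasicElementary hf
  | continuation _ V hV hc hz hw hg hfg ih =>
    exact ih.continuation hm hx (by rintro k rfl; exact hm) hV hc hz hw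
      (fun q hq => holAt_iff_analyticAt.2 (hg q hq)) hfg
  | comp _ _ ihg ihf => exact ihg.comp (hm _) (hx _) ihf
  | add _ _ ihf ihg => exact ihf.add (hx _) ihg
  | sub _ _ ihf ihg => exact ihf.sub (hx _) ihg
  | mul _ _ ihf ihg => exact ihf.mul (hx _) ihg
  | div _ _ h ihf ihg => exact ihf.div (hx _) ihg h
  | deriv _ ih =>
    rw [← derivAlong_id]
    refine ih.deriv (isCoordAt_id _) ?_
    rintro k rfl q - -
    rw [derivAlong_id, deriv_id'']
    exact .const 1
  | algebraic hn c y _ hy h ih =>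
    exact .algebraic (hx _) ih (holAt_iff_analyticAt.2 hy) h

end OneVariable

/-! ### Elementary functions over a functional differential field -/

section OverField

variable {U : Type*} [TopologicalSpace U] [T1Space U] [PreconnectedSpace U] [ChartedSpace ℂ U]
  [IsManifold 𝓘(ℂ) ω U] {x f : U → ℂ} {K : FunctionalDifferentialField U x} {p : U}

lemma IsGenElementaryOver.isElementaryNear (hx : IsMeromorphic x)
    (hxc : ¬ ∃ c : ℂ, SameMeromorphic x fun _ => c) (hf : IsGenElementaryOver K p f) :
    IsElementaryNear x K.toSubalgebra p f := by
  have hco := eventually_isCoordAt hx hxc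
  induction hf with
  | base hf hp => exact .base hf hp
  | continuation _ hfg ih =>
    obtain ⟨V, hVo, hV, hp, hq, hg, hfg⟩ := hfg
    exact ih.continuation hx hco (fun k hk => K.isMeromorphic_of_mem hk) hVo hV hp hq
      (fun q hq => hg.contMDiffAt (hVo.mem_nhds hq)) hfg
  | comp _ hφ ih => exact ih.comp (hx _) (hco _) hφ.isElementaryNearVar
  | add _ _ ihf ihg => exact ihf.add (hco _) ihg
  | sub _ _ ihf ihg => exact ihf.sub (hco _) ihg
  | mul _ _ ihf ihg => exact ihf.mul (hco _) ihg
  | div _ _ h ihf ihg => exact ihf.div (hco _) ihg h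
  | deriv _ hxp h ih =>
    exact ih.deriv ⟨hxp, h⟩ fun k hk q hxq hkq => .base (K.deriv_mem hk) (hkq.derivAlong hxq)
  | algebraic hn c y _ hy h ih => exact .algebraic (hco _) ih hy h

end OverField

section LogGerm

variable {U : Type*} [TopologicalSpace U] [ChartedSpace ℂ U] [IsManifold 𝓘(ℂ) ω U]
  {f x : U → ℂ} {p q : U}

lemma exists_isOpen_isPreconnected_holAt (hf : HolAt f p) :
    ∃ V : Set U, IsOpen V ∧ IsPreconnected V ∧ p ∈ V ∧ ∀ q ∈ V, HolAt f q := by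
  have := ChartedSpace.locallyConnectedSpace ℂ U
  obtain ⟨V, hV, hVo, hpV, hVc⟩ :=
    locallyConnectedSpace_iff_subsets_isOpen_isConnected.1 this p _ hf.eventually
  exact ⟨V, hVo, hVc.isPreconnected, hpV, fun q hq => hV hq⟩

/-- A branch near `c` of the logarithm with given value at `c`. -/
lemma analyticAt_log_div_add {c : ℂ} (hc : c ≠ 0) (b : ℂ) :
    AnalyticAt ℂ (fun w => Complex.log (w / c) + b) c :=
  ((analyticAt_id.div analyticAt_const hc).clog (by simp [hc])).add analyticAt_const

lemma exp_log_div_add {c b : ℂ} (hb : Complex.exp b = c) {w : ℂ} (hw : w ≠ 0) :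
    Complex.exp (Complex.log (w / c) + b) = w := by
  have hc : c ≠ 0 := hb ▸ Complex.exp_ne_zero b
  rw [Complex.exp_add, Complex.exp_log (div_ne_zero hw hc), hb, div_mul_cancel₀ _ hc]

lemma exists_holAt_log (hf : HolAt f q) (h0 : f q ≠ 0) :
    ∃ l, HolAt l q ∧ ∀ᶠ t in 𝓝 q, Complex.exp (l t) = f t := by
  refine ⟨_, .comp (analyticAt_log_div_add h0 (Complex.log (f q))) hf, ?_⟩
  filter_upwards [hf.continuousAt.eventually_ne h0] with t ht
  exact exp_log_div_add (Complex.exp_log h0) ht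

lemma HolAt.eventually_ne_zero_of_expansion (hx : IsCoordAt x q) (hf : HolAt f q)
    (h : expansion x f q ≠ 0) : ∀ᶠ t in 𝓝[≠] q, f t ≠ 0 :=
  hf.merAt.eventually_eq_zero_or_ne_zero.resolve_left fun h0 =>
    h ((expansion_eq_zero_iff hx hf).2 (hf.eventually_eq_zero h0))

end LogGerm

/-! ### Expansions of meromorphic functions and the integrand -/

section Representation

open Differential

variable {U : Type*} [TopologicalSpace U] [ChartedSpace ℂ U] {x k k' : U → ℂ} {n n' : SeriesField}
  {q : U}

/-- The Laurent series `n` is the expansion at `q` of `k`, which may have a pole at `q`: `k` is a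
quotient of holomorphic functions, and `n` is the quotient of their expansions. -/
def HasExpansion (x k : U → ℂ) (q : U) (n : SeriesField) : Prop :=
  ∃ a b : U → ℂ, HolAt a q ∧ HolAt b q ∧ expansion x b q ≠ 0 ∧
    (∀ᶠ t in 𝓝[≠] q, k t * b t = a t) ∧ n * expansion x b q = expansion x a q

namespace HasExpansion

lemma of_holAt (hk : HolAt k q) : HasExpansion x k q (expansion x k q) :=
  ⟨k, 1, hk, .const 1, by simp [expansion_one], by simp, by simp [expansion_one]⟩

variable [IsManifold 𝓘(ℂ) ω U]

lemma eventually_eq_zero (hx : IsCoordAt x q) (h : HasExpansion x k q 0) :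
    ∀ᶠ t in 𝓝[≠] q, k t = 0 := by
  obtain ⟨a, b, ha, hb, hb0, hk, hn⟩ := h
  rw [zero_mul, eq_comm, expansion_eq_zero_iff hx ha] at hn
  filter_upwards [hk, hn.filter_mono nhdsWithin_le_nhds, hb.eventually_ne_zero_of_expansion hx hb0]
    with t h1 h2 h3
  rw [h2] at h1
  exact (mul_eq_zero.1 h1).resolve_right h3

lemma add (hx : IsCoordAt x q) (h : HasExpansion x k q n) (h' : HasExpansion x k' q n') :
    HasExpansion x (k + k') q (n + n') := by
  obtain ⟨a, b, ha, hb, hb0, hk, hn⟩ := h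
  obtain ⟨a', b', ha', hb', hb0', hk', hn'⟩ := h'
  refine ⟨a * b' + a' * b, b * b', (ha.mul hb').add (ha'.mul hb), hb.mul hb', ?_, ?_, ?_⟩
  · rw [expansion_mul hx hb hb']
    exact mul_ne_zero hb0 hb0'
  · filter_upwards [hk, hk'] with t h1 h2
    simp only [Pi.add_apply, Pi.mul_apply, ← h1, ← h2]
    ring
  · rw [expansion_add hx (ha.mul hb') (ha'.mul hb), expansion_mul hx hb hb',
      expansion_mul hx ha hb', expansion_mul hx ha' hb, ← hn, ← hn']
    ring

lemma mul (hx : IsCoordAt x q) (h : HasExpansion x k q n) (h' : HasExpansion x k' q n') :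
    HasExpansion x (k * k') q (n * n') := by
  obtain ⟨a, b, ha, hb, hb0, hk, hn⟩ := h
  obtain ⟨a', b', ha', hb', hb0', hk', hn'⟩ := h'
  refine ⟨a * a', b * b', ha.mul ha', hb.mul hb', ?_, ?_, ?_⟩
  · rw [expansion_mul hx hb hb']
    exact mul_ne_zero hb0 hb0'
  · filter_upwards [hk, hk'] with t h1 h2
    simp only [Pi.mul_apply, ← h1, ← h2]
    ring
  · rw [expansion_mul hx hb hb', expansion_mul hx ha ha', ← hn, ← hn']
    ring

lemma inv (hx : IsCoordAt x q) (h : HasExpansion x k q n) : HasExpansion x k⁻¹ q n⁻¹ := by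
  rcases eq_or_ne n 0 with rfl | h0
  · refine ⟨0, 1, .const 0, .const 1, by simp [expansion_one], ?_, ?_⟩
    · filter_upwards [h.eventually_eq_zero hx] with t ht
      simp [ht]
    · rw [inv_zero, zero_mul, expansion_zero]
  · obtain ⟨a, b, ha, hb, hb0, hk, hn⟩ := h
    have ha0 : expansion x a q ≠ 0 := hn ▸ mul_ne_zero h0 hb0
    refine ⟨b, a, hb, ha, ha0, ?_, ?_⟩
    · filter_upwards [hk, ha.eventually_ne_zero_of_expansion hx ha0] with t h1 h2
      rw [← h1] at h2 ⊢
      rw [Pi.inv_apply, inv_mul_cancel_left₀ (left_ne_zero_of_mul h2)]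
    · rw [← hn, inv_mul_cancel_left₀ h0]

lemma deriv [T1Space U] (hx : IsCoordAt x q) (hk : MerAt k q) (h : HasExpansion x k q n) :
    HasExpansion x (derivAlong x k) q n′ := by
  obtain ⟨a, b, ha, hb, hb0, hkb, hn⟩ := h
  have ha' := ha.derivAlong hx
  have hb' := hb.derivAlong hx
  refine ⟨derivAlong x a * b - a * derivAlong x b, b * b, (ha'.mul hb).sub (ha.mul hb'),
    hb.mul hb, ?_, ?_, ?_⟩
  · rw [expansion_mul hx hb hb]
    exact mul_ne_zero hb0 hb0
  · filter_upwards [eventually_nhdsNE_eventually_nhds hkb, hk.eventually_holAt,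
      hb.merAt.eventually_holAt] with t h1 hkt hbt
    have h2 : k * b =ᶠ[𝓝 t] a := h1
    have h3 := (derivAlong_congr (x := x) h2).self_of_nhds
    rw [derivAlong_mul hkt hbt] at h3
    simp only [Pi.mul_apply, Pi.sub_apply, ← h3, ← h1.self_of_nhds]
    ring
  · rw [expansion_sub hx (ha'.mul hb) (ha.mul hb'), expansion_mul hx hb hb,
      expansion_mul hx ha' hb, expansion_mul hx ha hb', ← deriv_expansion, ← deriv_expansion, ← hn,
      deriv_mul_field]
    ring

end HasExpansion

variable [IsManifold 𝓘(ℂ) ω U]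

/-- The expansions at `q` of the functions in a functional differential field. -/
noncomputable def expansionField (K : FunctionalDifferentialField U x) (hx : IsCoordAt x q) :
    Subfield SeriesField where
  carrier := {n | ∃ k ∈ K.toSubalgebra, HasExpansion x k q n}
  mul_mem' := fun ⟨k, hk, h⟩ ⟨k', hk', h'⟩ => ⟨k * k', mul_mem hk hk', h.mul hx h'⟩
  one_mem' := by
    refine ⟨1, one_mem _, ?_⟩
    simpa [expansion_one] using
      HasExpansion.of_holAt (k := 1) (x := x) (HolAt.const (q := q) 1)
  add_mem' := fun ⟨k, hk, h⟩ ⟨k', hk', h'⟩ => ⟨k + k', add_mem hk hk', h.add hx h'⟩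
  zero_mem' := by
    refine ⟨0, zero_mem _, ?_⟩
    simpa [expansion_zero] using
      HasExpansion.of_holAt (k := 0) (x := x) (HolAt.const (q := q) 0)
  neg_mem' := by
    rintro n ⟨k, hk, h⟩
    refine ⟨(fun _ : U => (-1 : ℂ)) * k, mul_mem (K.algebraMap_mem (-1)) hk, ?_⟩
    simpa [expansion_const] using (HasExpansion.of_holAt (.const (-1))).mul hx h
  inv_mem' := fun _ ⟨k, hk, h⟩ => ⟨k⁻¹, K.inv_mem hk, h.inv hx⟩

lemma isDifferentialSubfield_expansionField [T1Space U] (K : FunctionalDifferentialField U x)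
    (hx : IsCoordAt x q) : IsDifferentialSubfield (expansionField K hx) where
  deriv_mem := fun _ ⟨k, hk, h⟩ =>
    ⟨_, K.deriv_mem hk, h.deriv hx (K.isMeromorphic_of_mem hk q)⟩
  const_mem := fun n hn => by
    obtain ⟨c, rfl⟩ := SeriesField.exists_eq_C_of_deriv_eq_zero hn
    refine ⟨fun _ => c, K.algebraMap_mem c, ?_⟩
    rw [← expansion_const (x := x) (q := q)]
    exact .of_holAt (.const c)

lemma HasExpansion.sum (hx : IsCoordAt x q) {ι : Type*} (s : Finset ι) {k : ι → U → ℂ}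
    {n : ι → SeriesField} (h : ∀ i, HasExpansion x (k i) q (n i)) :
    HasExpansion x (∑ i ∈ s, k i) q (∑ i ∈ s, n i) := by
  classical
  induction s using Finset.induction_on with
  | empty =>
    simpa [expansion_zero] using HasExpansion.of_holAt (k := 0) (x := x) (HolAt.const (q := q) 0)
  | insert i s hi ih =>
    rw [Finset.sum_insert hi, Finset.sum_insert hi]
    exact (h i).add hx ih

/-- **Liouville's theorem** for germs: if an integral of `f` has an elementary germ at `q`, then
`f` is a sum of logarithmic derivatives with constant coefficients and a derivative near `q`. -/
theorem exists_eq_sum_logDeriv [T1Space U] {K : FunctionalDifferentialField U x} {f y : U → ℂ}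
    (hx : IsCoordAt x q) (hf : f ∈ K.toSubalgebra) (hy : HolAt y q)
    (hyf : ∀ᶠ t in 𝓝 q, derivAlong x y t = f t)
    (h : IsElementaryGerm x K.toSubalgebra q y) :
    ∃ (m : ℕ) (c : Fin m → ℂ) (v : U → ℂ) (u : Fin m → U → ℂ),
      v ∈ K.toSubalgebra ∧ (∀ i, u i ∈ K.toSubalgebra) ∧
      ∀ᶠ t in 𝓝[≠] q, f t = derivAlong x v t + ∑ i, c i * ((u i t)⁻¹ * derivAlong x (u i) t) := by
  have hE : expansion x f q = (expansion x y q)′ := by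
    rw [deriv_expansion]
    exact (expansion_congr hyf).symm
  have hfq : HolAt f q := (hy.derivAlong hx).congr hyf
  have hmem := IsElementaryOver.deriv_mem_liouvilleForms h
    (isDifferentialSubfield_expansionField K hx)
    (fun n ⟨k, hk, hkq, hn⟩ => ⟨k, hk, hn ▸ .of_holAt hkq⟩) (hE ▸ ⟨f, hf, .of_holAt hfq⟩)
  obtain ⟨ι, _, c, u, v, hc, hu, hv, hsum⟩ := exists_sum_of_mem_liouvilleForms hmem
  choose γ hγ using fun i => SeriesField.exists_eq_C_of_deriv_eq_zero (hc i)
  choose u' hu'K hu' using hu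
  obtain ⟨v', hv'K, hv'⟩ := hv
  let e := (Fintype.equivFin ι).symm
  have hmer {k : U → ℂ} (hk : k ∈ K.toSubalgebra) : MerAt k q := K.isMeromorphic_of_mem hk q
  have hS : HasExpansion x (derivAlong x v' + ∑ i, (fun _ => γ (e i)) *
      ((u' (e i))⁻¹ * derivAlong x (u' (e i)))) q (expansion x f q) := by
    have h1 : expansion x f q = v′ + ∑ i, expansion x (fun _ => γ (e i)) q *
        ((u (e i))⁻¹ * (u (e i))′) := by
      rw [hE, hsum, add_comm, ← e.sum_comp]
      refine congrArg (v′ + ·) (Finset.sum_congr rfl fun i _ => ?_)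
      rw [hγ, expansion_const, Differential.logDeriv, div_eq_inv_mul]
    rw [h1]
    refine (hv'.deriv hx (hmer hv'K)).add hx (.sum hx _ fun i => ?_)
    exact (HasExpansion.of_holAt (.const _)).mul hx
      (((hu' _).inv hx).mul hx ((hu' _).deriv hx (hmer (hu'K _))))
  have h0 := hS.add hx ((HasExpansion.of_holAt (.const (-1))).mul hx
    (HasExpansion.of_holAt (x := x) hfq))
  rw [expansion_const, map_neg, map_one, map_neg, map_one, neg_one_mul, add_neg_cancel] at h0
  refine ⟨_, fun i => γ (e i), v', fun i => u' (e i), hv'K, fun i => hu'K _, ?_⟩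
  filter_upwards [h0.eventually_eq_zero hx] with t ht
  simp only [Pi.add_apply, Pi.mul_apply, Finset.sum_apply, Pi.inv_apply] at ht
  linear_combination -ht

end Representation

/-! ### Generalized elementary germs and sums with logarithms -/

section Continuation

variable {U : Type*} [TopologicalSpace U] [ChartedSpace ℂ U]
  {x f g l : U → ℂ} {K : FunctionalDifferentialField U x} {p q : U}

lemma IsGenElementaryOver.sum {ι : Type*} (s : Finset ι) {f : ι → U → ℂ}
    (hf : ∀ i, IsGenElementaryOver K q (f i)) : IsGenElementaryOver K q (∑ i ∈ s, f i) := by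
  classical
  induction s using Finset.induction_on with
  | empty => exact .base (by simp) (HolAt.const 0)
  | insert i s hi ih =>
    rw [Finset.sum_insert hi]
    exact .add (hf i) ih

variable [IsManifold 𝓘(ℂ) ω U]

lemma IsGenElementaryOver.congr (hf : IsGenElementaryOver K q f) (hg : HolAt g q)
    (h : f =ᶠ[𝓝 q] g) : IsGenElementaryOver K q g := by
  obtain ⟨V, hVo, hV, hq, hgV⟩ := exists_isOpen_isPreconnected_holAt hg
  exact .continuation hf ⟨V, hVo, hV, hq, hq, fun t ht => (hgV t ht).contMDiffWithinAt, h⟩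

/-- A germ with a generalized elementary continuation is generalized elementary. -/
lemma IsGenElementaryOver.of_analyticContinuation {a b : U × (U → ℂ)}
    (h : AnalyticContinuation a b) (hb : IsGenElementaryOver K b.1 b.2) :
    IsGenElementaryOver K a.1 a.2 := by
  induction h using Relation.ReflTransGen.head_induction_on with
  | refl => exact hb
  | @head a b' hab _ ih =>
    obtain ⟨V, hVo, hV, ha, hb', hg, hfg⟩ := hab
    have h1 : IsGenElementaryOver K a.1 b'.2 :=
      .continuation ih ⟨V, hVo, hV, hb', ha, hg, .refl _ _⟩
    exact h1.congr (HolAt.congr (hg.contMDiffAt (hVo.mem_nhds ha)) hfg.symm) hfg.symm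

/-- A logarithm of a function of `K` is generalized elementary over `K`. -/
lemma IsGenElementaryOver.of_log (hf : f ∈ K.toSubalgebra) (hl : HolAt l q)
    (h : ∀ᶠ t in 𝓝 q, Complex.exp (l t) = f t) : IsGenElementaryOver K q l := by
  have hexp : AnalyticAt ℂ Complex.exp (l q) := Complex.differentiable_exp.analyticAt _
  have hfq : HolAt f q := (HolAt.comp hexp hl).congr h
  have hlq : Complex.exp (l q) = f q := h.self_of_nhds
  have h0 : f q ≠ 0 := hlq ▸ Complex.exp_ne_zero _
  have hφ : IsBasicElementary (f q) fun w => Complex.log (w / f q) + l q :=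
    .log _ _ (analyticAt_log_div_add h0 _)
      ((continuousAt_id.eventually_ne h0).mono fun w hw => exp_log_div_add hlq hw)
  refine (IsGenElementaryOver.comp (.base hf hfq) (.basic hφ)).congr hl ?_
  -- near `q`, the imaginary part of `l - l(q)` lies in the range of the principal logarithm
  have hc : ContinuousAt (fun t => (l t - l q).im) q :=
    Complex.continuous_im.continuousAt.comp (hl.continuousAt.sub continuousAt_const)
  have hπ := Real.pi_pos
  filter_upwards [h, hc.eventually (Ioo_mem_nhds (a := -Real.pi) (b := Real.pi) (by simpa)
    (by simpa))] with t ht him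
  simp only [Function.comp_apply]
  rw [← ht, ← hlq, ← Complex.exp_sub, Complex.log_exp him.1 him.2.le, sub_add_cancel]

lemma HolAt.sum {ι : Type*} (s : Finset ι) {f : ι → U → ℂ} (hf : ∀ i, HolAt (f i) q) :
    HolAt (∑ i ∈ s, f i) q :=
  sum_mem (S := holSubring q) fun i _ => hf i

end Continuation

section Main

open Differential

variable {U : Type*} [TopologicalSpace U] [ChartedSpace ℂ U] [IsManifold 𝓘(ℂ) ω U]
  {x f y : U → ℂ} {K : FunctionalDifferentialField U x} {p q : U}

/-- A function whose derivative is that of a sum with logarithms is this sum, up to a constant. -/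
lemma eventually_eq_add_sum_log (hx : IsCoordAt x q) {y v : U → ℂ} {m : ℕ} {c : Fin m → ℂ}
    {u l : Fin m → U → ℂ} (hy : HolAt y q) (hv : HolAt v q) (hl : ∀ i, HolAt (l i) q)
    (hlu : ∀ i, ∀ᶠ t in 𝓝 q, Complex.exp (l i t) = u i t)
    (h : ∀ᶠ t in 𝓝 q, derivAlong x y t =
      derivAlong x v t + ∑ i, c i * ((u i t)⁻¹ * derivAlong x (u i) t)) :
    ∃ b : ℂ, ∀ᶠ t in 𝓝 q, y t = v t + b + ∑ i, c i * l i t := by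
  have hcl (i) : HolAt ((fun _ => c i) * l i) q := (HolAt.const _).mul (hl i)
  have hcl' (i) : HolAt ((fun _ => c i) * derivAlong x (l i)) q :=
    (HolAt.const _).mul ((hl i).derivAlong hx)
  have hS : HolAt (v + ∑ i, (fun _ => c i) * l i) q := hv.add (.sum _ hcl)
  have hd : (expansion x (y - (v + ∑ i, (fun _ => c i) * l i)) q)′ = 0 := by
    rw [expansion_sub hx hy hS, expansion_add hx hv (.sum _ hcl), expansion_sum hx _ hcl]
    simp only [expansion_mul hx (.const _) (hl _), map_sub, map_add, map_sum, deriv_mul_field,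
      deriv_expansion, derivAlong_const, show (fun _ : U => (0 : ℂ)) = 0 from rfl, expansion_zero,
      mul_zero, add_zero]
    simp only [← expansion_mul hx (.const _) ((hl _).derivAlong hx)]
    rw [← expansion_sum hx _ hcl', ← expansion_add hx (hv.derivAlong hx) (.sum _ hcl'),
      sub_eq_zero]
    refine expansion_congr ?_
    filter_upwards [h, eventually_all.2 hlu,
      eventually_all.2 fun i => mul_derivAlong_log (x := x) (hl i) (hlu i)] with t ht h1 h2
    rw [ht]
    simp only [Pi.add_apply, Finset.sum_apply, Pi.mul_apply] at h2 ⊢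
    refine congrArg _ (Finset.sum_congr rfl fun i _ => ?_)
    rw [← h2, inv_mul_cancel_left₀ (h1 i ▸ Complex.exp_ne_zero _)]
  obtain ⟨b, hb⟩ := SeriesField.exists_eq_C_of_deriv_eq_zero hd
  rw [← expansion_const (x := x) (q := q), ← sub_eq_zero,
    ← expansion_sub hx (hy.sub hS) (.const b), expansion_eq_zero_iff hx
    ((hy.sub hS).sub (.const b))] at hb
  refine ⟨b, hb.mono fun t ht => ?_⟩
  simp only [Pi.sub_apply, Pi.add_apply, Finset.sum_apply, Pi.mul_apply] at ht
  linear_combination ht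

end Main

theorem mainTheorem1 {U : Type*} [TopologicalSpace U] [T2Space U] [ConnectedSpace U]
    [ChartedSpace ℂ U] [IsManifold 𝓘(ℂ) ω U]
    (x : U → ℂ) (hx : IsMeromorphic x) (hx_nonconst : ¬ ∃ c : ℂ, SameMeromorphic x (fun _ => c))
    (K : FunctionalDifferentialField U x) (f : U → ℂ) (hf : f ∈ K.toSubalgebra)
    (p : U) (y : U → ℂ) (hy : IsIntegralGerm x f p y) :
    IsGenElementaryOver K p y ↔
      ∃ (m : ℕ) (c : Fin m → ℂ) (r₀ : U → ℂ) (r : Fin m → U → ℂ),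
        r₀ ∈ K.toSubalgebra ∧ (∀ i, r i ∈ K.toSubalgebra) ∧ IsSumWithLogs p y r₀ c r := by
  constructor
  · intro h
    have hco := eventually_isCoordAt hx hx_nonconst
    obtain ⟨hyp, hel⟩ := h.isElementaryNear hx hx_nonconst
    obtain ⟨V, hVo, hV, hpV, hyV⟩ := exists_isOpen_isPreconnected_holAt hyp
    have hVp : ∀ᶠ q in 𝓝[≠] p, q ∈ V := (hVo.eventually_mem hpV).filter_mono nhdsWithin_le_nhds
    -- Liouville's theorem is applied at a point `q` near `p` where all functions are regular
    obtain ⟨q, hqx, hqel, hqy, hqV⟩ := ((hco p).and (hel.and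
      ((eventually_nhdsNE_eventually_nhds hy.2).and hVp))).exists
    obtain ⟨m, c, v, u, hv, hu, hsum⟩ := exists_eq_sum_logDeriv hqx hf (hyV q hqV) hqy hqel
    -- a function vanishing identically contributes nothing and is replaced by `1`
    classical
    let r : Fin m → U → ℂ := fun i => if ∀ᶠ t in 𝓝[≠] q, u i t = 0 then 1 else u i
    have hrK (i) : r i ∈ K.toSubalgebra := by
      by_cases hi : ∀ᶠ t in 𝓝[≠] q, u i t = 0
      · simp only [r, if_pos hi, one_mem]
      · simpa only [r, if_neg hi] using hu i
    have hr0 (i) : ∀ᶠ t in 𝓝[≠] q, r i t ≠ 0 := by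
      by_cases hi : ∀ᶠ t in 𝓝[≠] q, u i t = 0
      · simp [r, if_pos hi]
      · simp only [r, if_neg hi]
        exact (MerAt.eventually_eq_zero_or_ne_zero
          (K.isMeromorphic_of_mem (hu i) q)).resolve_left hi
    have hru (i) : ∀ᶠ t in 𝓝[≠] q,
        (u i t)⁻¹ * derivAlong x (u i) t = (r i t)⁻¹ * derivAlong x (r i) t := by
      by_cases hi : ∀ᶠ t in 𝓝[≠] q, u i t = 0
      · simp only [r, if_pos hi]
        filter_upwards [hi] with t ht
        rw [ht, show (1 : U → ℂ) = fun _ => 1 from rfl, derivAlong_const]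
        simp
      · simp only [r, if_neg hi]
        exact .of_forall fun _ => trivial
    have hmer {k : U → ℂ} (hk : k ∈ K.toSubalgebra) : MerAt k q := K.isMeromorphic_of_mem hk q
    obtain ⟨q', hq'x, hq'V, hq'v, hq'r, hq'0, hq'y⟩ := ((hco q).and
      (((hVo.eventually_mem hqV).filter_mono nhdsWithin_le_nhds).and
      ((hmer hv).eventually_holAt.and
      ((eventually_all.2 fun i => (hmer (hrK i)).eventually_holAt).and ((eventually_all.2 hr0).and
      (eventually_nhdsNE_eventually_nhds ((hqy.filter_mono nhdsWithin_le_nhds).and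
        (hsum.and (eventually_all.2 hru))))))))).exists
    choose l hl hlr using fun i => exists_holAt_log (hq'r i) (hq'0 i)
    obtain ⟨b, hb⟩ := eventually_eq_add_sum_log (c := c) hq'x (hyV q' hq'V) hq'v hl hlr
      (hq'y.mono fun t ⟨h1, h2, h3⟩ => by simp only [h1, h2, h3])
    refine ⟨m, c, v + fun _ => b, r, add_mem hv (K.algebraMap_mem b), hrK, q', y, l,
      .single ⟨V, hVo, hV, hpV, hq'V, fun t ht => (hyV t ht).contMDiffWithinAt, .refl _ _⟩,
      hq'v.add (.const b), fun i => ⟨hl i, hlr i⟩, hb⟩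
  · rintro ⟨m, c, r₀, r, hr₀, hr, q, z, l, hyz, hr₀q, hl, hz⟩
    refine IsGenElementaryOver.of_analyticContinuation hyz ?_
    have hS : HolAt (r₀ + ∑ i, (fun _ => c i) * l i) q :=
      HolAt.add hr₀q (.sum _ fun i => (HolAt.const _).mul (hl i).1)
    have hSz : r₀ + ∑ i, (fun _ => c i) * l i =ᶠ[𝓝 q] z := by
      filter_upwards [hz] with t ht
      simp [ht]
    refine IsGenElementaryOver.congr (.add (.base hr₀ hr₀q) (.sum _ fun i => .mul ?_ ?_))
      (hS.congr hSz) hSz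
    · exact .base (K.algebraMap_mem (c i)) (HolAt.const _)
    · exact .of_log (hr i) (hl i).1 (hl i).2
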